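/- **Setting.** Let $\alpha=\alpha_1+i\alpha_2$ with $\alpha_1>0$, let $g_1,g_2\in C^3(\mathbb R,\mathbb R)$ with $g_1(0)<0$, and put $$A=\begin{pmatrix}\alpha_1&-\alpha_2\\ \alpha_2&\alpha_1\end{pmatrix},\quad g=\begin{pmatrix}g_1&-g_2\\ g_2&g_1\end{pmatrix},\quad f(u)=g(|u|^2)u\ \ (u\in\mathbb R^2),\quad S_\omega=\begin{pmatrix}0&-\omega\\ \omega&0\end{pmatrix},\quad R_\theta=\begin{pmatrix}\cos\theta&-\sin\theta\\ \sin\theta&\cos\theta\end{pmatrix}.$$ Let $u_\star(x,t)=R_{-\omega t}v_\star(x-ct)$ be a traveling oscillating front of $u_t=Au_{xx}+f(u)$ ($x\in\mathbb R$, $t\ge 0$), with profile $v_\star\in C_b^2(\mathbb R,\mathbb R^2)$, speed $c>0$, frequency $\omega\in\mathbb R$, $\lim_{x\to-\infty}v_\star(x)=0$ and $\lim_{x\to\infty}v_\star(x)=v_\infty$, where $v_\infty=(|v_\infty|,0)^\top\ne 0$ and $g_1'(|v_\infty|^2)<0$. Call $\mu_\star>0$ a decay rate of $v_\star$ if for some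 $K>0$ the bound $|v_\star(x)-v_\infty|+|v_\star'(x)|+|v_\star''(x)|+|v_\star'''(x)|\le Ke^{-\mu_\star x}$ holds for all $x\ge0$ and $|v_\star(x)|+|v_\star'(x)|+|v_\star''(x)|+|v_\star'''(x)|\le Ke^{\mu_\star x}$ holds for all $x\le0$. For $\mu\ge0$ and $\hat\mu>0$ let $\eta(x)=e^{\mu\sqrt{x^2+1}}$, $\hat v(x)=\frac12\tanh(\hat\mu x)+\frac12$, $L^2_\eta=\{v\in L^2:\eta v\in L^2\}$ with $\|v\|_{L^2_\eta}=\|\eta v\|_{L^2}$, and $$X_\eta=\{(v,\rho): v:\mathbb R\to\mathbb K^2 \text{ measurable},\ \rho\in\mathbb K^2,\ v-\rho\hat v\in L^2_\eta\},\qquad \|(v,\rho)\|_{X_\eta}^2=|\rho|^2+\|v-\rho\hat v\|_{L^2_\eta}^2,$$ $$X_\eta^\ell=\{(v,\rho)\in X_\eta: v\in H^\ell_{\rm loc},\ \partial^kv\in L^2_\eta,\ 1\le k\le \ell\},\qquad \|(v,\rho)\|_{X^\ell_\eta}^2=\|(v,\rho)\|_{X_\eta}^2+\sum_{k=1}^\ell\|\partial^kv\|_{L^2_\eta}^2,\qquad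 Y_\eta=X_\eta^2,$$ where $\mathbb K=\mathbb R$ or, for the equations with complex $s$ below, $\mathbb K=\mathbb C$. Consider $$\mathcal L_\eta(v,\rho)=\bigl(Av_{xx}+cv_x+S_\omega v+Df(v_\star)v,\ S_\omega\rho+Df(v_\infty)\rho\bigr).$$ **Lemma.** The profile $v_\star$ has a decay rate. Let $\mu_\star$ be any decay rate of $v_\star$, let $0<2\hat\mu\le\mu_\star$ and let $\mu_2\in(0,2\hat\mu)$. Then there are constants $\varepsilon_0,R_0,C>0$ such that the following holds for all $0\le\mu\le\mu_2$. 1. $\mathcal L_\eta$ maps $Y_\eta$ into $X_\eta$, and $\mathcal L_\eta:Y_\eta\subset X_\eta\to X_\eta$ is closed and densely defined (for $\mathbb K=\mathbb R$ and for $\mathbb K=\mathbb C$). 2. Let $s\in\mathbb C$ with $|s|\ge R_0$ and $|\arg s|\le\frac\pi2+\varepsilon_0$, and let $\mathbf v=(v,\rho)\in Y_\eta$ and $\mathbf r\in X_\eta$ ($\mathbb K=\mathbb C$) satisfy $(sI-\mathcal L_\eta)\mathbf v=\mathbf r$. Then $$|s|\,\|\mathbf v\|_{X_\eta}^2+\|v_x\|_{L^2_\eta}^2\le\frac{C}{|s|}\|\mathbf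 r\|_{X_\eta}^2,$$ $$|s|^2\|\mathbf v\|_{X_\eta}^2+|s|\,\|v_x\|_{L^2_\eta}^2+\|v_{xx}\|_{L^2_\eta}^2\le C\|\mathbf r\|_{X_\eta}^2.$$ If in addition $\mathbf r\in X^1_\eta$ and $\mathbf v\in X^3_\eta$, then $$|s|^2\|\mathbf v\|_{X^1_\eta}^2+|s|\,\|v_{xx}\|_{L^2_\eta}^2+\|v_{xxx}\|_{L^2_\eta}^2\le C\|\mathbf r\|_{X^1_\eta}^2.$$ -/

import Mathlib

open MeasureTheory Filter Topology
open scoped ContDiff InnerProductSpace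

noncomputable section

namespace TOF

/-! ### The system, its coefficients and traveling oscillating fronts -/

/-- The plane `𝕜²` with its Euclidean norm; `𝕜 = ℝ` is the real phase space and `𝕜 = ℂ` its
complexification. -/
abbrev Plane (𝕜 : Type) : Type := EuclideanSpace 𝕜 (Fin 2)

/-- The real `2 × 2` matrix of multiplication by `a + i b`. -/
def mulMat (a b : ℝ) : Matrix (Fin 2) (Fin 2) ℝ := !![a, -b; b, a]

/-- `S_ω`. -/
def rotGen (freq : ℝ) : Matrix (Fin 2) (Fin 2) ℝ := !![0, -freq; freq, 0]

/-- The rotation `R_θ`. -/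
def rot (θ : ℝ) : Matrix (Fin 2) (Fin 2) ℝ :=
  !![Real.cos θ, -Real.sin θ; Real.sin θ, Real.cos θ]

/-- A real `2 × 2` matrix acting on `𝕜²`. -/
def act (𝕜 : Type) [RCLike 𝕜] (M : Matrix (Fin 2) (Fin 2) ℝ) : Plane 𝕜 →ₗ[𝕜] Plane 𝕜 :=
  Matrix.toEuclideanLin (M.map (algebraMap ℝ 𝕜))

/-- The nonlinearity `f(u) = g(|u|²) u`, where `g = (g₁, -g₂; g₂, g₁)`. -/
def nonlin (g₁ g₂ : ℝ → ℝ) (u : Plane ℝ) : Plane ℝ :=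
  act ℝ (mulMat (g₁ (‖u‖ ^ 2)) (g₂ (‖u‖ ^ 2))) u

/-- The Jacobian matrix `Df(u)`. -/
def jac (g₁ g₂ : ℝ → ℝ) (u : Plane ℝ) : Matrix (Fin 2) (Fin 2) ℝ :=
  Matrix.of fun i j => (fderiv ℝ (nonlin g₁ g₂) u (EuclideanSpace.single j 1)) i

/-- `v ∈ C²_b(ℝ, ℝ²)`. -/
def IsC2b (v : ℝ → Plane ℝ) : Prop :=
  ContDiff ℝ 2 v ∧ ∀ k ≤ 2, ∃ M : ℝ, ∀ x, ‖iteratedDeriv k v x‖ ≤ M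

/-- `u(x,t) = R_{-ωt} v(x - ct)` is a traveling oscillating front of `u_t = A u_xx + f(u)` with
(`C²`) profile `v`, speed `c`, frequency `freq` and asymptotic rest-state `vinf ≠ 0`. -/
def IsFront (α₁ α₂ : ℝ) (g₁ g₂ : ℝ → ℝ) (v : ℝ → Plane ℝ) (c freq : ℝ) (vinf : Plane ℝ) : Prop :=
  ContDiff ℝ 2 v ∧
  (let u : ℝ → ℝ → Plane ℝ := fun x t => act ℝ (rot (-(freq * t))) (v (x - c * t))
   ∀ x t : ℝ, 0 ≤ t →
    deriv (fun τ => u x τ) t =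
      act ℝ (mulMat α₁ α₂) (iteratedDeriv 2 (fun y => u y t) x) + nonlin g₁ g₂ (u x t)) ∧
  Tendsto v atBot (𝓝 0) ∧ Tendsto v atTop (𝓝 vinf) ∧ vinf ≠ 0

/-- `μstar` is an exponential rate for the convergence of the profile `v` to its limits
`0` and `vinf` and of its first three derivatives to zero. -/
def IsDecayRate (v : ℝ → Plane ℝ) (vinf : Plane ℝ) (μstar : ℝ) : Prop :=
  ∃ K > 0,
    (∀ x, 0 ≤ x → ‖v x - vinf‖ + ‖iteratedDeriv 1 v x‖ + ‖iteratedDeriv 2 v x‖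
        + ‖iteratedDeriv 3 v x‖ ≤ K * Real.exp (-(μstar * x))) ∧
    (∀ x, x ≤ 0 → ‖v x‖ + ‖iteratedDeriv 1 v x‖ + ‖iteratedDeriv 2 v x‖
        + ‖iteratedDeriv 3 v x‖ ≤ K * Real.exp (μstar * x))

/-! ### Weighted spaces and weak derivatives -/

/-- The weight `η(x) = exp(μ √(x² + 1))`. -/
def weight (μ x : ℝ) : ℝ := Real.exp (μ * Real.sqrt (x ^ 2 + 1))

/-- The template function `v̂(x) = tanh(μ̂ x)/2 + 1/2`. -/
def template (μhat x : ℝ) : ℝ := Real.tanh (μhat * x) / 2 + 1 / 2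

/-- The operator acts on classes of a.e. equal measurable functions `ℝ → 𝕜²`. -/
abbrev Fn (𝕜 : Type) [RCLike 𝕜] : Type := ℝ →ₘ[volume] Plane 𝕜

section Spaces

variable {𝕜 : Type} [RCLike 𝕜]

/-- `f ∈ L²_η`. -/
def MemL2w (μ : ℝ) (f : ℝ → Plane 𝕜) : Prop :=
  MemLp f 2 volume ∧ MemLp (fun x => weight μ x • f x) 2 volume

/-- The norm of `f ∈ L²_η`. -/
def normL2w (μ : ℝ) (f : ℝ → Plane 𝕜) : ℝ :=
  (eLpNorm (fun x => weight μ x • f x) 2 volume).toReal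

/-- `w` is the weak derivative of order `k` of `v`. -/
def HasWeakDeriv (k : ℕ) (v w : ℝ → Plane 𝕜) : Prop :=
  LocallyIntegrable v volume ∧ LocallyIntegrable w volume ∧
    ∀ φ : ℝ → ℝ, ContDiff ℝ ∞ φ → HasCompactSupport φ →
      ∫ x, iteratedDeriv k φ x • v x = (-1 : ℝ) ^ k • ∫ x, φ x • w x

open Classical in
/-- The weak derivative `∂ᵏ v` (zero if there is none). -/
def weakDeriv (k : ℕ) (v : Fn 𝕜) : Fn 𝕜 :=
  if h : ∃ w : Fn 𝕜, HasWeakDeriv k v w then h.choose else 0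

theorem MemL2w.congr {μ : ℝ} {f g : ℝ → Plane 𝕜} (hf : MemL2w μ f) (h : f =ᵐ[volume] g) :
    MemL2w μ g :=
  ⟨hf.1.ae_eq h, hf.2.ae_eq (h.mono fun x hx => by simp only [hx])⟩

theorem MemL2w.zero (μ : ℝ) : MemL2w μ (fun _ => (0 : Plane 𝕜)) := by
  constructor <;> simp

theorem MemL2w.add {μ : ℝ} {f g : ℝ → Plane 𝕜} (hf : MemL2w μ f) (hg : MemL2w μ g) :
    MemL2w μ (fun x => f x + g x) :=
  ⟨hf.1.add hg.1, (hf.2.add hg.2).ae_eq (.of_forall fun x => by simp [smul_add])⟩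

theorem MemL2w.smul {μ : ℝ} {f : ℝ → Plane 𝕜} (a : 𝕜) (hf : MemL2w μ f) :
    MemL2w μ (fun x => a • f x) :=
  ⟨hf.1.const_smul a, (hf.2.const_smul a).ae_eq
    (.of_forall fun x => by simp [smul_comm a])⟩

theorem HasWeakDeriv.congr {k : ℕ} {v w v' w' : ℝ → Plane 𝕜} (h : HasWeakDeriv k v w)
    (hv : v =ᵐ[volume] v') (hw : w =ᵐ[volume] w') : HasWeakDeriv k v' w' := by
  refine ⟨h.1.congr hv, h.2.1.congr hw, fun φ hφ hc => ?_⟩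
  have e1 : ∫ x, iteratedDeriv k φ x • v x = ∫ x, iteratedDeriv k φ x • v' x :=
    integral_congr_ae (hv.mono fun x hx => by simp only [hx])
  have e2 : ∫ x, φ x • w x = ∫ x, φ x • w' x :=
    integral_congr_ae (hw.mono fun x hx => by simp only [hx])
  rw [← e1, ← e2]
  exact h.2.2 φ hφ hc

theorem integrable_smul_test {φ : ℝ → ℝ} {v : ℝ → Plane 𝕜} (hφ : ContDiff ℝ ∞ φ)
    (hc : HasCompactSupport φ) (hv : LocallyIntegrable v volume) (k : ℕ) :
    Integrable (fun x => iteratedDeriv k φ x • v x) volume := by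
  refine hv.integrable_smul_left_of_hasCompactSupport (hφ.continuous_iteratedDeriv k ?_) ?_
  · exact_mod_cast le_top
  · refine hc.mono' ?_
    refine subset_trans ?_ (support_iteratedFDeriv_subset (𝕜 := ℝ) (n := k))
    intro x hx h0
    apply hx
    rw [iteratedDeriv_eq_iteratedFDeriv, h0]
    simp

theorem HasWeakDeriv.zero (k : ℕ) :
    HasWeakDeriv k (fun _ => (0 : Plane 𝕜)) (fun _ => 0) :=
  ⟨locallyIntegrable_zero, locallyIntegrable_zero, fun φ _ _ => by simp⟩

theorem HasWeakDeriv.add {k : ℕ} {v w v' w' : ℝ → Plane 𝕜} (h : HasWeakDeriv k v w)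
    (h' : HasWeakDeriv k v' w') :
    HasWeakDeriv k (fun x => v x + v' x) (fun x => w x + w' x) := by
  refine ⟨h.1.add h'.1, h.2.1.add h'.2.1, fun φ hφ hc => ?_⟩
  have e0 : ∀ {u : ℝ → Plane 𝕜}, LocallyIntegrable u volume →
      Integrable (fun x => φ x • u x) volume := fun hu => by
    simpa using integrable_smul_test hφ hc hu 0
  simp only [smul_add]
  rw [integral_add (integrable_smul_test hφ hc h.1 k) (integrable_smul_test hφ hc h'.1 k),
    integral_add (e0 h.2.1) (e0 h'.2.1), h.2.2 φ hφ hc, h'.2.2 φ hφ hc, smul_add]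

theorem HasWeakDeriv.smul {k : ℕ} {v w : ℝ → Plane 𝕜} (a : 𝕜) (h : HasWeakDeriv k v w) :
    HasWeakDeriv k (fun x => a • v x) (fun x => a • w x) := by
  refine ⟨h.1.smul a, h.2.1.smul a, fun φ hφ hc => ?_⟩
  simp only [smul_comm _ a]
  rw [integral_smul, integral_smul, h.2.2 φ hφ hc, smul_comm]

/-- Weak derivatives are unique. -/
theorem HasWeakDeriv.unique {k : ℕ} {v w w' : ℝ → Plane 𝕜} (h : HasWeakDeriv k v w)
    (h' : HasWeakDeriv k v w') : w =ᵐ[volume] w' := by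
  refine ae_eq_of_integral_contDiff_smul_eq h.2.1 h'.2.1 fun φ hφ hc => ?_
  have e := (h.2.2 φ hφ hc).symm.trans (h'.2.2 φ hφ hc)
  exact smul_right_injective _ (pow_ne_zero k (by norm_num : (-1 : ℝ) ≠ 0)) e

theorem weakDeriv_eq {k : ℕ} {v w : Fn 𝕜} (h : HasWeakDeriv k v w) : weakDeriv k v = w := by
  have hex : ∃ w : Fn 𝕜, HasWeakDeriv k v w := ⟨w, h⟩
  rw [weakDeriv, dif_pos hex]
  exact AEEqFun.ext (hex.choose_spec.unique h)

end Spaces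

/-! ### The extended phase space `X_η` -/

/-- The pairs `(v, ρ)` with `v - ρ v̂ ∈ L²_η`. -/
def spaceXSub (𝕜 : Type) [RCLike 𝕜] (μ μhat : ℝ) : Submodule 𝕜 (Fn 𝕜 × Plane 𝕜) where
  carrier := {p | MemL2w μ fun x => p.1 x - template μhat x • p.2}
  zero_mem' := by
    refine (MemL2w.zero μ).congr ?_
    filter_upwards [AEEqFun.coeFn_zero (α := ℝ) (β := Plane 𝕜) (μ := volume)] with x hx
    simp [hx]
  add_mem' := by
    intro p q hp hq
    refine (MemL2w.add hp hq).congr ?_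
    filter_upwards [AEEqFun.coeFn_add p.1 q.1] with x hx
    simp only [Prod.fst_add, Prod.snd_add, hx, Pi.add_apply, smul_add]
    abel
  smul_mem' := by
    intro a p hp
    refine (MemL2w.smul a hp).congr ?_
    filter_upwards [AEEqFun.coeFn_smul a p.1] with x hx
    simp only [Prod.smul_fst, Prod.smul_snd, hx, Pi.smul_apply, smul_sub, smul_comm a]

/-- The space `X_η`. -/
def SpaceX (𝕜 : Type) [RCLike 𝕜] (μ μhat : ℝ) : Type := spaceXSub 𝕜 μ μhat

section SpaceX

variable {𝕜 : Type} [RCLike 𝕜] {μ μhat : ℝ}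

/-- The first component `v` of `(v, ρ) ∈ X_η`. -/
def SpaceX.fn (p : SpaceX 𝕜 μ μhat) : Fn 𝕜 := p.1.1

/-- The second component `ρ` of `(v, ρ) ∈ X_η`. -/
def SpaceX.lim (p : SpaceX 𝕜 μ μhat) : Plane 𝕜 := p.1.2

theorem SpaceX.mem (p : SpaceX 𝕜 μ μhat) :
    MemL2w μ fun x => p.fn x - template μhat x • p.lim := p.2

instance : AddCommGroup (SpaceX 𝕜 μ μhat) := inferInstanceAs (AddCommGroup (spaceXSub 𝕜 μ μhat))

instance : Module 𝕜 (SpaceX 𝕜 μ μhat) := inferInstanceAs (Module 𝕜 (spaceXSub 𝕜 μ μhat))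

theorem SpaceX.coe_fn_add (p q : SpaceX 𝕜 μ μhat) :
    (p + q).fn =ᵐ[volume] fun x => p.fn x + q.fn x := AEEqFun.coeFn_add p.fn q.fn

theorem SpaceX.coe_fn_smul (a : 𝕜) (p : SpaceX 𝕜 μ μhat) :
    (a • p).fn =ᵐ[volume] fun x => a • p.fn x := AEEqFun.coeFn_smul a p.fn

theorem SpaceX.coe_fn_zero : (0 : SpaceX 𝕜 μ μhat).fn =ᵐ[volume] fun _ => 0 :=
  AEEqFun.coeFn_zero

theorem SpaceX.lim_add (p q : SpaceX 𝕜 μ μhat) : (p + q).lim = p.lim + q.lim := rfl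

theorem SpaceX.lim_smul (a : 𝕜) (p : SpaceX 𝕜 μ μhat) : (a • p).lim = a • p.lim := rfl

theorem SpaceX.lim_zero : (0 : SpaceX 𝕜 μ μhat).lim = 0 := rfl

theorem SpaceX.ext {p q : SpaceX 𝕜 μ μhat} (h : p.fn =ᵐ[volume] q.fn) (h' : p.lim = q.lim) :
    p = q :=
  Subtype.ext (Prod.ext (AEEqFun.ext h) h')

/-- The map `(v, ρ) ↦ (η (v - ρ v̂), ρ)` into `L² × 𝕜²`; `X_η` carries the inner product
which makes it isometric. -/
def SpaceX.embed : SpaceX 𝕜 μ μhat →ₗ[𝕜] WithLp 2 (Lp (Plane 𝕜) 2 (volume : Measure ℝ) × Plane 𝕜)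
    where
  toFun p := WithLp.toLp 2 (p.mem.2.toLp _, p.lim)
  map_add' p q := by
    rw [← WithLp.toLp_add, Prod.mk_add_mk, ← MemLp.toLp_add]
    congr 2
    refine MemLp.toLp_congr _ _ ?_
    filter_upwards [SpaceX.coe_fn_add p q] with x hx
    simp only [hx, SpaceX.lim_add, Pi.add_apply, ← smul_add]
    congr 1
    rw [smul_add]
    abel
  map_smul' a p := by
    rw [RingHom.id_apply, ← WithLp.toLp_smul, Prod.smul_mk, ← MemLp.toLp_const_smul]
    congr 2
    refine MemLp.toLp_congr _ _ ?_
    filter_upwards [SpaceX.coe_fn_smul a p] with x hx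
    simp only [hx, SpaceX.lim_smul, Pi.smul_apply, smul_sub, smul_comm a]

theorem SpaceX.embed_injective :
    Function.Injective (SpaceX.embed : SpaceX 𝕜 μ μhat →ₗ[𝕜] _) := by
  intro p q h
  have h1 := congrArg (fun z => (WithLp.ofLp z).1) h
  have h2 : p.lim = q.lim := congrArg (fun z => (WithLp.ofLp z).2) h
  refine SpaceX.ext ?_ h2
  have h3 := (MemLp.toLp_eq_toLp_iff p.mem.2 q.mem.2).1 h1
  filter_upwards [h3] with x hx
  have h4 := smul_right_injective _ (Real.exp_pos _).ne' hx
  rw [h2] at h4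
  exact sub_left_injective h4

instance : NormedAddCommGroup (SpaceX 𝕜 μ μhat) :=
  NormedAddCommGroup.induced _ _ SpaceX.embed SpaceX.embed_injective

/-- `((u, ρ), (v, ζ))_{X_η} = (ρ, ζ) + (u - ρ v̂, v - ζ v̂)_{L²_η}`. -/
instance : InnerProductSpace 𝕜 (SpaceX 𝕜 μ μhat) where
  norm_smul_le a p := by
    change ‖SpaceX.embed (a • p)‖ ≤ ‖a‖ * ‖SpaceX.embed p‖
    rw [map_smul]
    exact norm_smul_le _ _
  inner p q := inner 𝕜 (SpaceX.embed p) (SpaceX.embed q)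
  norm_sq_eq_re_inner p := norm_sq_eq_re_inner (𝕜 := 𝕜) (SpaceX.embed p)
  conj_inner_symm p q := inner_conj_symm _ _
  add_left p q r := by rw [map_add, inner_add_left]
  smul_left p q a := by rw [map_smul, inner_smul_left]

/-- The norm of `X_η`, explicitly. -/
theorem SpaceX.norm_sq (p : SpaceX 𝕜 μ μhat) :
    ‖p‖ ^ 2 = ‖p.lim‖ ^ 2 + normL2w μ (fun x => p.fn x - template μhat x • p.lim) ^ 2 := by
  change ‖SpaceX.embed p‖ ^ 2 = _
  rw [WithLp.prod_norm_sq_eq_of_L2, add_comm]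
  simp [SpaceX.embed, normL2w, Lp.norm_toLp]

end SpaceX

/-- The smooth analog `X^ℓ_η`. (As `η ≥ 1`, the condition contains `v ∈ H^ℓ_loc`.) -/
def sobX (𝕜 : Type) [RCLike 𝕜] (μ μhat : ℝ) (l : ℕ) : Submodule 𝕜 (SpaceX 𝕜 μ μhat) where
  carrier := {p | ∀ k, 1 ≤ k → k ≤ l → ∃ w : Fn 𝕜, HasWeakDeriv k p.fn w ∧ MemL2w μ w}
  zero_mem' := by
    intro k _ _
    have h0 : (fun _ => 0) =ᵐ[volume] (0 : Fn 𝕜) := AEEqFun.coeFn_zero.symm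
    exact ⟨0, (HasWeakDeriv.zero k).congr SpaceX.coe_fn_zero.symm h0, (MemL2w.zero μ).congr h0⟩
  add_mem' := by
    intro p q hp hq k h1 hl
    obtain ⟨w, hw, hw2⟩ := hp k h1 hl
    obtain ⟨w', hw', hw2'⟩ := hq k h1 hl
    have h0 : (fun x => w x + w' x) =ᵐ[volume] (w + w' : Fn 𝕜) := (AEEqFun.coeFn_add w w').symm
    exact ⟨w + w', (hw.add hw').congr (SpaceX.coe_fn_add p q).symm h0, (hw2.add hw2').congr h0⟩
  smul_mem' := by
    intro a p hp k h1 hl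
    obtain ⟨w, hw, hw2⟩ := hp k h1 hl
    have h0 : (fun x => a • w x) =ᵐ[volume] (a • w : Fn 𝕜) := (AEEqFun.coeFn_smul a w).symm
    exact ⟨a • w, (hw.smul a).congr (SpaceX.coe_fn_smul a p).symm h0, (hw2.smul a).congr h0⟩

/-- The norm of `X^ℓ_η`:
`‖(v, ρ)‖² = |ρ|² + ‖v - ρ v̂‖²_{L²_η} + ∑_{k=1}^ℓ ‖∂ᵏ v‖²_{L²_η}`. -/
def sobNorm {𝕜 : Type} [RCLike 𝕜] {μ μhat : ℝ} (l : ℕ) (p : SpaceX 𝕜 μ μhat) : ℝ :=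
  Real.sqrt (‖p.lim‖ ^ 2 + normL2w μ (fun x => p.fn x - template μhat x • p.lim) ^ 2
    + ∑ k ∈ Finset.Icc 1 l, normL2w μ (weakDeriv k p.fn) ^ 2)

/-! ### The linearized operator -/

section Operator

variable (𝕜 : Type) [RCLike 𝕜] (α₁ α₂ : ℝ) (g₁ g₂ : ℝ → ℝ) (vstar : ℝ → Plane ℝ) (c freq : ℝ)
  (vinf : Plane ℝ) (μ μhat : ℝ)

/-- The graph of the operator
`(v, ρ) ↦ (A v_xx + c v_x + S_ω v + Df(v_⋆) v, S_ω ρ + Df(v_∞) ρ)` in `X_η × X_η`: the first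
member of a pair is an element `(v, ρ)` of `X²_η` whose image lies in `X_η`. -/
def linGraph : Submodule 𝕜 (SpaceX 𝕜 μ μhat × SpaceX 𝕜 μ μhat) where
  carrier := {z | ∃ w₁ w₂ : Fn 𝕜, (HasWeakDeriv 1 z.1.fn w₁ ∧ MemL2w μ w₁) ∧
    (HasWeakDeriv 2 z.1.fn w₂ ∧ MemL2w μ w₂) ∧
    (z.2.fn =ᵐ[volume] fun x => act 𝕜 (mulMat α₁ α₂) (w₂ x) + (c : 𝕜) • w₁ x
      + act 𝕜 (rotGen freq) (z.1.fn x) + act 𝕜 (jac g₁ g₂ (vstar x)) (z.1.fn x)) ∧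
    z.2.lim = act 𝕜 (rotGen freq) z.1.lim + act 𝕜 (jac g₁ g₂ vinf) z.1.lim}
  zero_mem' := by
    have h0 : (fun _ => 0) =ᵐ[volume] (0 : Fn 𝕜) := AEEqFun.coeFn_zero.symm
    have hX := SpaceX.coe_fn_zero (𝕜 := 𝕜) (μ := μ) (μhat := μhat)
    refine ⟨0, 0, ⟨(HasWeakDeriv.zero 1).congr hX.symm h0, (MemL2w.zero μ).congr h0⟩,
      ⟨(HasWeakDeriv.zero 2).congr hX.symm h0, (MemL2w.zero μ).congr h0⟩, ?_, ?_⟩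
    · filter_upwards [h0, hX] with x h1 h2
      simp only [Prod.fst_zero, Prod.snd_zero, h2, ← h1, map_zero, smul_zero, add_zero]
    · simp only [Prod.fst_zero, Prod.snd_zero, SpaceX.lim_zero, map_zero, add_zero]
  add_mem' := by
    rintro z z' ⟨w₁, w₂, ⟨a1, a2⟩, ⟨b1, b2⟩, e, l⟩ ⟨w₁', w₂', ⟨a1', a2'⟩, ⟨b1', b2'⟩, e', l'⟩
    have h1 : (fun x => w₁ x + w₁' x) =ᵐ[volume] (w₁ + w₁' : Fn 𝕜) :=
      (AEEqFun.coeFn_add w₁ w₁').symm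
    have h2 : (fun x => w₂ x + w₂' x) =ᵐ[volume] (w₂ + w₂' : Fn 𝕜) :=
      (AEEqFun.coeFn_add w₂ w₂').symm
    have hX := SpaceX.coe_fn_add z.1 z'.1
    refine ⟨w₁ + w₁', w₂ + w₂', ⟨(a1.add a1').congr hX.symm h1, (a2.add a2').congr h1⟩,
      ⟨(b1.add b1').congr hX.symm h2, (b2.add b2').congr h2⟩, ?_, ?_⟩
    · filter_upwards [h1, h2, hX, e, e', SpaceX.coe_fn_add z.2 z'.2] with x h1 h2 h3 h4 h5 h6
      simp only [Prod.fst_add, Prod.snd_add, h6, h3, h4, h5, ← h1, ← h2, map_add, smul_add]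
      abel
    · simp only [Prod.fst_add, Prod.snd_add, SpaceX.lim_add, l, l', map_add]
      abel
  smul_mem' := by
    rintro a z ⟨w₁, w₂, ⟨a1, a2⟩, ⟨b1, b2⟩, e, l⟩
    have h1 : (fun x => a • w₁ x) =ᵐ[volume] (a • w₁ : Fn 𝕜) := (AEEqFun.coeFn_smul a w₁).symm
    have h2 : (fun x => a • w₂ x) =ᵐ[volume] (a • w₂ : Fn 𝕜) := (AEEqFun.coeFn_smul a w₂).symm
    have hX := SpaceX.coe_fn_smul a z.1
    refine ⟨a • w₁, a • w₂, ⟨(a1.smul a).congr hX.symm h1, (a2.smul a).congr h1⟩,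
      ⟨(b1.smul a).congr hX.symm h2, (b2.smul a).congr h2⟩, ?_, ?_⟩
    · filter_upwards [h1, h2, hX, e, SpaceX.coe_fn_smul a z.2] with x h1 h2 h3 h4 h6
      simp only [Prod.smul_fst, Prod.smul_snd, h6, h3, h4, ← h1, ← h2, map_smul, smul_add,
        smul_comm a (c : 𝕜)]
    · simp only [Prod.smul_fst, Prod.smul_snd, SpaceX.lim_smul, l, map_smul, smul_add]

/-- The linearized operator `𝓛_η` in `X_η`, as a partially defined linear operator. -/
def linOp : SpaceX 𝕜 μ μhat →ₗ.[𝕜] SpaceX 𝕜 μ μhat :=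
  (linGraph 𝕜 α₁ α₂ g₁ g₂ vstar c freq vinf μ μhat).toLinearPMap

/-- `linGraph` is single-valued, hence it is the graph of `linOp`. -/
theorem linOp_graph : (linOp 𝕜 α₁ α₂ g₁ g₂ vstar c freq vinf μ μhat).graph =
    linGraph 𝕜 α₁ α₂ g₁ g₂ vstar c freq vinf μ μhat := by
  refine Submodule.toLinearPMap_graph_eq _ ?_
  rintro z ⟨w₁, w₂, ⟨a1, -⟩, ⟨b1, -⟩, e, l⟩ hz
  rw [hz] at a1 b1 e l
  have hX := SpaceX.coe_fn_zero (𝕜 := 𝕜) (μ := μ) (μhat := μhat)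
  have h1 := a1.unique ((HasWeakDeriv.zero 1).congr hX.symm (ae_eq_refl _))
  have h2 := b1.unique ((HasWeakDeriv.zero 2).congr hX.symm (ae_eq_refl _))
  refine SpaceX.ext ?_ ?_
  · filter_upwards [h1, h2, hX, e] with x h1 h2 h3 h4
    rw [h4, h1, h2, h3]
    simp
  · rw [l, SpaceX.lim_zero]
    simp

end Operator

end TOF

end

/-!
The statement has two independent halves: the front profile converges exponentially to its limits,
and, granted such a rate, the linearization generates energy estimates in the weighted space `X_η`
of functions with a limit at `+∞`.

**Resolvent estimates.** For `u = v - ρ v̂` the equation `(s - 𝓛)(v, ρ) = r` becomes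
`s u - (A u'' + c u' + b u) = F`, where `b = S_ω + Df(v_⋆)` and where `F` contains, besides
`r.fn - r.lim v̂`, a `defect` built from `(b - b_∞) v̂`, `v̂'` and `v̂''`. These decay at the rate
`2 μ̂ > μ₂`, hence lie in `L²_η` with bounds uniform in `μ ≤ μ₂`. The basic estimate
(`resolvent_estimate`) tests the equation with `η² u` and takes the functional `re ± δ im`, with
the sign of `im s`: it is bounded below by a multiple of `‖s‖` on a sector slightly larger than the
right half plane, and it keeps `⟨z, A z⟩` coercive. The derivative of `η² ⟨u, A u'⟩` integrates to
zero, and all mixed terms are absorbed for large `‖s‖`. Adding the second component, where `s - b_∞`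
is boundedly invertible for large `‖s‖`, gives `extended_estimate`; the equation for `v'` has the same
form with the additional inhomogeneity `b' v`, which gives `extended_estimate_deriv`.
All integrations by parts are done for primitives in the sense of Lebesgue (`IsPrim`), to which weak
derivatives are related by the lemma of du Bois-Reymond.

**Closed and densely defined.** The estimate at one large real `s`, applied to differences, shows
that convergence of `p` and `𝓛 p` in `X_η` forces convergence of the weak derivatives of `p`
(`linOp_isClosed`). Test functions plus multiples of `v̂` are dense (`dense_sobX`).

**Decay rate.** The profile solves `A v'' + c v' + S_ω v + f(v) = 0`. In the limit
`x → -∞` the function `⟨v, A v'⟩ + c |v|² / 2` is a Lyapunov function, because `g₁(0) < 0`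
(`exp_decay_atBot`). The limit `v_∞` lies on a circle of rest states; the rotation invariant
quantities `|v|² - |v_∞|²`, `⟨v, v'⟩`, `v ∧ v'` satisfy a three dimensional system `x' = M x + o(x)`
whose characteristic polynomial `λ³ + a₂ λ² + a₁ λ - d` has `a₂ > 0` and, as `g₁'(|v_∞|²) < 0`,
`d > 0`. Testing the third order equation with `x` produces a Lyapunov function
(`exp_decay_of_cubic`, `exp_decay_atTop`). In both cases `exp_decay_of_lyapunov` yields exponential
decay without any definiteness of the Lyapunov function.
-/

namespace TOF

/-! ### Locally absolutely continuous functions as primitives -/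

section Primitives

theorem intervalIntegrable_of_locallyIntegrable {E : Type*} [NormedAddCommGroup E] {u : ℝ → E}
    (hu : LocallyIntegrable u volume) (a b : ℝ) : IntervalIntegrable u volume a b :=
  intervalIntegrable_iff.mpr <|
    (hu.integrableOn_isCompact isCompact_uIcc).mono_set Set.uIoc_subset_uIcc

theorem locallyIntegrable_norm {E : Type*} [NormedAddCommGroup E] {u : ℝ → E}
    (hu : LocallyIntegrable u volume) : LocallyIntegrable (fun x => ‖u x‖) volume :=
  hu.mono hu.aestronglyMeasurable.norm (.of_forall fun x => by simp)

/-- A function whose increments are controlled by the integral of a fixed nonnegative function is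
absolutely continuous. -/
theorem absolutelyContinuousOnInterval_of_norm_sub_le {E : Type*} [NormedAddCommGroup E]
    {U : ℝ → E} {m : ℝ → ℝ} {a b : ℝ}
    (hm : IntervalIntegrable m volume a b)
    (h : ∀ x ∈ Set.uIcc a b, ∀ y ∈ Set.uIcc a b, ‖U x - U y‖ ≤ |∫ t in y..x, m t|) :
    AbsolutelyContinuousOnInterval U a b := by
  have hM := hm.absolutelyContinuousOnInterval_intervalIntegral (c := a) (by simp)
  unfold AbsolutelyContinuousOnInterval at hM ⊢
  refine squeeze_zero' (.of_forall fun E => Finset.sum_nonneg fun _ _ => dist_nonneg) ?_ hM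
  have h1 : ∀ᶠ E : ℕ × (ℕ → ℝ × ℝ) in AbsolutelyContinuousOnInterval.totalLengthFilter ⊓
      𝓟 (AbsolutelyContinuousOnInterval.disjWithin a b),
      E ∈ AbsolutelyContinuousOnInterval.disjWithin a b :=
    eventually_inf_principal.mpr (by simp)
  filter_upwards [h1] with E hE
  refine Finset.sum_le_sum fun i hi => ?_
  obtain ⟨hx, hy⟩ := hE.1 i hi
  have sub : ∀ z ∈ Set.uIcc a b, IntervalIntegrable m volume a z := fun z hz =>
    hm.mono_set (Set.uIcc_subset_uIcc_left hz)
  rw [dist_eq_norm, Real.dist_eq,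
    intervalIntegral.integral_interval_sub_left (sub _ hx) (sub _ hy)]
  exact h _ hx _ hy

variable {E F G : Type*} [NormedAddCommGroup E] [NormedSpace ℝ E]
  [NormedAddCommGroup F] [NormedSpace ℝ F] [NormedAddCommGroup G] [NormedSpace ℝ G]

/-- `U` is a primitive of the locally integrable function `u`, in the sense of the Lebesgue
integral. This is the same as `U` being locally absolutely continuous with derivative `u`. -/
def IsPrim (U u : ℝ → E) : Prop :=
  LocallyIntegrable u volume ∧ ∀ a b, U b - U a = ∫ x in a..b, u x

theorem IsPrim.intervalIntegrable {U u : ℝ → E} (h : IsPrim U u) (a b : ℝ) :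
    IntervalIntegrable u volume a b :=
  intervalIntegrable_of_locallyIntegrable h.1 a b

theorem IsPrim.eq_add {U u : ℝ → E} (h : IsPrim U u) (a b : ℝ) :
    U b = U a + ∫ x in a..b, u x := by
  rw [← h.2 a b]; abel

theorem IsPrim.continuous {U u : ℝ → E} (h : IsPrim U u) : Continuous U := by
  have e : U = fun x => U 0 + ∫ t in (0 : ℝ)..x, u t := funext fun x => h.eq_add 0 x
  rw [e]
  exact continuous_const.add
    (intervalIntegral.continuous_primitive (fun a b => h.intervalIntegrable a b) 0)

theorem IsPrim.integral {u : ℝ → E} (hu : LocallyIntegrable u volume) :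
    IsPrim (fun x => ∫ t in (0 : ℝ)..x, u t) u := by
  refine ⟨hu, fun a b => ?_⟩
  have h := intervalIntegrable_of_locallyIntegrable hu
  exact intervalIntegral.integral_interval_sub_left (h _ _) (h _ _)

theorem IsPrim.congr_ae {U u u' : ℝ → E} (h : IsPrim U u) (e : u =ᵐ[volume] u') :
    IsPrim U u' := by
  refine ⟨h.1.congr e, fun a b => (h.2 a b).trans ?_⟩
  exact intervalIntegral.integral_congr_ae (e.mono fun x hx _ => hx)

theorem IsPrim.of_hasDerivAt [CompleteSpace E] {U u : ℝ → E} (h : ∀ x, HasDerivAt U (u x) x)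
    (hu : Continuous u) : IsPrim U u :=
  ⟨hu.locallyIntegrable, fun a b => (intervalIntegral.integral_eq_sub_of_hasDerivAt
    (fun x _ => h x) (hu.intervalIntegrable a b)).symm⟩

theorem IsPrim.clm [CompleteSpace E] [CompleteSpace F] {U u : ℝ → E} (h : IsPrim U u)
    (L : E →L[ℝ] F) :
    IsPrim (fun x => L (U x)) (fun x => L (u x)) := by
  refine ⟨fun x => ?_, fun a b => ?_⟩
  · obtain ⟨s, hs, hi⟩ := h.1 x
    exact ⟨s, hs, L.integrable_comp hi⟩
  · rw [L.intervalIntegral_comp_comm (h.intervalIntegrable a b), ← h.2, map_sub]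

theorem IsPrim.norm_increment_le {U u : ℝ → E} (h : IsPrim U u) (x y : ℝ) :
    ‖U x - U y‖ ≤ |∫ t in y..x, ‖u t‖| := by
  rw [h.2 y x]
  exact intervalIntegral.norm_integral_le_abs_integral_norm

/-- The product rule for absolutely continuous functions and a bilinear map. -/
theorem IsPrim.bilin [CompleteSpace E] [CompleteSpace F] [CompleteSpace G] (L : E →L[ℝ] F →L[ℝ] G)
    {U u : ℝ → E} {V v : ℝ → F} (hU : IsPrim U u) (hV : IsPrim V v) :
    IsPrim (fun x => L (U x) (V x)) (fun x => L (U x) (v x) + L (u x) (V x)) := by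
  have cU := hU.continuous
  have cV := hV.continuous
  have hloc1 : LocallyIntegrable (fun x => L (U x) (v x)) volume := by
    refine ((locallyIntegrable_norm hV.1).continuous_mul (g := fun x => ‖L‖ * ‖U x‖)
      (by fun_prop)).mono ?_ ?_
    · exact L.aestronglyMeasurable_comp₂ cU.aestronglyMeasurable hV.1.aestronglyMeasurable
    · refine .of_forall fun x => (L.le_opNorm₂ _ _).trans (le_of_eq ?_)
      simp [abs_of_nonneg (norm_nonneg L)]
  have hloc2 : LocallyIntegrable (fun x => L (u x) (V x)) volume := by
    refine ((locallyIntegrable_norm hU.1).continuous_mul (g := fun x => ‖L‖ * ‖V x‖)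
      (by fun_prop)).mono ?_ ?_
    · exact L.aestronglyMeasurable_comp₂ hU.1.aestronglyMeasurable cV.aestronglyMeasurable
    · refine .of_forall fun x => (L.le_opNorm₂ _ _).trans (le_of_eq ?_)
      simp only [norm_mul, norm_norm, Real.norm_of_nonneg (norm_nonneg L)]
      ring
  have hloc : LocallyIntegrable (fun x => L (U x) (v x) + L (u x) (V x)) volume :=
    hloc1.add hloc2
  refine ⟨hloc, fun a b => ?_⟩
  have hP := IsPrim.integral hloc
  set P : ℝ → G := fun x => ∫ t in (0 : ℝ)..x, (L (U t) (v t) + L (u t) (V t)) with hPdef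
  obtain ⟨MU, hMU⟩ := (isCompact_uIcc (a := a) (b := b)).exists_bound_of_continuousOn
    cU.continuousOn
  obtain ⟨MV, hMV⟩ := (isCompact_uIcc (a := a) (b := b)).exists_bound_of_continuousOn
    cV.continuousOn
  have hac : AbsolutelyContinuousOnInterval (fun x => L (U x) (V x) - P x) a b := by
    refine absolutelyContinuousOnInterval_of_norm_sub_le
      (m := fun x => ‖L‖ * MU * ‖v x‖ + ‖L‖ * MV * ‖u x‖ + ‖L (U x) (v x) + L (u x) (V x)‖) ?_ ?_
    · exact (((hV.intervalIntegrable a b).norm.const_mul _).add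
        ((hU.intervalIntegrable a b).norm.const_mul _)).add (hP.intervalIntegrable a b).norm
    · intro x hx y hy
      have key : L (U x) (V x) - P x - (L (U y) (V y) - P y)
          = L (U x) (V x - V y) + L (U x - U y) (V y) - (P x - P y) := by
        simp only [map_sub, _root_.sub_apply]; abel
      have hMU0 : 0 ≤ MU := (norm_nonneg _).trans (hMU x hx)
      have hMV0 : 0 ≤ MV := (norm_nonneg _).trans (hMV x hx)
      have n1 : ‖L (U x) (V x - V y)‖ ≤ ‖L‖ * MU * |∫ t in y..x, ‖v t‖| := by
        refine (L.le_opNorm₂ _ _).trans ?_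
        gcongr
        · exact hMU x hx
        · exact hV.norm_increment_le x y
      have n2 : ‖L (U x - U y) (V y)‖ ≤ ‖L‖ * MV * |∫ t in y..x, ‖u t‖| := by
        refine (L.le_opNorm₂ _ _).trans ?_
        rw [mul_right_comm]
        gcongr
        · exact hMV y hy
        · exact hU.norm_increment_le x y
      have n3 := hP.norm_increment_le x y
      rw [key]
      refine (norm_sub_le _ _).trans ((add_le_add ((norm_add_le _ _).trans (add_le_add n1 n2))
        n3).trans (le_of_eq ?_))
      rw [intervalIntegral.integral_add, intervalIntegral.integral_add,
        intervalIntegral.integral_const_mul, intervalIntegral.integral_const_mul]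
      · have i1 : ∀ {w : ℝ → ℝ}, (∀ t, 0 ≤ w t) → y ≤ x → 0 ≤ ∫ t in y..x, w t := fun h hyx =>
          intervalIntegral.integral_nonneg hyx fun t _ => h t
        have i2 : ∀ {w : ℝ → ℝ}, (∀ t, 0 ≤ w t) → x ≤ y → ∫ t in y..x, w t ≤ 0 := fun h hyx => by
          rw [intervalIntegral.integral_symm]
          exact neg_nonpos.2 (intervalIntegral.integral_nonneg hyx fun t _ => h t)
        rcases le_total y x with hyx | hyx
        · have a1 := i1 (fun t => norm_nonneg (v t)) hyx
          have a2 := i1 (fun t => norm_nonneg (u t)) hyx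
          have a3 := i1 (fun t => norm_nonneg (L (U t) (v t) + L (u t) (V t))) hyx
          rw [abs_of_nonneg a1, abs_of_nonneg a2, abs_of_nonneg a3, abs_of_nonneg]
          positivity
        · have a1 := i2 (fun t => norm_nonneg (v t)) hyx
          have a2 := i2 (fun t => norm_nonneg (u t)) hyx
          have a3 := i2 (fun t => norm_nonneg (L (U t) (v t) + L (u t) (V t))) hyx
          rw [abs_of_nonpos a1, abs_of_nonpos a2, abs_of_nonpos a3, abs_of_nonpos]
          · ring
          · have c1 : 0 ≤ ‖L‖ * MU := by positivity
            have c2 : 0 ≤ ‖L‖ * MV := by positivity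
            have := mul_nonpos_of_nonneg_of_nonpos c1 a1
            have := mul_nonpos_of_nonneg_of_nonpos c2 a2
            linarith
      · exact (hV.intervalIntegrable _ _).norm.const_mul _
      · exact (hU.intervalIntegrable _ _).norm.const_mul _
      · exact ((hV.intervalIntegrable _ _).norm.const_mul _).add
          ((hU.intervalIntegrable _ _).norm.const_mul _)
      · exact (hP.intervalIntegrable _ _).norm
  have hder : ∀ᵐ x, x ∈ Set.uIcc a b → HasDerivAt (fun x => L (U x) (V x) - P x) 0 x := by
    have eU : U = fun x => U 0 + ∫ t in (0 : ℝ)..x, u t := funext fun x => hU.eq_add 0 x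
    have eV : V = fun x => V 0 + ∫ t in (0 : ℝ)..x, v t := funext fun x => hV.eq_add 0 x
    filter_upwards [_root_.LocallyIntegrable.ae_hasDerivAt_integral hU.1,
      _root_.LocallyIntegrable.ae_hasDerivAt_integral hV.1,
      _root_.LocallyIntegrable.ae_hasDerivAt_integral hloc] with x h1 h2 h3 _
    have d1 : HasDerivAt U (u x) x := by
      rw [eU]; exact (h1 0).const_add _
    have d2 : HasDerivAt V (v x) x := by
      rw [eV]; exact (h2 0).const_add _
    have d3 := (L.hasDerivAt_of_bilinear (fun _ => d1) (fun _ => d2)).sub (h3 0)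
    refine d3.congr_deriv ?_
    simp
  obtain ⟨C, hC⟩ := hac.const_of_ae_hasDerivAt_zero hder
  have e1 := hC a (by simp)
  have e2 := hC b (by simp)
  have e3 := hP.2 a b
  rw [← e3]
  have e4 := e2.trans e1.symm
  rw [sub_eq_sub_iff_add_eq_add] at e4 ⊢
  rw [add_comm (P b), ← e4]

/-- The integral over the line of the derivative of an integrable function vanishes. -/
theorem IsPrim.integral_eq_zero [CompleteSpace E] {U u : ℝ → E} (h : IsPrim U u)
    (hU : Integrable U) (hu : Integrable u) : ∫ x, u x = 0 := by
  have top : Tendsto U atTop (𝓝 (U 0 + ∫ x in Set.Ioi (0 : ℝ), u x)) := by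
    have := (intervalIntegral_tendsto_integral_Ioi 0 hu.integrableOn tendsto_id).const_add (U 0)
    exact this.congr fun x => (h.eq_add 0 x).symm
  have bot : Tendsto U atBot (𝓝 (U 0 - ∫ x in Set.Iic (0 : ℝ), u x)) := by
    have := (intervalIntegral_tendsto_integral_Iic 0 hu.integrableOn tendsto_id).const_sub (U 0)
    refine this.congr fun x => ?_
    rw [id, ← h.2 x 0]; abel
  have z1 : U 0 + ∫ x in Set.Ioi (0 : ℝ), u x = 0 := by
    by_contra hne
    obtain ⟨ε, hε, hlt⟩ := exists_between (norm_pos_iff.2 hne)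
    have hev := (top.norm.eventually (lt_mem_nhds hlt))
    obtain ⟨X, hX⟩ := eventually_atTop.1 hev
    have : IntegrableOn (fun _ : ℝ => ε) (Set.Ioi X) := by
      refine Integrable.mono hU.integrableOn aestronglyMeasurable_const ?_
      refine (ae_restrict_mem measurableSet_Ioi).mono fun x hx => ?_
      rw [Real.norm_of_nonneg hε.le]
      exact (hX x (le_of_lt hx)).le
    rw [integrableOn_const_iff] at this
    simp [hε.ne'] at this
  have z2 : U 0 - ∫ x in Set.Iic (0 : ℝ), u x = 0 := by
    by_contra hne
    obtain ⟨ε, hε, hlt⟩ := exists_between (norm_pos_iff.2 hne)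
    have hev := (bot.norm.eventually (lt_mem_nhds hlt))
    obtain ⟨X, hX⟩ := eventually_atBot.1 hev
    have : IntegrableOn (fun _ : ℝ => ε) (Set.Iio X) := by
      refine Integrable.mono hU.integrableOn aestronglyMeasurable_const ?_
      refine (ae_restrict_mem measurableSet_Iio).mono fun x hx => ?_
      rw [Real.norm_of_nonneg hε.le]
      exact (hX x (le_of_lt hx)).le
    rw [integrableOn_const_iff] at this
    simp [hε.ne'] at this
  rw [← integral_add_compl (measurableSet_Iic (a := (0 : ℝ))) hu, Set.compl_Iic,
    ← sub_eq_zero.1 z2, z1]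

end Primitives

/-! ### Weak derivatives on the line -/

section WeakDerivatives

variable {𝕜 : Type} [RCLike 𝕜]

theorem IsPrim.hasWeakDeriv {V w : ℝ → Plane 𝕜} (h : IsPrim V w) : HasWeakDeriv 1 V w := by
  refine ⟨h.continuous.locallyIntegrable, h.1, fun φ hφ hc => ?_⟩
  have hφ' : ∀ x, HasDerivAt φ (deriv φ x) x := fun x =>
    (hφ.differentiable (by simp) x).hasDerivAt
  have hp : IsPrim φ (deriv φ) := IsPrim.of_hasDerivAt hφ'
    (hφ.continuous_deriv (by exact_mod_cast le_top))
  have hb := hp.bilin (ContinuousLinearMap.lsmul ℝ ℝ) h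
  simp only [ContinuousLinearMap.lsmul_apply] at hb
  have i1 := integrable_smul_test hφ hc h.1 0
  have i2 := integrable_smul_test hφ hc h.continuous.locallyIntegrable 1
  have i3 := integrable_smul_test hφ hc h.continuous.locallyIntegrable 0
  simp only [iteratedDeriv_zero, iteratedDeriv_one] at i1 i2 i3 ⊢
  have h0 := hb.integral_eq_zero i3 (i1.add i2)
  rw [integral_add i1 i2] at h0
  rw [eq_neg_of_add_eq_zero_right h0]
  simp

/-- A smooth function with compact support and vanishing integral is the derivative of a test
function. -/
theorem exists_deriv_eq_of_integral_eq_zero {θ : ℝ → ℝ} (hθ : ContDiff ℝ ∞ θ)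
    (hc : HasCompactSupport θ) (h0 : ∫ x, θ x = 0) :
    ∃ Φ : ℝ → ℝ, ContDiff ℝ ∞ Φ ∧ HasCompactSupport Φ ∧ deriv Φ = θ := by
  obtain ⟨R, hR⟩ : ∃ R : ℝ, tsupport θ ⊆ Set.Icc (-R) R := by
    obtain ⟨R, hR⟩ := hc.isCompact.isBounded.subset_closedBall 0
    exact ⟨R, by rwa [Real.closedBall_eq_Icc, zero_sub, zero_add] at hR⟩
  have hz : ∀ x, x ∉ Set.Icc (-R) R → θ x = 0 := fun x hx =>
    image_eq_zero_of_notMem_tsupport fun h => hx (hR h)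
  have hcont := hθ.continuous
  have hint : Integrable θ := hcont.integrable_of_hasCompactSupport hc
  let Φ : ℝ → ℝ := fun x => ∫ t in Set.Iic x, θ t
  have hΦ : ∀ x, HasDerivAt Φ (θ x) x := by
    intro x
    have e : Φ = fun x => (∫ t in Set.Iic (0 : ℝ), θ t) + ∫ t in (0 : ℝ)..x, θ t := by
      funext x
      rw [← intervalIntegral.integral_Iic_sub_Iic hint.integrableOn hint.integrableOn]
      simp [Φ]
    rw [e]
    exact (hcont.integral_hasStrictDerivAt 0 x).hasDerivAt.const_add _
  have hd : deriv Φ = θ := funext fun x => (hΦ x).deriv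
  refine ⟨Φ, ?_, ?_, hd⟩
  · rw [contDiff_infty_iff_deriv, hd]
    exact ⟨fun x => (hΦ x).differentiableAt, hθ⟩
  · refine HasCompactSupport.intro (isCompact_Icc (a := -R) (b := R)) fun x hx => ?_
    by_cases h1 : x < -R
    · refine setIntegral_eq_zero_of_forall_eq_zero fun t ht => hz t fun h => ?_
      have : t ≤ x := ht
      linarith [h.1]
    · have h2 : R < x := by
        by_contra h2
        exact hx ⟨not_lt.1 h1, not_lt.1 h2⟩
      rw [← h0]
      refine setIntegral_eq_integral_of_forall_compl_eq_zero fun t ht => hz t fun h => ht ?_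
      exact h.2.trans h2.le

/-- The lemma of du Bois-Reymond: a function with a weak derivative agrees almost everywhere with
a primitive of that derivative. -/
theorem HasWeakDeriv.exists_isPrim {v w : ℝ → Plane 𝕜} (h : HasWeakDeriv 1 v w) :
    ∃ V, IsPrim V w ∧ v =ᵐ[volume] V := by
  set W : ℝ → Plane 𝕜 := fun x => ∫ t in (0 : ℝ)..x, w t with hW
  have hPW : IsPrim W w := IsPrim.integral h.2.1
  have hWw := hPW.hasWeakDeriv
  have hd : LocallyIntegrable (fun x => v x - W x) volume := h.1.sub hWw.1
  have hd0 : ∀ φ : ℝ → ℝ, ContDiff ℝ ∞ φ → HasCompactSupport φ →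
      ∫ x, deriv φ x • (v x - W x) = 0 := by
    intro φ hφ hc
    have e1 := h.2.2 φ hφ hc
    have e2 := hWw.2.2 φ hφ hc
    have i1 := integrable_smul_test hφ hc h.1 1
    have i2 := integrable_smul_test hφ hc hWw.1 1
    simp only [iteratedDeriv_one] at e1 e2 i1 i2
    simp only [smul_sub]
    rw [integral_sub i1 i2, e1, e2, sub_self]
  let b : ContDiffBump (0 : ℝ) := default
  set χ : ℝ → ℝ := b.normed volume with hχ
  have hχs : ContDiff ℝ ∞ χ := b.contDiff_normed
  have hχc : HasCompactSupport χ := b.hasCompactSupport_normed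
  have hχ1 : ∫ x, χ x = 1 := b.integral_normed
  set C : Plane 𝕜 := ∫ x, χ x • (v x - W x) with hC
  have hae : (fun x => v x - W x) =ᵐ[volume] fun _ => C := by
    refine ae_eq_of_integral_contDiff_smul_eq hd (locallyIntegrable_const C) fun ψ hψ hψc => ?_
    have hψi := hψ.continuous.integrable_of_hasCompactSupport (μ := volume) hψc
    have hχi := hχs.continuous.integrable_of_hasCompactSupport (μ := volume) hχc
    obtain ⟨Φ, hΦ, hΦc, hΦd⟩ := exists_deriv_eq_of_integral_eq_zero
      (θ := fun x => ψ x - (∫ t, ψ t) * χ x) (hψ.sub (contDiff_const.mul hχs))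
      (hψc.sub (hχc.mul_left)) (by
        rw [integral_sub hψi (hχi.const_mul _), integral_const_mul, hχ1, mul_one, sub_self])
    have e := hd0 Φ hΦ hΦc
    rw [hΦd] at e
    have i1 := integrable_smul_test hψ hψc hd 0
    have i2 := integrable_smul_test hχs hχc hd 0
    simp only [iteratedDeriv_zero] at i1 i2
    simp only [sub_smul, mul_smul] at e
    have i3 : Integrable (fun x => (∫ t, ψ t) • χ x • (v x - W x)) :=
      i2.fun_smul (∫ t, ψ t)
    rw [integral_sub i1 i3, integral_smul, sub_eq_zero] at e
    rw [e, integral_smul_const]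
  refine ⟨fun x => C + W x, ⟨h.2.1, fun a b => ?_⟩, hae.mono fun x hx => ?_⟩
  · rw [add_sub_add_left_eq_sub, hPW.2 a b]
  · exact sub_eq_iff_eq_add.1 hx

theorem iteratedDeriv_test {φ : ℝ → ℝ} (hφ : ContDiff ℝ ∞ φ) (hc : HasCompactSupport φ) (k : ℕ) :
    ContDiff ℝ ∞ (iteratedDeriv k φ) ∧ HasCompactSupport (iteratedDeriv k φ) := by
  induction k with
  | zero => simpa using ⟨hφ, hc⟩
  | succ k ih =>
    rw [iteratedDeriv_succ]
    exact ⟨(contDiff_infty_iff_deriv.1 ih.1).2, ih.2.deriv⟩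

theorem HasWeakDeriv.of_succ {k : ℕ} {v w₁ w : ℝ → Plane 𝕜} (h₁ : HasWeakDeriv 1 v w₁)
    (h : HasWeakDeriv (k + 1) v w) : HasWeakDeriv k w₁ w := by
  refine ⟨h₁.2.1, h.2.1, fun φ hφ hc => ?_⟩
  have ht := iteratedDeriv_test hφ hc k
  have e1 := h₁.2.2 _ ht.1 ht.2
  have e2 := h.2.2 φ hφ hc
  rw [iteratedDeriv_one, ← iteratedDeriv_succ, e2, pow_succ] at e1
  simp only [pow_one, mul_smul, neg_smul, one_smul, smul_neg, neg_inj] at e1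
  exact e1.symm

theorem HasWeakDeriv.succ {k : ℕ} {v w₁ w : ℝ → Plane 𝕜} (h₁ : HasWeakDeriv 1 v w₁)
    (h : HasWeakDeriv k w₁ w) : HasWeakDeriv (k + 1) v w := by
  refine ⟨h₁.1, h.2.1, fun φ hφ hc => ?_⟩
  have ht := iteratedDeriv_test hφ hc k
  have e1 := h₁.2.2 _ ht.1 ht.2
  have e2 := h.2.2 φ hφ hc
  rw [iteratedDeriv_one, ← iteratedDeriv_succ, e2] at e1
  rw [e1, smul_smul, ← pow_add, add_comm]

/-- Weak derivatives are stable under convergence against test functions. -/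
theorem HasWeakDeriv.of_tendsto {k : ℕ} {v w : ℝ → Plane 𝕜} {vn wn : ℕ → ℝ → Plane 𝕜}
    (hv : LocallyIntegrable v volume) (hw : LocallyIntegrable w volume)
    (h : ∀ n, HasWeakDeriv k (vn n) (wn n))
    (hvn : ∀ ψ : ℝ → ℝ, Continuous ψ → HasCompactSupport ψ →
      Tendsto (fun n => ∫ x, ψ x • vn n x) atTop (𝓝 (∫ x, ψ x • v x)))
    (hwn : ∀ ψ : ℝ → ℝ, Continuous ψ → HasCompactSupport ψ →
      Tendsto (fun n => ∫ x, ψ x • wn n x) atTop (𝓝 (∫ x, ψ x • w x))) :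
    HasWeakDeriv k v w := by
  refine ⟨hv, hw, fun φ hφ hc => ?_⟩
  have ht := iteratedDeriv_test hφ hc k
  refine tendsto_nhds_unique (hvn _ ht.1.continuous ht.2) ?_
  refine ((hwn φ hφ.continuous hc).const_smul ((-1 : ℝ) ^ k)).congr fun n => ?_
  exact ((h n).2.2 φ hφ hc).symm

end WeakDerivatives

/-! ### The weight and the weighted norms -/

section Weights

variable {μ μ₂ : ℝ}

theorem weight_pos (μ x : ℝ) : 0 < weight μ x := Real.exp_pos _

theorem one_le_weight (hμ : 0 ≤ μ) (x : ℝ) : 1 ≤ weight μ x :=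
  Real.one_le_exp (mul_nonneg hμ (Real.sqrt_nonneg _))

/-- The derivative of the weight is `weightSlope μ x * weight μ x`. -/
noncomputable def weightSlope (μ x : ℝ) : ℝ := μ * (x / Real.sqrt (x ^ 2 + 1))

theorem hasDerivAt_weight (μ x : ℝ) :
    HasDerivAt (weight μ) (weightSlope μ x * weight μ x) x := by
  have h0 : x ^ 2 + 1 ≠ 0 := by positivity
  have h1 : HasDerivAt (fun x : ℝ => x ^ 2 + 1) (2 * x) x := by
    simpa using (hasDerivAt_pow 2 x).add_const 1
  have h2 := ((h1.sqrt h0).const_mul μ).exp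
  refine h2.congr_deriv ?_
  rw [weightSlope, weight]
  field_simp

theorem continuous_weight (μ : ℝ) : Continuous (weight μ) := by
  unfold weight; fun_prop

theorem continuous_weightSlope (μ : ℝ) : Continuous (weightSlope μ) := by
  unfold weightSlope
  refine continuous_const.mul (continuous_id.div (by fun_prop) fun x => ?_)
  have : 0 < x ^ 2 + 1 := by positivity
  exact (Real.sqrt_pos.2 this).ne'

theorem abs_weightSlope_le (hμ : 0 ≤ μ) (x : ℝ) : |weightSlope μ x| ≤ μ := by
  have h0 : 0 < x ^ 2 + 1 := by positivity
  rw [weightSlope, abs_mul, abs_of_nonneg hμ, abs_div, abs_of_pos (Real.sqrt_pos.2 h0)]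
  refine mul_le_of_le_one_right hμ ((div_le_one (Real.sqrt_pos.2 h0)).2 ?_)
  exact Real.abs_le_sqrt (by linarith)

theorem weight_le (hμ : 0 ≤ μ) (hμ₂ : μ ≤ μ₂) (x : ℝ) :
    weight μ x ≤ Real.exp μ₂ * Real.exp (μ₂ * |x|) := by
  rw [← Real.exp_add, weight]
  have h1 : Real.sqrt (x ^ 2 + 1) ≤ |x| + 1 := by
    rw [Real.sqrt_le_left (by positivity)]
    nlinarith [sq_abs x, abs_nonneg x]
  refine Real.exp_le_exp.2 ((mul_le_mul hμ₂ h1 (Real.sqrt_nonneg _) (hμ.trans hμ₂)).trans ?_)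
  linarith

theorem integrable_exp_neg_abs {a : ℝ} (ha : 0 < a) :
    Integrable fun x : ℝ => Real.exp (-(a * |x|)) := by
  refine (integrable_inv_one_add_sq.const_mul ((min 1 (a ^ 2 / 2))⁻¹)).mono'
    (by fun_prop) (.of_forall fun x => ?_)
  have hm : 0 < min 1 (a ^ 2 / 2) := lt_min one_pos (by positivity)
  rw [Real.norm_of_nonneg (Real.exp_pos _).le, Real.exp_neg, ← mul_inv]
  refine inv_anti₀ (by positivity) ?_
  have h1 := Real.quadratic_le_exp_of_nonneg (x := a * |x|) (by positivity)
  have h2 : min 1 (a ^ 2 / 2) ≤ 1 := min_le_left _ _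
  have h3 : min 1 (a ^ 2 / 2) * x ^ 2 ≤ a ^ 2 / 2 * x ^ 2 :=
    mul_le_mul_of_nonneg_right (min_le_right _ _) (sq_nonneg x)
  have h4 : (a * |x|) ^ 2 = a ^ 2 * x ^ 2 := by rw [mul_pow, sq_abs]
  have h5 : 0 ≤ a * |x| := by positivity
  nlinarith

variable {𝕜 : Type} [RCLike 𝕜]

theorem normL2w_nonneg (μ : ℝ) (f : ℝ → Plane 𝕜) : 0 ≤ normL2w μ f := ENNReal.toReal_nonneg

theorem normL2w_congr {f g : ℝ → Plane 𝕜} (h : f =ᵐ[volume] g) : normL2w μ f = normL2w μ g := by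
  have h' : (fun x => weight μ x • f x) =ᵐ[volume] fun x => weight μ x • g x :=
    h.mono fun x hx => by simp only [hx]
  rw [normL2w, normL2w, eLpNorm_congr_ae h']

theorem MemL2w.aesm {f : ℝ → Plane 𝕜} (h : MemL2w μ f) : AEStronglyMeasurable f volume :=
  h.1.aestronglyMeasurable

theorem norm_weight_smul_sq (μ : ℝ) (f : ℝ → Plane 𝕜) (x : ℝ) :
    ‖weight μ x • f x‖ ^ 2 = weight μ x ^ 2 * ‖f x‖ ^ 2 := by
  rw [norm_smul, Real.norm_of_nonneg (weight_pos μ x).le, mul_pow]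

theorem MemL2w.integrable {f : ℝ → Plane 𝕜} (h : MemL2w μ f) :
    Integrable fun x => weight μ x ^ 2 * ‖f x‖ ^ 2 := by
  have := (memLp_two_iff_integrable_sq_norm h.2.aestronglyMeasurable).1 h.2
  simpa only [norm_weight_smul_sq] using this

theorem MemL2w.normL2w_sq {f : ℝ → Plane 𝕜} (h : MemL2w μ f) :
    normL2w μ f ^ 2 = ∫ x, weight μ x ^ 2 * ‖f x‖ ^ 2 := by
  have hnn : 0 ≤ ∫ x, ‖weight μ x • f x‖ ^ 2 := integral_nonneg fun x => by positivity
  rw [normL2w, h.2.eLpNorm_eq_integral_rpow_norm two_ne_zero ENNReal.ofNat_ne_top]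
  simp only [ENNReal.toReal_ofNat, Real.rpow_two]
  rw [ENNReal.toReal_ofReal (by positivity), ← Real.rpow_natCast, ← Real.rpow_mul hnn]
  simp only [norm_weight_smul_sq]
  norm_num

theorem memL2w_of_integrable (hμ : 0 ≤ μ) {f : ℝ → Plane 𝕜} (hf : AEStronglyMeasurable f volume)
    (h : Integrable fun x => weight μ x ^ 2 * ‖f x‖ ^ 2) : MemL2w μ f := by
  have hw : AEStronglyMeasurable (fun x => weight μ x • f x) volume :=
    (continuous_weight μ).aestronglyMeasurable.smul hf
  constructor
  · refine (memLp_two_iff_integrable_sq_norm hf).2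
      (h.mono' (hf.norm.pow 2) (.of_forall fun x => ?_))
    rw [Real.norm_of_nonneg (by positivity)]
    exact le_mul_of_one_le_left (by positivity) (one_le_pow₀ (one_le_weight hμ x))
  · refine (memLp_two_iff_integrable_sq_norm hw).2 ?_
    simpa only [norm_weight_smul_sq] using h

/-- Pointwise domination in `L²_η`. -/
theorem MemL2w.mono (hμ : 0 ≤ μ) {f g : ℝ → Plane 𝕜} {K : ℝ} (hg : MemL2w μ g)
    (hf : AEStronglyMeasurable f volume) (h : ∀ᵐ x, ‖f x‖ ≤ K * ‖g x‖) :
    MemL2w μ f ∧ normL2w μ f ^ 2 ≤ K ^ 2 * normL2w μ g ^ 2 := by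
  have hle : ∀ᵐ x, weight μ x ^ 2 * ‖f x‖ ^ 2 ≤ K ^ 2 * (weight μ x ^ 2 * ‖g x‖ ^ 2) :=
    h.mono fun x hx => by
      have h1 : ‖f x‖ ^ 2 ≤ (K * ‖g x‖) ^ 2 := pow_le_pow_left₀ (norm_nonneg _) hx 2
      have h2 := mul_le_mul_of_nonneg_left h1 (sq_nonneg (weight μ x))
      linarith [mul_pow K ‖g x‖ 2, h2,
        show weight μ x ^ 2 * (K * ‖g x‖) ^ 2 = K ^ 2 * (weight μ x ^ 2 * ‖g x‖ ^ 2) by ring]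
  have hmeas : AEStronglyMeasurable (fun x => weight μ x ^ 2 * ‖f x‖ ^ 2) volume :=
    ((continuous_weight μ).pow 2).aestronglyMeasurable.mul (hf.norm.pow 2)
  have hi : Integrable fun x => weight μ x ^ 2 * ‖f x‖ ^ 2 := by
    refine (hg.integrable.const_mul (K ^ 2)).mono' hmeas (hle.mono fun x hx => ?_)
    rwa [Real.norm_of_nonneg (by positivity)]
  have hm := memL2w_of_integrable hμ hf hi
  refine ⟨hm, ?_⟩
  rw [hm.normL2w_sq, hg.normL2w_sq, ← integral_const_mul]
  exact integral_mono_ae hi (hg.integrable.const_mul _) hle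

theorem MemL2w.normL2w_add_sq_le {f g : ℝ → Plane 𝕜} (hf : MemL2w μ f)
    (hg : MemL2w μ g) :
    normL2w μ (fun x => f x + g x) ^ 2 ≤ 2 * normL2w μ f ^ 2 + 2 * normL2w μ g ^ 2 := by
  rw [(hf.add hg).normL2w_sq, hf.normL2w_sq, hg.normL2w_sq, ← integral_const_mul,
    ← integral_const_mul, ← integral_add (hf.integrable.const_mul 2) (hg.integrable.const_mul 2)]
  refine integral_mono (hf.add hg).integrable
    ((hf.integrable.const_mul 2).add (hg.integrable.const_mul 2)) fun x => ?_
  have h1 : ‖f x + g x‖ ^ 2 ≤ 2 * ‖f x‖ ^ 2 + 2 * ‖g x‖ ^ 2 := by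
    have := pow_le_pow_left₀ (norm_nonneg _) (norm_add_le (f x) (g x)) 2
    nlinarith [sq_nonneg (‖f x‖ - ‖g x‖)]
  have h2 := mul_le_mul_of_nonneg_left h1 (sq_nonneg (weight μ x))
  linarith

/-- Functions which decay exponentially at a rate above `μ₂` lie in all the spaces `L²_η` with
`μ ≤ μ₂`, with a uniform bound. -/
theorem memL2w_of_exp_decay {ν : ℝ} (hν : μ₂ < ν) :
    ∃ C > 0, ∀ μ, 0 ≤ μ → μ ≤ μ₂ → ∀ (f : ℝ → Plane 𝕜) (K : ℝ), AEStronglyMeasurable f volume →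
      (∀ x, ‖f x‖ ≤ K * Real.exp (-(ν * |x|))) →
      MemL2w μ f ∧ normL2w μ f ^ 2 ≤ C * K ^ 2 := by
  have hI := integrable_exp_neg_abs (a := 2 * (ν - μ₂)) (by linarith)
  set I := ∫ x, Real.exp (-(2 * (ν - μ₂) * |x|)) with hIdef
  have hI0 : 0 ≤ I := integral_nonneg fun x => (Real.exp_pos _).le
  refine ⟨Real.exp μ₂ ^ 2 * I + 1, by positivity, fun μ hμ hμ₂ f K hf hle => ?_⟩
  have hpt : ∀ x, weight μ x ^ 2 * ‖f x‖ ^ 2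
      ≤ Real.exp μ₂ ^ 2 * K ^ 2 * Real.exp (-(2 * (ν - μ₂) * |x|)) := by
    intro x
    have h1 := pow_le_pow_left₀ (weight_pos μ x).le (weight_le hμ hμ₂ x) 2
    have h2 := pow_le_pow_left₀ (norm_nonneg _) (hle x) 2
    refine (mul_le_mul h1 h2 (by positivity) (by positivity)).trans (le_of_eq ?_)
    have e : Real.exp (-(2 * (ν - μ₂) * |x|))
        = Real.exp (μ₂ * |x|) ^ 2 * Real.exp (-(ν * |x|)) ^ 2 := by
      rw [← Real.exp_nat_mul, ← Real.exp_nat_mul, ← Real.exp_add]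
      congr 1; push_cast; ring
    rw [e]; ring
  have hmeas : AEStronglyMeasurable (fun x => weight μ x ^ 2 * ‖f x‖ ^ 2) volume :=
    ((continuous_weight μ).pow 2).aestronglyMeasurable.mul (hf.norm.pow 2)
  have hi : Integrable fun x => weight μ x ^ 2 * ‖f x‖ ^ 2 := by
    refine (hI.const_mul (Real.exp μ₂ ^ 2 * K ^ 2)).mono' hmeas (.of_forall fun x => ?_)
    rw [Real.norm_of_nonneg (by positivity)]
    exact hpt x
  have hm := memL2w_of_integrable hμ hf hi
  refine ⟨hm, ?_⟩
  rw [hm.normL2w_sq]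
  refine (integral_mono hi (hI.const_mul _) hpt).trans ?_
  rw [integral_const_mul, ← hIdef]
  nlinarith [sq_nonneg K]

end Weights

/-! ### The template function -/

section Template

variable {μhat : ℝ}

theorem template_eq_sigmoid (μhat x : ℝ) : template μhat x = Real.sigmoid (2 * μhat * x) := by
  rw [template, Real.tanh_eq, Real.sigmoid_def]
  have e : Real.exp (-(2 * μhat * x)) = Real.exp (-(μhat * x)) * Real.exp (-(μhat * x)) := by
    rw [← Real.exp_add]; ring_nf
  have e' : Real.exp (μhat * x) = (Real.exp (-(μhat * x)))⁻¹ := by rw [Real.exp_neg, inv_inv]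
  have hp := Real.exp_pos (-(μhat * x))
  rw [e, e']
  field_simp
  ring

theorem template_nonneg (μhat x : ℝ) : 0 ≤ template μhat x := by
  rw [template_eq_sigmoid]; exact Real.sigmoid_nonneg _

theorem template_le_one (μhat x : ℝ) : template μhat x ≤ 1 := by
  rw [template_eq_sigmoid]; exact Real.sigmoid_le_one _

theorem sigmoid_le_exp (y : ℝ) : Real.sigmoid y ≤ Real.exp y := by
  rw [Real.sigmoid_def, ← inv_inv (Real.exp y), ← Real.exp_neg]
  exact inv_anti₀ (Real.exp_pos _) (by linarith)

theorem template_le_exp (μhat x : ℝ) : template μhat x ≤ Real.exp (2 * μhat * x) := by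
  rw [template_eq_sigmoid]; exact sigmoid_le_exp _

/-- The derivative of the template function. -/
noncomputable def templateDeriv (μhat x : ℝ) : ℝ :=
  2 * μhat * (template μhat x * (1 - template μhat x))

/-- The second derivative of the template function. -/
noncomputable def templateDeriv₂ (μhat x : ℝ) : ℝ :=
  2 * μhat * (templateDeriv μhat x * (1 - 2 * template μhat x))

theorem hasDerivAt_template (μhat x : ℝ) :
    HasDerivAt (template μhat) (templateDeriv μhat x) x := by
  have e : template μhat = fun x => Real.sigmoid (2 * μhat * x) :=
    funext fun x => template_eq_sigmoid μhat x
  have h1 : HasDerivAt (fun x : ℝ => 2 * μhat * x) (2 * μhat) x := by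
    simpa using (hasDerivAt_id x).const_mul (2 * μhat)
  have h := (Real.hasDerivAt_sigmoid (2 * μhat * x)).comp x h1
  rw [templateDeriv, template_eq_sigmoid, e]
  exact h.congr_deriv (by ring)

theorem hasDerivAt_templateDeriv (μhat x : ℝ) :
    HasDerivAt (templateDeriv μhat) (templateDeriv₂ μhat x) x := by
  have h := hasDerivAt_template μhat x
  have h1 := (h.mul (h.const_sub 1)).const_mul (2 * μhat)
  refine h1.congr_deriv ?_
  rw [templateDeriv₂]; ring

theorem continuous_template (μhat : ℝ) : Continuous (template μhat) :=
  continuous_iff_continuousAt.2 fun x => (hasDerivAt_template μhat x).continuousAt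

theorem continuous_templateDeriv (μhat : ℝ) : Continuous (templateDeriv μhat) :=
  continuous_iff_continuousAt.2 fun x => (hasDerivAt_templateDeriv μhat x).continuousAt

theorem continuous_templateDeriv₂ (μhat : ℝ) : Continuous (templateDeriv₂ μhat) := by
  have h := continuous_template μhat
  have h' := continuous_templateDeriv μhat
  unfold templateDeriv₂
  fun_prop

theorem abs_templateDeriv_le (hμ : 0 < μhat) (x : ℝ) :
    |templateDeriv μhat x| ≤ 2 * μhat * Real.exp (-(2 * μhat * |x|)) := by
  have h0 := template_nonneg μhat x
  have h1 := template_le_one μhat x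
  rw [templateDeriv, abs_of_nonneg (by nlinarith [mul_nonneg h0 (sub_nonneg.2 h1)])]
  refine mul_le_mul_of_nonneg_left ?_ (by linarith)
  rcases le_total 0 x with hx | hx
  · have h2 : 1 - template μhat x ≤ Real.exp (-(2 * μhat * x)) := by
      rw [template_eq_sigmoid, ← Real.sigmoid_neg]; exact sigmoid_le_exp _
    rw [abs_of_nonneg hx]
    nlinarith
  · have h2 := template_le_exp μhat x
    rw [abs_of_nonpos hx, show -(2 * μhat * -x) = 2 * μhat * x by ring]
    nlinarith

theorem abs_templateDeriv₂_le (hμ : 0 < μhat) (x : ℝ) :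
    |templateDeriv₂ μhat x| ≤ (2 * μhat) ^ 2 * Real.exp (-(2 * μhat * |x|)) := by
  have h := abs_templateDeriv_le hμ x
  have h0 := template_nonneg μhat x
  have h1 := template_le_one μhat x
  have h2 : |1 - 2 * template μhat x| ≤ 1 := by rw [abs_le]; constructor <;> linarith
  rw [templateDeriv₂, abs_mul (2 * μhat), abs_of_pos (by linarith : 0 < 2 * μhat), abs_mul]
  refine (mul_le_mul_of_nonneg_left ((mul_le_of_le_one_right (abs_nonneg _) h2).trans h)
    (by linarith : 0 ≤ 2 * μhat)).trans (le_of_eq (by ring))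

end Template

/-! ### The energy estimate in `L²_η` -/

section Energy

variable {𝕜 : Type} [RCLike 𝕜]

theorem sq_sum_four_le (p q r x y z : ℝ) : (p * x + q * y + r * x + z) ^ 2
    ≤ 4 * (p ^ 2 * x ^ 2 + q ^ 2 * y ^ 2 + r ^ 2 * x ^ 2 + z ^ 2) := by
  nlinarith [sq_nonneg (p * x - q * y), sq_nonneg (p * x - r * x), sq_nonneg (p * x - z),
    sq_nonneg (q * y - r * x), sq_nonneg (q * y - z), sq_nonneg (r * x - z)]

/-- The algebra behind the resolvent estimate: with `T = |u|`, `P = |u'|`, `G = |F|` all mixed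
products are absorbed by the quadratic terms once the modulus `σ` of the spectral parameter is
large. -/
theorem absorb_mixed_terms {α₁ c₀ N M σ T P G D : ℝ} (hα : 0 < α₁) (hc₀ : 0 < c₀)
    (hσ : 0 < σ) (hR : 2 * M + N ^ 2 / α₁ ≤ c₀ / 4 * σ)
    (hD : c₀ * σ * T ^ 2 + α₁ / 2 * P ^ 2 - (2 * M * T ^ 2 + N * (T * P) + 2 * (T * G)) ≤ D) :
    c₀ / 2 * σ * T ^ 2 + α₁ / 4 * P ^ 2 ≤ 4 / (c₀ * σ) * G ^ 2 + D := by
  have h1 : N * (T * P) ≤ α₁ / 4 * P ^ 2 + N ^ 2 / α₁ * T ^ 2 := by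
    have : 0 ≤ α₁ * (P / 2 - N / α₁ * T) ^ 2 := by positivity
    have e : α₁ * (P / 2 - N / α₁ * T) ^ 2
        = α₁ / 4 * P ^ 2 + N ^ 2 / α₁ * T ^ 2 - N * (T * P) := by field_simp; ring
    linarith
  have h2 : 2 * (T * G) ≤ c₀ / 4 * σ * T ^ 2 + 4 / (c₀ * σ) * G ^ 2 := by
    have hp : 0 < c₀ * σ := mul_pos hc₀ hσ
    have : 0 ≤ c₀ * σ * (T / 2 - 2 / (c₀ * σ) * G) ^ 2 := by positivity
    have e : c₀ * σ * (T / 2 - 2 / (c₀ * σ) * G) ^ 2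
        = c₀ / 4 * σ * T ^ 2 + 4 / (c₀ * σ) * G ^ 2 - 2 * (T * G) := by field_simp; ring
    linarith
  have h3 := mul_le_mul_of_nonneg_right hR (sq_nonneg T)
  linarith

/-- On a sector slightly larger than the right half plane the functional `re + δ |im|` is bounded
below by a multiple of the modulus. -/
theorem sector_lower_bound {δ r i σ : ℝ} (hδ : 0 < δ) (hδ1 : δ ≤ 1) (hσ : 0 ≤ σ)
    (hle : σ ≤ |r| + |i|) (hs : -(δ / 4 * σ) ≤ r) : δ / 2 * σ ≤ r + δ * |i| := by
  have hi := abs_nonneg i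
  rcases le_or_gt 0 r with hr | hr
  · rw [abs_of_nonneg hr] at hle
    nlinarith
  · rw [abs_of_neg hr] at hle
    nlinarith [mul_nonneg hδ.le hσ, mul_le_mul_of_nonneg_left hδ1 (mul_nonneg hδ.le hσ)]

/-- The inner product as a real bilinear map. -/
noncomputable def innerBilin (𝕜 : Type) [RCLike 𝕜] : Plane 𝕜 →L[ℝ] Plane 𝕜 →L[ℝ] 𝕜 :=
  (isBoundedBilinearMap_inner (𝕜 := 𝕜) (E := Plane 𝕜)).toContinuousLinearMap

theorem innerBilin_apply (z w : Plane 𝕜) : innerBilin 𝕜 z w = ⟪z, w⟫_𝕜 := rfl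

/-- The real functional `re + τ im`. -/
noncomputable def reAddIm (𝕜 : Type) [RCLike 𝕜] (τ : ℝ) : 𝕜 →L[ℝ] ℝ :=
  RCLike.reCLM + τ • RCLike.imCLM

theorem reAddIm_apply (τ : ℝ) (z : 𝕜) : reAddIm 𝕜 τ z = RCLike.re z + τ * RCLike.im z := rfl

theorem abs_reAddIm_le {τ : ℝ} (hτ : |τ| ≤ 1) (z : 𝕜) : |reAddIm 𝕜 τ z| ≤ 2 * ‖z‖ := by
  rw [reAddIm_apply]
  refine (abs_add_le _ _).trans ?_
  rw [abs_mul]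
  have h1 := RCLike.abs_re_le_norm z
  have h2 := RCLike.abs_im_le_norm z
  nlinarith [abs_nonneg (RCLike.im z), norm_nonneg z]

theorem norm_le_abs_re_add_abs_im (s : 𝕜) : ‖s‖ ≤ |RCLike.re s| + |RCLike.im s| := by
  have h := RCLike.norm_sq_eq_def (z := s)
  have h1 := abs_nonneg (RCLike.re s)
  have h2 := abs_nonneg (RCLike.im s)
  refine abs_le_of_sq_le_sq' ?_ (by positivity) |>.2
  rw [h]
  nlinarith [sq_abs (RCLike.re s), sq_abs (RCLike.im s), mul_nonneg h1 h2]

/-- The pointwise energy estimate for a solution of `s u - (A u'' + c u' + b u) = F`. With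
`ℓ = re + τ im` and `k = η'/η`, the right-hand side is the derivative of `η² ℓ⟨u, A u'⟩` divided by
`η²`. The sign of `τ` is that of `im s`, which makes `ℓ(s)` comparable to `|s|` on the sector, and
`τ` is so small that `ℓ⟨z, A z⟩` remains coercive. -/
theorem energy_pointwise {α₁ a c M μ₂ δ : ℝ} (hδ : 0 < δ) (hδ1 : δ ≤ 1)
    (hδa : δ * a ≤ α₁ / 2) {A : Plane 𝕜 →L[ℝ] Plane 𝕜}
    (hAre : ∀ z, α₁ * ‖z‖ ^ 2 ≤ RCLike.re ⟪z, A z⟫_𝕜)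
    (hAim : ∀ z, |RCLike.im ⟪z, A z⟫_𝕜| ≤ a * ‖z‖ ^ 2) {NA : ℝ} (hA : ∀ z, ‖A z‖ ≤ NA * ‖z‖)
    {b : Plane 𝕜 →L[ℝ] Plane 𝕜} (hb : ‖b‖ ≤ M) {k : ℝ} (hk : |k| ≤ μ₂) {s : 𝕜}
    (hs : -(δ / 4 * ‖s‖) ≤ RCLike.re s) {τ : ℝ} (hτ : |τ| ≤ δ)
    (hτs : τ * RCLike.im s = δ * |RCLike.im s|)
    {u u₁ u₂ F : Plane 𝕜} (heq : s • u - (A u₂ + c • u₁ + b u) = F) :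
    δ / 2 * ‖s‖ * ‖u‖ ^ 2 + α₁ / 2 * ‖u₁‖ ^ 2 - (2 * M * ‖u‖ ^ 2
      + (2 * |c| + 4 * (μ₂ * NA)) * (‖u‖ * ‖u₁‖) + 2 * (‖u‖ * ‖F‖))
    ≤ reAddIm 𝕜 τ (⟪u, A u₂⟫_𝕜 + ⟪u₁, A u₁⟫_𝕜) + 2 * k * reAddIm 𝕜 τ ⟪u, A u₁⟫_𝕜 := by
  have hτ1 : |τ| ≤ 1 := hτ.trans hδ1
  have hAu : A u₂ = s • u - c • u₁ - b u - F := by rw [← heq]; abel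
  have e1 : ⟪u, A u₂⟫_𝕜
      = s * ((‖u‖ ^ 2 : ℝ) : 𝕜) - (c : 𝕜) * ⟪u, u₁⟫_𝕜 - ⟪u, b u⟫_𝕜 - ⟪u, F⟫_𝕜 := by
    rw [hAu, inner_sub_right, inner_sub_right, inner_sub_right, inner_smul_right,
      RCLike.real_smul_eq_coe_smul (K := 𝕜) c u₁, inner_smul_right, inner_self_eq_norm_sq_to_K]
    push_cast
    ring
  have e2 : reAddIm 𝕜 τ (s * ((‖u‖ ^ 2 : ℝ) : 𝕜)) = (RCLike.re s + τ * RCLike.im s) * ‖u‖ ^ 2 := by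
    rw [reAddIm_apply, mul_comm, RCLike.re_ofReal_mul, RCLike.im_ofReal_mul]; ring
  have e3 : reAddIm 𝕜 τ ((c : 𝕜) * ⟪u, u₁⟫_𝕜) = c * reAddIm 𝕜 τ ⟪u, u₁⟫_𝕜 := by
    rw [reAddIm_apply, reAddIm_apply, RCLike.re_ofReal_mul, RCLike.im_ofReal_mul]; ring
  have i1 : |c * reAddIm 𝕜 τ ⟪u, u₁⟫_𝕜| ≤ 2 * |c| * (‖u‖ * ‖u₁‖) := by
    rw [abs_mul]
    have := (abs_reAddIm_le hτ1 ⟪u, u₁⟫_𝕜).trans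
      (mul_le_mul_of_nonneg_left (norm_inner_le_norm u u₁) two_pos.le)
    nlinarith [mul_le_mul_of_nonneg_left this (abs_nonneg c)]
  have i2 : |reAddIm 𝕜 τ ⟪u, b u⟫_𝕜| ≤ 2 * M * ‖u‖ ^ 2 := by
    have h1 := (abs_reAddIm_le hτ1 ⟪u, b u⟫_𝕜).trans
      (mul_le_mul_of_nonneg_left (norm_inner_le_norm u (b u)) two_pos.le)
    have h2 : ‖b u‖ ≤ M * ‖u‖ := b.le_of_opNorm_le hb u
    nlinarith [mul_le_mul_of_nonneg_left h2 (norm_nonneg u)]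
  have i3 : |reAddIm 𝕜 τ ⟪u, F⟫_𝕜| ≤ 2 * (‖u‖ * ‖F‖) :=
    (abs_reAddIm_le hτ1 ⟪u, F⟫_𝕜).trans
      (mul_le_mul_of_nonneg_left (norm_inner_le_norm u F) two_pos.le)
  have i4 : |2 * k * reAddIm 𝕜 τ ⟪u, A u₁⟫_𝕜| ≤ 4 * (μ₂ * NA) * (‖u‖ * ‖u₁‖) := by
    rw [abs_mul, abs_mul, abs_two]
    have h1 := (abs_reAddIm_le hτ1 ⟪u, A u₁⟫_𝕜).trans
      (mul_le_mul_of_nonneg_left (norm_inner_le_norm u (A u₁)) two_pos.le)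
    have h2 : 2 * (‖u‖ * ‖A u₁‖) ≤ 2 * (‖u‖ * (NA * ‖u₁‖)) := by
      have := mul_le_mul_of_nonneg_left (hA u₁) (norm_nonneg u)
      linarith
    have h3 := mul_le_mul hk (h1.trans h2) (abs_nonneg _) ((abs_nonneg k).trans hk)
    nlinarith
  have i5 : α₁ / 2 * ‖u₁‖ ^ 2 ≤ reAddIm 𝕜 τ ⟪u₁, A u₁⟫_𝕜 := by
    rw [reAddIm_apply]
    have h1 := hAre u₁
    have h2 : |τ * RCLike.im ⟪u₁, A u₁⟫_𝕜| ≤ δ * (a * ‖u₁‖ ^ 2) := by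
      rw [abs_mul]
      exact mul_le_mul hτ (hAim u₁) (abs_nonneg _) hδ.le
    have h3 := mul_le_mul_of_nonneg_right hδa (sq_nonneg ‖u₁‖)
    have h4 := (abs_le.1 h2).1
    nlinarith
  have i6 : δ / 2 * ‖s‖ * ‖u‖ ^ 2 ≤ (RCLike.re s + τ * RCLike.im s) * ‖u‖ ^ 2 := by
    rw [hτs]
    refine mul_le_mul_of_nonneg_right ?_ (sq_nonneg _)
    exact sector_lower_bound hδ hδ1 (norm_nonneg s) (norm_le_abs_re_add_abs_im s) hs
  rw [map_add, e1, map_sub, map_sub, map_sub, e2, e3]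
  have j1 := (abs_le.1 i1).2
  have j2 := (abs_le.1 i2).2
  have j3 := (abs_le.1 i3).2
  have j4 := (abs_le.1 i4).1
  linarith

/-- The derivative of `η² ℓ⟨u, A u'⟩` is integrable and has integral zero, for `u` in the
weighted Sobolev space of order two and `ℓ = re + τ im`. -/
theorem exists_energy_density {μ μ₂ τ NA : ℝ} (hμ : 0 ≤ μ) (hμ₂ : μ ≤ μ₂) (hτ1 : |τ| ≤ 1)
    (hNA : 0 < NA) {A : Plane 𝕜 →L[ℝ] Plane 𝕜} (hA : ∀ z, ‖A z‖ ≤ NA * ‖z‖)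
    {u u₁ u₂ : ℝ → Plane 𝕜} (hw1 : HasWeakDeriv 1 u u₁) (hw2 : HasWeakDeriv 1 u₁ u₂)
    (mu : MemL2w μ u) (mu₁ : MemL2w μ u₁) (mu₂ : MemL2w μ u₂) :
    ∃ D : ℝ → ℝ, Integrable D ∧ ∫ x, D x = 0 ∧ ∀ᵐ x, D x = weight μ x ^ 2 *
      (reAddIm 𝕜 τ (⟪u x, A (u₂ x)⟫_𝕜 + ⟪u₁ x, A (u₁ x)⟫_𝕜)
        + 2 * weightSlope μ x * reAddIm 𝕜 τ ⟪u x, A (u₁ x)⟫_𝕜) := by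
  -- absolutely continuous representatives
  obtain ⟨U, hU, hUe⟩ := hw1.exists_isPrim
  obtain ⟨U₁, hU₁, hU₁e⟩ := hw2.exists_isPrim
  have hU' : IsPrim U U₁ := hU.congr_ae hU₁e
  have hE := (hU'.bilin (innerBilin 𝕜) (hU₁.clm A)).clm (reAddIm 𝕜 τ)
  have hη : IsPrim (fun x => weight μ x ^ 2) (fun x => 2 * weightSlope μ x * weight μ x ^ 2) := by
    refine IsPrim.of_hasDerivAt (fun x => ?_) ?_
    · exact ((hasDerivAt_weight μ x).pow 2).congr_deriv (by ring)
    · exact (continuous_const.mul (continuous_weightSlope μ)).mul ((continuous_weight μ).pow 2)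
  have hP := hη.bilin (ContinuousLinearMap.mul ℝ ℝ) hE
  simp only [ContinuousLinearMap.mul_apply', innerBilin_apply] at hP
  set D : ℝ → ℝ := fun x => weight μ x ^ 2 * reAddIm 𝕜 τ (⟪U x, A (u₂ x)⟫_𝕜 + ⟪U₁ x, A (U₁ x)⟫_𝕜)
    + 2 * weightSlope μ x * weight μ x ^ 2 * reAddIm 𝕜 τ ⟪U x, A (U₁ x)⟫_𝕜 with hD
  have mU : MemL2w μ U := mu.congr hUe
  have mU₁ : MemL2w μ U₁ := mu₁.congr hU₁e
  have hdom := (mU.integrable.add (mU₁.integrable.add mu₂.integrable))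
  have hprod : ∀ z w : Plane 𝕜, |reAddIm 𝕜 τ ⟪z, A w⟫_𝕜| ≤ NA * (‖z‖ ^ 2 + ‖w‖ ^ 2) := by
    intro z w
    have h1 := (abs_reAddIm_le hτ1 ⟪z, A w⟫_𝕜).trans
      (mul_le_mul_of_nonneg_left (norm_inner_le_norm z (A w)) two_pos.le)
    have h2 := mul_le_mul_of_nonneg_left (hA w) (norm_nonneg z)
    nlinarith [mul_nonneg hNA.le (sq_nonneg (‖z‖ - ‖w‖))]
  have iP : Integrable fun x => weight μ x ^ 2 * reAddIm 𝕜 τ ⟪U x, A (U₁ x)⟫_𝕜 := by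
    refine (hdom.const_mul NA).mono' hP.continuous.aestronglyMeasurable
      (.of_forall fun x => ?_)
    rw [Real.norm_eq_abs, abs_mul, abs_of_nonneg (sq_nonneg _)]
    have h1 := mul_le_mul_of_nonneg_left (hprod (U x) (U₁ x)) (sq_nonneg (weight μ x))
    have h2 : 0 ≤ NA * (weight μ x ^ 2 * ‖u₂ x‖ ^ 2) := by positivity
    simp only [Pi.add_apply]
    linarith
  have iD : Integrable D := by
    refine (hdom.const_mul (NA * (2 + 2 * μ₂))).mono' hP.1.aestronglyMeasurable
      (.of_forall fun x => ?_)
    have h1 := hprod (U x) (u₂ x)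
    have h2 := hprod (U₁ x) (U₁ x)
    have h3 := hprod (U x) (U₁ x)
    have hk : |weightSlope μ x| ≤ μ₂ := (abs_weightSlope_le hμ x).trans hμ₂
    have h4 : |2 * weightSlope μ x * reAddIm 𝕜 τ ⟪U x, A (U₁ x)⟫_𝕜|
        ≤ 2 * μ₂ * (NA * (‖U x‖ ^ 2 + ‖U₁ x‖ ^ 2)) := by
      rw [abs_mul, abs_mul, abs_two]
      exact mul_le_mul (by linarith) h3 (abs_nonneg _) (by linarith [hμ.trans hμ₂])
    have e : D x = weight μ x ^ 2 * (reAddIm 𝕜 τ ⟪U x, A (u₂ x)⟫_𝕜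
        + reAddIm 𝕜 τ ⟪U₁ x, A (U₁ x)⟫_𝕜
        + 2 * weightSlope μ x * reAddIm 𝕜 τ ⟪U x, A (U₁ x)⟫_𝕜) := by
      simp only [hD, map_add]; ring
    rw [Real.norm_eq_abs, e, abs_mul, abs_of_nonneg (sq_nonneg _)]
    simp only [Pi.add_apply]
    have h5 : |reAddIm 𝕜 τ ⟪U x, A (u₂ x)⟫_𝕜 + reAddIm 𝕜 τ ⟪U₁ x, A (U₁ x)⟫_𝕜
        + 2 * weightSlope μ x * reAddIm 𝕜 τ ⟪U x, A (U₁ x)⟫_𝕜|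
        ≤ NA * (2 + 2 * μ₂) * (‖U x‖ ^ 2 + (‖U₁ x‖ ^ 2 + ‖u₂ x‖ ^ 2)) := by
      refine (abs_add_three _ _ _).trans ?_
      have hμ₂0 := hμ.trans hμ₂
      have p1 : 0 ≤ NA * ‖U x‖ ^ 2 := by positivity
      have p2 : 0 ≤ NA * ‖u₂ x‖ ^ 2 := by positivity
      have p3 : 0 ≤ 2 * μ₂ * (NA * ‖u₂ x‖ ^ 2) := by positivity
      linarith
    have := mul_le_mul_of_nonneg_left h5 (sq_nonneg (weight μ x))
    linarith
  have hD0 : ∫ x, D x = 0 := hP.integral_eq_zero iP iD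
  refine ⟨D, iD, hD0, ?_⟩
  filter_upwards [hUe, hU₁e] with x hx0 hx1
  simp only [hD, hx0, hx1]; ring

/-- The second derivative is recovered from the equation. -/
theorem second_deriv_estimate {α₁ c M μ : ℝ} (hα : 0 < α₁) {A : Plane 𝕜 →L[ℝ] Plane 𝕜}
    (hAre : ∀ z, α₁ * ‖z‖ ^ 2 ≤ RCLike.re ⟪z, A z⟫_𝕜)
    {b : ℝ → Plane 𝕜 →L[ℝ] Plane 𝕜} (hb : ∀ x, ‖b x‖ ≤ M) {s : 𝕜} {u u₁ u₂ F : ℝ → Plane 𝕜}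
    (mu : MemL2w μ u) (mu₁ : MemL2w μ u₁) (mu₂ : MemL2w μ u₂) (mF : MemL2w μ F)
    (heq : ∀ᵐ x, s • u x - (A (u₂ x) + c • u₁ x + b x (u x)) = F x) :
    normL2w μ u₂ ^ 2 ≤ 4 / α₁ ^ 2 * (‖s‖ ^ 2 * normL2w μ u ^ 2 + c ^ 2 * normL2w μ u₁ ^ 2
      + M ^ 2 * normL2w μ u ^ 2 + normL2w μ F ^ 2) := by
  have hpt2 : ∀ᵐ x, weight μ x ^ 2 * ‖u₂ x‖ ^ 2 ≤ 4 / α₁ ^ 2 *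
      (‖s‖ ^ 2 * (weight μ x ^ 2 * ‖u x‖ ^ 2) + c ^ 2 * (weight μ x ^ 2 * ‖u₁ x‖ ^ 2)
        + M ^ 2 * (weight μ x ^ 2 * ‖u x‖ ^ 2) + weight μ x ^ 2 * ‖F x‖ ^ 2) := by
    filter_upwards [heq] with x hx
    have hlow : α₁ * ‖u₂ x‖ ≤ ‖A (u₂ x)‖ := by
      by_cases h0 : ‖u₂ x‖ = 0
      · rw [h0, mul_zero]; exact norm_nonneg _
      · have h1 := (hAre (u₂ x)).trans ((RCLike.re_le_norm _).trans
          (norm_inner_le_norm (u₂ x) (A (u₂ x))))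
        have h2 : 0 < ‖u₂ x‖ := lt_of_le_of_ne (norm_nonneg _) (Ne.symm h0)
        refine le_of_mul_le_mul_left ?_ h2
        linarith
    have hup : ‖A (u₂ x)‖ ≤ ‖s‖ * ‖u x‖ + |c| * ‖u₁ x‖ + M * ‖u x‖ + ‖F x‖ := by
      have e : A (u₂ x) = s • u x - c • u₁ x - b x (u x) - F x := by rw [← hx]; abel
      rw [e]
      refine (norm_sub_le _ _).trans (add_le_add ((norm_sub_le _ _).trans
        (add_le_add ((norm_sub_le _ _).trans (add_le_add ?_ ?_)) ?_)) le_rfl)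
      · rw [norm_smul]
      · rw [norm_smul, Real.norm_eq_abs]
      · exact (b x).le_of_opNorm_le (hb x) _
    have h1 : (α₁ * ‖u₂ x‖) ^ 2 ≤ 4 * (‖s‖ ^ 2 * ‖u x‖ ^ 2 + c ^ 2 * ‖u₁ x‖ ^ 2
        + M ^ 2 * ‖u x‖ ^ 2 + ‖F x‖ ^ 2) := by
      refine (pow_le_pow_left₀ (by positivity) (hlow.trans hup) 2).trans ?_
      rw [← sq_abs c]
      exact sq_sum_four_le _ _ _ _ _ _
    have h2 : ‖u₂ x‖ ^ 2 ≤ 4 / α₁ ^ 2 * (‖s‖ ^ 2 * ‖u x‖ ^ 2 + c ^ 2 * ‖u₁ x‖ ^ 2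
        + M ^ 2 * ‖u x‖ ^ 2 + ‖F x‖ ^ 2) := by
      rw [div_mul_eq_mul_div, le_div_iff₀ (by positivity)]
      linarith
    have h3 := mul_le_mul_of_nonneg_left h2 (sq_nonneg (weight μ x))
    linarith
  have i1 := mu.integrable.const_mul (‖s‖ ^ 2)
  have i2 := mu₁.integrable.const_mul (c ^ 2)
  have i3 := mu.integrable.const_mul (M ^ 2)
  have i12 : Integrable fun x => ‖s‖ ^ 2 * (weight μ x ^ 2 * ‖u x‖ ^ 2)
      + c ^ 2 * (weight μ x ^ 2 * ‖u₁ x‖ ^ 2) := i1.add i2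
  have i123 : Integrable fun x => ‖s‖ ^ 2 * (weight μ x ^ 2 * ‖u x‖ ^ 2)
      + c ^ 2 * (weight μ x ^ 2 * ‖u₁ x‖ ^ 2) + M ^ 2 * (weight μ x ^ 2 * ‖u x‖ ^ 2) := i12.add i3
  have hi := integral_mono_ae mu₂.integrable
    ((i123.add mF.integrable).const_mul (4 / α₁ ^ 2)) hpt2
  simp only [Pi.add_apply] at hi
  rw [integral_const_mul, integral_add i123 mF.integrable, integral_add i12 i3,
    integral_add i1 i2, integral_const_mul, integral_const_mul, integral_const_mul,
    ← mu.normL2w_sq, ← mu₁.normL2w_sq, ← mF.normL2w_sq, ← mu₂.normL2w_sq] at hi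
  exact hi

/-- The resolvent estimate in `L²_η` for the operator `A ∂² + c ∂ + b(x)`, uniformly in the weights
`μ ≤ μ₂`, in the matrices `A` with given coercivity constants and in the coefficients `b` with
`‖b‖ ≤ M`. -/
theorem resolvent_estimate (𝕜 : Type) [RCLike 𝕜] {α₁ a M μ₂ : ℝ} (c : ℝ) (hα : 0 < α₁)
    (ha : 0 ≤ a) :
    ∃ κ > 0, ∃ R ≥ 1, ∃ C > 0, ∀ A : Plane 𝕜 →L[ℝ] Plane 𝕜,
      (∀ z, α₁ * ‖z‖ ^ 2 ≤ RCLike.re ⟪z, A z⟫_𝕜) → (∀ z, |RCLike.im ⟪z, A z⟫_𝕜| ≤ a * ‖z‖ ^ 2) →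
      ‖A‖ ≤ α₁ + a → ∀ b : ℝ → Plane 𝕜 →L[ℝ] Plane 𝕜, (∀ x, ‖b x‖ ≤ M) →
      ∀ μ, 0 ≤ μ → μ ≤ μ₂ → ∀ s : 𝕜, R ≤ ‖s‖ → -(κ * ‖s‖) ≤ RCLike.re s →
      ∀ u u₁ u₂ F : ℝ → Plane 𝕜, HasWeakDeriv 1 u u₁ → HasWeakDeriv 1 u₁ u₂ →
        MemL2w μ u → MemL2w μ u₁ → MemL2w μ u₂ → MemL2w μ F →
        (∀ᵐ x, s • u x - (A (u₂ x) + c • u₁ x + b x (u x)) = F x) →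
        ‖s‖ ^ 2 * normL2w μ u ^ 2 + ‖s‖ * normL2w μ u₁ ^ 2 + normL2w μ u₂ ^ 2
          ≤ C * normL2w μ F ^ 2 := by
  obtain ⟨δ, hδ, hδ1, hδa⟩ : ∃ δ : ℝ, 0 < δ ∧ δ ≤ 1 ∧ δ * a ≤ α₁ / 2 := by
    refine ⟨min 1 (α₁ / (2 * (a + 1))), by positivity, min_le_left _ _, ?_⟩
    have h1 : min 1 (α₁ / (2 * (a + 1))) ≤ α₁ / (2 * (a + 1)) := min_le_right _ _
    have h2 : α₁ / (2 * (a + 1)) * (a + 1) = α₁ / 2 := by field_simp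
    have h3 : 0 < min 1 (α₁ / (2 * (a + 1))) := by positivity
    nlinarith [mul_le_mul_of_nonneg_right h1 (by linarith : 0 ≤ a + 1)]
  set c₀ := δ / 2 with hc₀def
  have hc₀ : 0 < c₀ := by positivity
  set N := 2 * |c| + 4 * (μ₂ * (α₁ + a)) with hN
  set C₁ := (2 / c₀ + 4 / α₁) * (4 / c₀) with hC₁
  set C₂ := 4 / α₁ ^ 2 * (C₁ + c ^ 2 * C₁ + M ^ 2 * C₁ + 1) with hC₂
  have hC₁0 : 0 < C₁ := by positivity
  have hC₂0 : 0 < C₂ := by positivity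
  -- the threshold for `‖s‖` is the one of `absorb_mixed_terms`
  refine ⟨δ / 4, by positivity, max 1 ((2 * M + N ^ 2 / α₁) / (c₀ / 4)), le_max_left _ _,
    2 * C₁ + C₂, by positivity, ?_⟩
  intro A hAre hAim hAn b hb μ hμ hμ₂ s hR hs u u₁ u₂ F hw1 hw2 mu mu₁ mu₂ mF heq
  have hσ1 : 1 ≤ ‖s‖ := (le_max_left _ _).trans hR
  have hσ0 : 0 < ‖s‖ := by linarith
  have hR' : 2 * M + N ^ 2 / α₁ ≤ c₀ / 4 * ‖s‖ := by
    have := (le_max_right _ _).trans hR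
    rwa [div_le_iff₀' (by positivity)] at this
  have hA : ∀ z, ‖A z‖ ≤ (α₁ + a) * ‖z‖ := fun z => A.le_of_opNorm_le hAn z
  obtain ⟨τ, hτ, hτs⟩ : ∃ τ : ℝ, |τ| ≤ δ ∧ τ * RCLike.im s = δ * |RCLike.im s| := by
    rcases le_total 0 (RCLike.im s) with h | h
    · exact ⟨δ, by rw [abs_of_pos hδ], by rw [abs_of_nonneg h]⟩
    · exact ⟨-δ, by rw [abs_neg, abs_of_pos hδ], by rw [abs_of_nonpos h]; ring⟩
  have hτ1 : |τ| ≤ 1 := hτ.trans hδ1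
  obtain ⟨D, iD, hD0, hDe⟩ := exists_energy_density hμ hμ₂ hτ1 (by linarith : 0 < α₁ + a) hA
    hw1 hw2 mu mu₁ mu₂
  -- the pointwise estimate
  have hpt : ∀ᵐ x, c₀ / 2 * ‖s‖ * (weight μ x ^ 2 * ‖u x‖ ^ 2)
      + α₁ / 4 * (weight μ x ^ 2 * ‖u₁ x‖ ^ 2)
      ≤ 4 / (c₀ * ‖s‖) * (weight μ x ^ 2 * ‖F x‖ ^ 2) + D x := by
    filter_upwards [heq, hDe] with x hx e
    have h1 := energy_pointwise hδ hδ1 hδa hAre hAim hA (hb x)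
      ((abs_weightSlope_le hμ x).trans hμ₂) hs hτ hτs hx
    have h2 := absorb_mixed_terms hα hc₀ hσ0 hR' h1
    rw [e]
    have h3 := mul_le_mul_of_nonneg_left h2 (sq_nonneg (weight μ x))
    linarith
  have hint := integral_mono_ae
    ((mu.integrable.const_mul (c₀ / 2 * ‖s‖)).add (mu₁.integrable.const_mul (α₁ / 4)))
    ((mF.integrable.const_mul (4 / (c₀ * ‖s‖))).add iD) hpt
  simp only [Pi.add_apply] at hint
  rw [integral_add (mu.integrable.const_mul _) (mu₁.integrable.const_mul _),
    integral_add (mF.integrable.const_mul _) iD, integral_const_mul, integral_const_mul,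
    integral_const_mul, hD0, add_zero, ← mu.normL2w_sq, ← mu₁.normL2w_sq, ← mF.normL2w_sq] at hint
  set T := normL2w μ u ^ 2
  set P := normL2w μ u₁ ^ 2
  set G := normL2w μ F ^ 2
  have hT : 0 ≤ T := sq_nonneg _
  have hPn : 0 ≤ P := sq_nonneg _
  have hG : 0 ≤ G := sq_nonneg _
  have hmain : c₀ / 2 * (‖s‖ ^ 2 * T) + α₁ / 4 * (‖s‖ * P) ≤ 4 / c₀ * G := by
    have := mul_le_mul_of_nonneg_left hint hσ0.le
    have e : ‖s‖ * (4 / (c₀ * ‖s‖) * G) = 4 / c₀ * G := by field_simp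
    rw [e] at this
    linarith
  have hsT0 : 0 ≤ ‖s‖ ^ 2 * T := by positivity
  have hsP0 : 0 ≤ ‖s‖ * P := by positivity
  have hT1 : ‖s‖ ^ 2 * T ≤ C₁ * G := by
    have h1 : ‖s‖ ^ 2 * T ≤ 2 / c₀ * (4 / c₀ * G) := by
      rw [div_mul_eq_mul_div, le_div_iff₀ hc₀]
      have := mul_nonneg (by positivity : 0 ≤ α₁ / 4) hsP0
      linarith
    have h2 : 0 ≤ 4 / α₁ * (4 / c₀) * G := by positivity
    rw [hC₁]; linarith
  have hP1 : ‖s‖ * P ≤ C₁ * G := by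
    have h1 : ‖s‖ * P ≤ 4 / α₁ * (4 / c₀ * G) := by
      rw [div_mul_eq_mul_div, le_div_iff₀ hα]
      have := mul_nonneg (by positivity : 0 ≤ c₀ / 2) hsT0
      linarith
    have h2 : 0 ≤ 2 / c₀ * (4 / c₀) * G := by positivity
    rw [hC₁]; linarith
  have hQ : normL2w μ u₂ ^ 2 ≤ 4 / α₁ ^ 2 * (‖s‖ ^ 2 * T + c ^ 2 * P + M ^ 2 * T + G) :=
    second_deriv_estimate hα hAre hb mu mu₁ mu₂ mF heq
  have hTT : T ≤ C₁ * G := by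
    have : T ≤ ‖s‖ ^ 2 * T := le_mul_of_one_le_left hT (one_le_pow₀ hσ1)
    linarith
  have hPP : P ≤ C₁ * G := by
    have : P ≤ ‖s‖ * P := le_mul_of_one_le_left hPn hσ1
    linarith
  have hQ2 : normL2w μ u₂ ^ 2 ≤ C₂ * G := by
    refine hQ.trans ?_
    rw [hC₂, mul_assoc]
    refine mul_le_mul_of_nonneg_left ?_ (by positivity)
    have := mul_le_mul_of_nonneg_left hTT (sq_nonneg M)
    have := mul_le_mul_of_nonneg_left hPP (sq_nonneg c)
    linarith
  linarith

end Energy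

/-! ### Real matrices acting on `𝕜²` -/

section Matrices

theorem act_coord {𝕜 : Type} [RCLike 𝕜] (M : Matrix (Fin 2) (Fin 2) ℝ) (z : Plane 𝕜) (i : Fin 2) :
    act 𝕜 M z i = (M i 0 : 𝕜) * z 0 + (M i 1 : 𝕜) * z 1 := by
  fin_cases i <;> simp [act, Matrix.toLpLin_apply, RCLike.algebraMap_eq_ofReal]

/-- A real matrix acting on `𝕜²`, as a continuous real-linear map depending linearly on the
matrix. -/
noncomputable def actL (𝕜 : Type) [RCLike 𝕜] :
    Matrix (Fin 2) (Fin 2) ℝ →ₗ[ℝ] (Plane 𝕜 →L[ℝ] Plane 𝕜) where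
  toFun M := (LinearMap.toContinuousLinearMap (act 𝕜 M)).restrictScalars ℝ
  map_add' M N := by
    ext z i
    change act 𝕜 (M + N) z i = act 𝕜 M z i + act 𝕜 N z i
    simp only [act_coord, Matrix.add_apply, RCLike.ofReal_add]
    ring
  map_smul' a M := by
    ext z i
    change act 𝕜 (a • M) z i = a • act 𝕜 M z i
    simp only [act_coord, Matrix.smul_apply, smul_eq_mul, RCLike.ofReal_mul,
      RCLike.real_smul_eq_coe_mul]
    ring

variable {𝕜 : Type} [RCLike 𝕜]

theorem actL_apply (M : Matrix (Fin 2) (Fin 2) ℝ) (z : Plane 𝕜) : actL 𝕜 M z = act 𝕜 M z := rfl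

theorem map_matrix_eq_sum {F : Type*} [AddCommMonoid F] [Module ℝ F]
    (L : Matrix (Fin 2) (Fin 2) ℝ →ₗ[ℝ] F) (M : Matrix (Fin 2) (Fin 2) ℝ) :
    L M = ∑ i, ∑ j, M i j • L (Matrix.single i j 1) := by
  conv_lhs => rw [Matrix.matrix_eq_sum_single M]
  simp only [map_sum]
  refine Finset.sum_congr rfl fun i _ => Finset.sum_congr rfl fun j _ => ?_
  rw [← map_smul, Matrix.smul_single, smul_eq_mul, mul_one]

section Operators

variable {F : Type*} [NormedAddCommGroup F] [NormedSpace ℝ F]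
  (L : Matrix (Fin 2) (Fin 2) ℝ →ₗ[ℝ] F)

theorem hasDerivAt_map_matrix {M : ℝ → Matrix (Fin 2) (Fin 2) ℝ} {M' : Matrix (Fin 2) (Fin 2) ℝ}
    {x : ℝ} (h : ∀ i j, HasDerivAt (fun x => M x i j) (M' i j) x) :
    HasDerivAt (fun x => L (M x)) (L M') x := by
  have e : (fun x => L (M x)) = fun x => ∑ i, ∑ j, M x i j • L (Matrix.single i j 1) :=
    funext fun x => map_matrix_eq_sum L (M x)
  rw [e, map_matrix_eq_sum L M']
  exact HasDerivAt.fun_sum fun i _ => HasDerivAt.fun_sum fun j _ => (h i j).smul_const _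

theorem continuous_map_matrix {M : ℝ → Matrix (Fin 2) (Fin 2) ℝ}
    (h : ∀ i j, Continuous fun x => M x i j) : Continuous fun x => L (M x) := by
  have e : (fun x => L (M x)) = fun x => ∑ i, ∑ j, M x i j • L (Matrix.single i j 1) :=
    funext fun x => map_matrix_eq_sum L (M x)
  rw [e]
  exact continuous_finsetSum _ fun i _ => continuous_finsetSum _ fun j _ =>
    (h i j).smul continuous_const

end Operators

theorem hasDerivAt_actL {M : ℝ → Matrix (Fin 2) (Fin 2) ℝ} {M' : Matrix (Fin 2) (Fin 2) ℝ} {x : ℝ}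
    (h : ∀ i j, HasDerivAt (fun x => M x i j) (M' i j) x) :
    HasDerivAt (fun x => actL 𝕜 (M x)) (actL 𝕜 M') x :=
  hasDerivAt_map_matrix (F := Plane 𝕜 →L[ℝ] Plane 𝕜) (actL 𝕜) h

theorem continuous_actL {M : ℝ → Matrix (Fin 2) (Fin 2) ℝ}
    (h : ∀ i j, Continuous fun x => M x i j) : Continuous fun x => actL 𝕜 (M x) :=
  continuous_map_matrix (F := Plane 𝕜 →L[ℝ] Plane 𝕜) (actL 𝕜) h

theorem plane_norm_sq (z : Plane 𝕜) : ‖z‖ ^ 2 = ‖z 0‖ ^ 2 + ‖z 1‖ ^ 2 := by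
  rw [EuclideanSpace.norm_sq_eq, Fin.sum_univ_two]

theorem norm_actL_le {M : Matrix (Fin 2) (Fin 2) ℝ} {m : ℝ} (h : ∀ i j, |M i j| ≤ m) :
    ‖actL 𝕜 M‖ ≤ 2 * m := by
  have hm : 0 ≤ m := (abs_nonneg _).trans (h 0 0)
  refine ContinuousLinearMap.opNorm_le_bound _ (by positivity) fun z => ?_
  refine (pow_le_pow_iff_left₀ (norm_nonneg _) (by positivity) two_ne_zero).1 ?_
  have hc : ∀ i, ‖actL 𝕜 M z i‖ ^ 2 ≤ (m * (‖z 0‖ + ‖z 1‖)) ^ 2 := fun i => by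
    refine pow_le_pow_left₀ (norm_nonneg _) ?_ 2
    rw [actL_apply, act_coord, mul_add]
    refine (norm_add_le _ _).trans (add_le_add ?_ ?_) <;> rw [norm_mul, RCLike.norm_ofReal]
    · exact mul_le_mul_of_nonneg_right (h i 0) (norm_nonneg _)
    · exact mul_le_mul_of_nonneg_right (h i 1) (norm_nonneg _)
  have h1 : (‖z 0‖ + ‖z 1‖) ^ 2 ≤ 2 * ‖z‖ ^ 2 := by
    rw [plane_norm_sq]
    nlinarith [sq_nonneg (‖z 0‖ - ‖z 1‖)]
  rw [plane_norm_sq]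
  have h2 := mul_le_mul_of_nonneg_left h1 (sq_nonneg m)
  have h3 := hc 0
  have h4 := hc 1
  linarith [mul_pow m (‖z 0‖ + ‖z 1‖) 2, mul_pow (2 * m) ‖z‖ 2, mul_pow 2 m 2]

theorem mulMat_eq (α₁ α₂ : ℝ) : mulMat α₁ α₂ = α₁ • (1 : Matrix (Fin 2) (Fin 2) ℝ) + rotGen α₂ := by
  ext i j
  fin_cases i <;> fin_cases j <;> simp [mulMat, rotGen]

theorem actL_one (z : Plane 𝕜) : actL 𝕜 1 z = z := by
  ext i
  rw [actL_apply, act_coord]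
  fin_cases i <;> simp [Matrix.one_apply]

theorem norm_actL_rotGen (θ : ℝ) (z : Plane 𝕜) : ‖actL 𝕜 (rotGen θ) z‖ = |θ| * ‖z‖ := by
  refine (pow_left_inj₀ (norm_nonneg _) (by positivity) two_ne_zero).1 ?_
  rw [mul_pow, plane_norm_sq, plane_norm_sq z, actL_apply, act_coord, act_coord]
  simp [rotGen, mul_pow]
  ring

theorem re_inner_rotGen (θ : ℝ) (z : Plane 𝕜) : RCLike.re ⟪z, actL 𝕜 (rotGen θ) z⟫_𝕜 = 0 := by
  rw [actL_apply, PiLp.inner_apply, Fin.sum_univ_two, act_coord, act_coord]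
  simp [rotGen, RCLike.inner_apply]
  ring

theorem inner_mulMat (α₁ α₂ : ℝ) (z : Plane 𝕜) : ⟪z, actL 𝕜 (mulMat α₁ α₂) z⟫_𝕜
    = ((α₁ * ‖z‖ ^ 2 : ℝ) : 𝕜) + ⟪z, actL 𝕜 (rotGen α₂) z⟫_𝕜 := by
  rw [mulMat_eq, map_add, map_smul, _root_.add_apply, _root_.smul_apply, actL_one, inner_add_right,
    RCLike.real_smul_eq_coe_smul (K := 𝕜), inner_smul_right, inner_self_eq_norm_sq_to_K]
  push_cast
  rfl

/-- Coercivity of `A`: it comes from the symmetric part `α₁ I` alone. -/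
theorem re_inner_mulMat (α₁ α₂ : ℝ) (z : Plane 𝕜) :
    RCLike.re ⟪z, actL 𝕜 (mulMat α₁ α₂) z⟫_𝕜 = α₁ * ‖z‖ ^ 2 := by
  rw [inner_mulMat, map_add, re_inner_rotGen, RCLike.ofReal_re, add_zero]

theorem abs_im_inner_mulMat_le (α₁ α₂ : ℝ) (z : Plane 𝕜) :
    |RCLike.im ⟪z, actL 𝕜 (mulMat α₁ α₂) z⟫_𝕜| ≤ |α₂| * ‖z‖ ^ 2 := by
  rw [inner_mulMat, map_add, RCLike.ofReal_im, zero_add]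
  refine (RCLike.abs_im_le_norm _).trans ((norm_inner_le_norm _ _).trans (le_of_eq ?_))
  rw [norm_actL_rotGen]; ring

theorem norm_actL_mulMat_le {α₁ : ℝ} (hα : 0 < α₁) (α₂ : ℝ) :
    ‖actL 𝕜 (mulMat α₁ α₂)‖ ≤ α₁ + |α₂| := by
  refine ContinuousLinearMap.opNorm_le_bound _ (by positivity) fun z => ?_
  rw [mulMat_eq, map_add, map_smul, _root_.add_apply, _root_.smul_apply, actL_one, add_mul]
  refine (norm_add_le _ _).trans (le_of_eq ?_)
  rw [norm_smul, norm_actL_rotGen, Real.norm_of_nonneg hα.le]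

end Matrices

/-! ### Calculus of weak derivatives -/

section WeakCalculus

variable {𝕜 : Type} [RCLike 𝕜]

theorem HasWeakDeriv.clm {v w : ℝ → Plane 𝕜} (h : HasWeakDeriv 1 v w)
    (L : Plane 𝕜 →L[ℝ] Plane 𝕜) : HasWeakDeriv 1 (fun x => L (v x)) (fun x => L (w x)) := by
  obtain ⟨V, hV, e⟩ := h.exists_isPrim
  exact (hV.clm L).hasWeakDeriv.congr (e.symm.mono fun x hx => by simp only [hx]) (ae_eq_refl _)

theorem IsPrim.coeff_apply {E : Type*} [NormedAddCommGroup E] [NormedSpace ℝ E] [CompleteSpace E]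
    {V w : ℝ → E} (hV : IsPrim V w)
    {b b' : ℝ → E →L[ℝ] E} (hb : ∀ x, HasDerivAt b (b' x) x) (hb' : Continuous b') :
    IsPrim (fun x => b x (V x)) (fun x => b x (w x) + b' x (V x)) :=
  (IsPrim.of_hasDerivAt hb hb').bilin (ContinuousLinearMap.id ℝ (E →L[ℝ] E)) hV

/-- The product rule for a `C¹` operator-valued coefficient and a weakly differentiable function. -/
theorem HasWeakDeriv.coeff_apply {v w : ℝ → Plane 𝕜} (h : HasWeakDeriv 1 v w)
    {b b' : ℝ → Plane 𝕜 →L[ℝ] Plane 𝕜} (hb : ∀ x, HasDerivAt b (b' x) x) (hb' : Continuous b') :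
    HasWeakDeriv 1 (fun x => b x (v x)) (fun x => b x (w x) + b' x (v x)) := by
  obtain ⟨V, hV, e⟩ := h.exists_isPrim
  exact (hV.coeff_apply hb hb').hasWeakDeriv.congr (e.symm.mono fun x hx => by simp only [hx])
    (e.symm.mono fun x hx => by simp only [hx])

theorem HasWeakDeriv.of_hasDerivAt_smul {f f' : ℝ → ℝ} (h : ∀ x, HasDerivAt f (f' x) x)
    (hf' : Continuous f') (z : Plane 𝕜) : HasWeakDeriv 1 (fun x => f x • z) (fun x => f' x • z) :=
  (IsPrim.of_hasDerivAt (fun x => (h x).smul_const z) (hf'.smul continuous_const)).hasWeakDeriv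

theorem HasWeakDeriv.neg {k : ℕ} {v w : ℝ → Plane 𝕜} (h : HasWeakDeriv k v w) :
    HasWeakDeriv k (fun x => -v x) (fun x => -w x) := by
  simpa using h.smul (-1)

theorem HasWeakDeriv.sub {k : ℕ} {v w v' w' : ℝ → Plane 𝕜} (h : HasWeakDeriv k v w)
    (h' : HasWeakDeriv k v' w') :
    HasWeakDeriv k (fun x => v x - v' x) (fun x => w x - w' x) := by
  simpa [sub_eq_add_neg] using h.add h'.neg

theorem MemL2w.neg {μ : ℝ} {f : ℝ → Plane 𝕜} (hf : MemL2w μ f) : MemL2w μ (fun x => -f x) := by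
  simpa using hf.smul (-1)

theorem MemL2w.sub {μ : ℝ} {f g : ℝ → Plane 𝕜} (hf : MemL2w μ f) (hg : MemL2w μ g) :
    MemL2w μ (fun x => f x - g x) := by
  simpa [sub_eq_add_neg] using hf.add hg.neg

end WeakCalculus

/-! ### The energy estimate in `X_η` -/

section ExtendedEstimates

variable {𝕜 : Type} [RCLike 𝕜]

/-- A `C¹` coefficient `b` with derivative `b'` and limit `binf` at `+∞`; `M` bounds all of them,
and the products of `b - binf` and `b'` with the template function decay at the rate `2 μ̂` at both
ends. At `-∞` that decay is the one of the template function, as `b` need not be close to `binf`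
there. -/
structure IsCoeff (μhat M : ℝ) (b b' : ℝ → Plane 𝕜 →L[ℝ] Plane 𝕜)
    (binf : Plane 𝕜 →L[ℝ] Plane 𝕜) : Prop where
  norm_le : ∀ x, ‖b x‖ ≤ M
  norm_lim_le : ‖binf‖ ≤ M
  hasDerivAt : ∀ x, HasDerivAt b (b' x) x
  continuous_deriv : Continuous b'
  norm_deriv_le : ∀ x, ‖b' x‖ ≤ M
  decay : ∀ x, template μhat x * ‖b x - binf‖ ≤ M * Real.exp (-(2 * μhat * |x|))
  decay_deriv : ∀ x, template μhat x * ‖b' x‖ ≤ M * Real.exp (-(2 * μhat * |x|))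

theorem continuous_coeff {E : Type*} [NormedAddCommGroup E] [NormedSpace ℝ E]
    {b b' : ℝ → E →L[ℝ] E} (h : ∀ x, HasDerivAt b (b' x) x) : Continuous b :=
  continuous_iff_continuousAt.2 fun x => (h x).continuousAt

theorem aesm_coeff_apply {E : Type*} [NormedAddCommGroup E] [NormedSpace ℝ E]
    {b : ℝ → E →L[ℝ] E} (hb : Continuous b) {f : ℝ → E}
    (hf : AEStronglyMeasurable f volume) : AEStronglyMeasurable (fun x => b x (f x)) volume :=
  (ContinuousLinearMap.id ℝ (E →L[ℝ] E)).aestronglyMeasurable_comp₂ hb.aestronglyMeasurable hf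

/-- The inhomogeneity caused by the template function in the equation for `v - ρ v̂`. -/
noncomputable def defect (c μhat : ℝ) (A : Plane 𝕜 →L[ℝ] Plane 𝕜)
    (b : ℝ → Plane 𝕜 →L[ℝ] Plane 𝕜) (binf : Plane 𝕜 →L[ℝ] Plane 𝕜) (ρ : Plane 𝕜) (x : ℝ) :
    Plane 𝕜 :=
  template μhat x • (b x ρ - binf ρ) + templateDeriv₂ μhat x • A ρ
    + (c * templateDeriv μhat x) • ρ

theorem norm_defect_le {c μhat M : ℝ} (hμ : 0 < μhat) {A : Plane 𝕜 →L[ℝ] Plane 𝕜}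
    {b b' : ℝ → Plane 𝕜 →L[ℝ] Plane 𝕜} {binf : Plane 𝕜 →L[ℝ] Plane 𝕜}
    (h : IsCoeff μhat M b b' binf) {NA : ℝ} (hA : ‖A‖ ≤ NA) (ρ : Plane 𝕜) (x : ℝ) :
    ‖defect c μhat A b binf ρ x‖
      ≤ (M + (2 * μhat) ^ 2 * NA + |c| * (2 * μhat)) * ‖ρ‖ * Real.exp (-(2 * μhat * |x|)) := by
  set e := Real.exp (-(2 * μhat * |x|)) with he
  have he0 : 0 < e := Real.exp_pos _
  have hNA : 0 ≤ NA := (norm_nonneg A).trans hA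
  have n1 : ‖template μhat x • (b x ρ - binf ρ)‖ ≤ M * e * ‖ρ‖ := by
    rw [norm_smul, Real.norm_of_nonneg (template_nonneg _ _), ← _root_.sub_apply]
    refine (mul_le_mul_of_nonneg_left ((b x - binf).le_opNorm ρ) (template_nonneg _ _)).trans ?_
    rw [← mul_assoc]
    exact mul_le_mul_of_nonneg_right (h.decay x) (norm_nonneg _)
  have n2 : ‖templateDeriv₂ μhat x • A ρ‖ ≤ (2 * μhat) ^ 2 * e * (NA * ‖ρ‖) := by
    rw [norm_smul, Real.norm_eq_abs]
    exact mul_le_mul (abs_templateDeriv₂_le hμ x) (A.le_of_opNorm_le hA ρ) (norm_nonneg _)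
      (by positivity)
  have n3 : ‖(c * templateDeriv μhat x) • ρ‖ ≤ |c| * (2 * μhat * e) * ‖ρ‖ := by
    rw [norm_smul, Real.norm_eq_abs, abs_mul]
    exact mul_le_mul_of_nonneg_right
      (mul_le_mul_of_nonneg_left (abs_templateDeriv_le hμ x) (abs_nonneg _)) (norm_nonneg _)
  refine (norm_add_le _ _).trans ((add_le_add ((norm_add_le _ _).trans (add_le_add n1 n2)) n3).trans
    (le_of_eq (by ring)))

theorem aesm_defect {c μhat M : ℝ} {A : Plane 𝕜 →L[ℝ] Plane 𝕜}
    {b b' : ℝ → Plane 𝕜 →L[ℝ] Plane 𝕜} {binf : Plane 𝕜 →L[ℝ] Plane 𝕜}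
    (h : IsCoeff μhat M b b' binf) (ρ : Plane 𝕜) :
    AEStronglyMeasurable (defect c μhat A b binf ρ) volume := by
  have h1 : AEStronglyMeasurable (fun x => b x ρ) volume :=
    aesm_coeff_apply (continuous_coeff h.hasDerivAt) aestronglyMeasurable_const
  have h2 := (continuous_template μhat).aestronglyMeasurable (μ := (volume : Measure ℝ))
  have h3 := (continuous_templateDeriv μhat).aestronglyMeasurable (μ := (volume : Measure ℝ))
  have h4 := (continuous_templateDeriv₂ μhat).aestronglyMeasurable (μ := (volume : Measure ℝ))
  exact ((h2.smul (h1.sub aestronglyMeasurable_const)).add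
    (h4.smul aestronglyMeasurable_const)).add ((h3.const_mul c).smul aestronglyMeasurable_const)

/-- The equation `(s - 𝓛)(v, ρ) = r` turns into the equation for `v - ρ v̂` with an additional
inhomogeneity. -/
theorem shifted_equation {c : ℝ} (A b binf : Plane 𝕜 →L[ℝ] Plane 𝕜) (s : 𝕜) (t t₁ t₂ : ℝ)
    (v w₁ w₂ ρ : Plane 𝕜) :
    s • (v - t • ρ) - (A (w₂ - t₂ • ρ) + c • (w₁ - t₁ • ρ) + b (v - t • ρ))
      = (s • v - (A w₂ + c • w₁ + b v) - t • (s • ρ - binf ρ))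
        + (t • (b ρ - binf ρ) + t₂ • A ρ + (c * t₁) • ρ) := by
  simp only [map_sub, map_smul, smul_sub, mul_smul, smul_comm s t ρ]
  abel

theorem memL2w_templateDeriv {μ μhat Cd : ℝ} (hμ : 0 < μhat)
    (hCd : ∀ (f : ℝ → Plane 𝕜) (K : ℝ), AEStronglyMeasurable f volume →
      (∀ x, ‖f x‖ ≤ K * Real.exp (-(2 * μhat * |x|))) → MemL2w μ f ∧ normL2w μ f ^ 2 ≤ Cd * K ^ 2)
    (ρ : Plane 𝕜) :
    (MemL2w μ (fun x => templateDeriv μhat x • ρ) ∧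
      normL2w μ (fun x => templateDeriv μhat x • ρ) ^ 2 ≤ Cd * (2 * μhat * ‖ρ‖) ^ 2) ∧
    (MemL2w μ (fun x => templateDeriv₂ μhat x • ρ) ∧
      normL2w μ (fun x => templateDeriv₂ μhat x • ρ) ^ 2 ≤ Cd * ((2 * μhat) ^ 2 * ‖ρ‖) ^ 2) := by
  constructor
  · refine hCd _ _ ((continuous_templateDeriv μhat).smul continuous_const).aestronglyMeasurable
      fun x => ?_
    rw [norm_smul, Real.norm_eq_abs, mul_right_comm]
    exact mul_le_mul_of_nonneg_right (abs_templateDeriv_le hμ x) (norm_nonneg _)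
  · refine hCd _ _ ((continuous_templateDeriv₂ μhat).smul continuous_const).aestronglyMeasurable
      fun x => ?_
    rw [norm_smul, Real.norm_eq_abs, mul_right_comm]
    exact mul_le_mul_of_nonneg_right (abs_templateDeriv₂_le hμ x) (norm_nonneg _)

/-- The bookkeeping of constants in the estimate for `(v, ρ)`: `U, U₁, U₂` are the squared norms for
`v - ρ v̂`, `W₁, W₂` those of the derivatives of `v`, `G` that of the inhomogeneity and `P, Z, H`
those of `ρ` and of the two components of the right-hand side. -/
theorem combine_estimates {σ U U₁ U₂ W₁ W₂ G P Z H C₀ D₀ D₁ D₂ : ℝ} (hσ : 1 ≤ σ)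
    (hC₀ : 0 < C₀) (hP : 0 ≤ P) (hZ : 0 ≤ Z) (hH : 0 ≤ H) (hD₀ : 0 ≤ D₀) (hD₁ : 0 ≤ D₁)
    (hD₂ : 0 ≤ D₂) (h0 : σ ^ 2 * U + σ * U₁ + U₂ ≤ C₀ * G) (hG : G ≤ 2 * H + 2 * (D₀ * P))
    (hU : 0 ≤ U)
    (h1 : W₁ ≤ 2 * U₁ + 2 * (D₁ * P)) (h2 : W₂ ≤ 2 * U₂ + 2 * (D₂ * P)) (hρ : σ ^ 2 * P ≤ 4 * Z) :
    σ ^ 2 * (P + U) + σ * W₁ + W₂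
      ≤ (4 + 4 * C₀ + 16 * C₀ * D₀ + 8 * D₁ + 8 * D₂) * (Z + H) := by
  have hσ0 : 0 ≤ σ := by linarith
  have hσP : σ * P ≤ 4 * Z := by
    have : σ * P ≤ σ ^ 2 * P := by nlinarith [mul_nonneg hσ0 hP]
    linarith
  have hPZ : P ≤ 4 * Z := by nlinarith
  have a1 := mul_le_mul_of_nonneg_left h1 hσ0
  have a2 := mul_le_mul_of_nonneg_left hG hC₀.le
  have a3 := mul_le_mul_of_nonneg_left hσP hD₁
  have a4 := mul_le_mul_of_nonneg_left hPZ hD₂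
  have a5 := mul_le_mul_of_nonneg_left hPZ (mul_nonneg hC₀.le hD₀)
  have a6 : 0 ≤ σ ^ 2 * U := by positivity
  have b1 : 0 ≤ C₀ * D₀ * H := by positivity
  have b2 : 0 ≤ D₁ * H := by positivity
  have b3 : 0 ≤ D₂ * H := by positivity
  have b4 : 0 ≤ C₀ * Z := by positivity
  linarith

/-- The resolvent estimate in `X_η`, for a pair `(v, ρ)`: the energy estimate applies to
`v - ρ v̂`, whose equation has the additional inhomogeneity `defect`; for `‖s‖ ≥ 2 M` the second
component controls `ρ`, and thereby the defect. -/
theorem extended_estimate (𝕜 : Type) [RCLike 𝕜] {α₁ μhat μ₂ : ℝ} (α₂ c M : ℝ) (hα : 0 < α₁)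
    (hμhat : 0 < μhat) (hμ₂' : μ₂ < 2 * μhat) :
    ∃ κ > 0, ∃ R ≥ 1, ∃ C > 0, ∀ (b b' : ℝ → Plane 𝕜 →L[ℝ] Plane 𝕜) (binf : Plane 𝕜 →L[ℝ] Plane 𝕜),
      IsCoeff μhat M b b' binf → ∀ μ, 0 ≤ μ → μ ≤ μ₂ → ∀ s : 𝕜, R ≤ ‖s‖ →
      -(κ * ‖s‖) ≤ RCLike.re s → ∀ (p r : SpaceX 𝕜 μ μhat) (w₁ w₂ : ℝ → Plane 𝕜),
        HasWeakDeriv 1 p.fn w₁ → HasWeakDeriv 1 w₁ w₂ → MemL2w μ w₁ → MemL2w μ w₂ →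
        (∀ᵐ x, r.fn x = s • p.fn x
          - (actL 𝕜 (mulMat α₁ α₂) (w₂ x) + c • w₁ x + b x (p.fn x))) →
        r.lim = s • p.lim - binf p.lim →
        ‖s‖ ^ 2 * ‖p‖ ^ 2 + ‖s‖ * normL2w μ w₁ ^ 2 + normL2w μ w₂ ^ 2 ≤ C * ‖r‖ ^ 2 := by
  obtain ⟨κ, hκ, R₀, hR₀, C₀, hC₀, core⟩ := resolvent_estimate 𝕜 (M := M) (μ₂ := μ₂) c hα
    (abs_nonneg α₂)
  obtain ⟨Cd, hCd, decay⟩ := memL2w_of_exp_decay (𝕜 := 𝕜) hμ₂'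
  set A := actL 𝕜 (mulMat α₁ α₂) with hA
  set K₁ := M + (2 * μhat) ^ 2 * (α₁ + |α₂|) + |c| * (2 * μhat) with hK₁
  refine ⟨κ, hκ, max R₀ (2 * M), hR₀.trans (le_max_left _ _),
    4 + 4 * C₀ + 16 * C₀ * (Cd * K₁ ^ 2) + 8 * (Cd * (2 * μhat) ^ 2)
      + 8 * (Cd * ((2 * μhat) ^ 2) ^ 2), by positivity, ?_⟩
  intro b b' binf hb μ hμ hμ₂ s hR hs p r w₁ w₂ hw1 hw2 m1 m2 heq hlim
  have decay' := decay μ hμ hμ₂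
  have hs1 : 1 ≤ ‖s‖ := hR₀.trans ((le_max_left _ _).trans hR)
  have hsM : 2 * M ≤ ‖s‖ := (le_max_right _ _).trans hR
  obtain ⟨⟨mt1, nt1⟩, ⟨mt2, nt2⟩⟩ := memL2w_templateDeriv hμhat decay' p.lim
  obtain ⟨md, nd⟩ := decay' (defect c μhat A b binf p.lim) _ (aesm_defect hb p.lim)
    (norm_defect_le hμhat hb (norm_actL_mulMat_le hα α₂) p.lim)
  have hu1 : HasWeakDeriv 1 (fun x => p.fn x - template μhat x • p.lim)
      (fun x => w₁ x - templateDeriv μhat x • p.lim) :=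
    hw1.sub (HasWeakDeriv.of_hasDerivAt_smul (hasDerivAt_template μhat)
      (continuous_templateDeriv μhat) p.lim)
  have hu2 : HasWeakDeriv 1 (fun x => w₁ x - templateDeriv μhat x • p.lim)
      (fun x => w₂ x - templateDeriv₂ μhat x • p.lim) :=
    hw2.sub (HasWeakDeriv.of_hasDerivAt_smul (hasDerivAt_templateDeriv μhat)
      (continuous_templateDeriv₂ μhat) p.lim)
  have hρ : ‖s‖ * ‖p.lim‖ ≤ 2 * ‖r.lim‖ := by
    have e : s • p.lim = r.lim + binf p.lim := by rw [hlim]; abel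
    have h1 : ‖s‖ * ‖p.lim‖ ≤ ‖r.lim‖ + M * ‖p.lim‖ := by
      rw [← norm_smul, e]
      exact (norm_add_le _ _).trans (add_le_add le_rfl (binf.le_of_opNorm_le hb.norm_lim_le _))
    nlinarith [norm_nonneg p.lim]
  have est := core A (fun z => (re_inner_mulMat α₁ α₂ z).ge) (abs_im_inner_mulMat_le α₁ α₂)
    (norm_actL_mulMat_le hα α₂) b hb.norm_le μ hμ hμ₂ s ((le_max_left _ _).trans hR) hs _ _ _
    (fun x => (r.fn x - template μhat x • r.lim) + defect c μhat A b binf p.lim x)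
    hu1 hu2 p.mem (m1.sub mt1) (m2.sub mt2) (r.mem.add md) (by
      filter_upwards [heq] with x hx
      rw [shifted_equation A (b x) binf s, hx, hlim]
      rfl)
  have hG := r.mem.normL2w_add_sq_le md
  have hW1 := (m1.sub mt1).normL2w_add_sq_le mt1
  have hW2 := (m2.sub mt2).normL2w_add_sq_le mt2
  simp only [sub_add_cancel] at hW1 hW2
  rw [SpaceX.norm_sq, SpaceX.norm_sq]
  refine combine_estimates (D₀ := Cd * K₁ ^ 2) (D₁ := Cd * (2 * μhat) ^ 2)
    (D₂ := Cd * ((2 * μhat) ^ 2) ^ 2) hs1 hC₀ (sq_nonneg _) (sq_nonneg _) (sq_nonneg _)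
    (by positivity) (by positivity) (by positivity) est ?_ (sq_nonneg _) ?_ ?_ ?_
  · refine hG.trans ?_
    have e : Cd * (K₁ * ‖p.lim‖) ^ 2 = Cd * K₁ ^ 2 * ‖p.lim‖ ^ 2 := by ring
    linarith
  · refine hW1.trans ?_
    have e : Cd * (2 * μhat * ‖p.lim‖) ^ 2 = Cd * (2 * μhat) ^ 2 * ‖p.lim‖ ^ 2 := by ring
    linarith
  · refine hW2.trans ?_
    have e : Cd * ((2 * μhat) ^ 2 * ‖p.lim‖) ^ 2 = Cd * ((2 * μhat) ^ 2) ^ 2 * ‖p.lim‖ ^ 2 := by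
      ring
    linarith
  · have := pow_le_pow_left₀ (by positivity) hρ 2
    linarith [mul_pow ‖s‖ ‖p.lim‖ 2, mul_pow 2 ‖r.lim‖ 2]

/-- The resolvent estimate for one more derivative: the derivative of `v` solves the same equation
with the additional inhomogeneity `b' v`. -/
theorem extended_estimate_deriv (𝕜 : Type) [RCLike 𝕜] {α₁ μhat μ₂ : ℝ} (α₂ c : ℝ) {M : ℝ}
    (hα : 0 < α₁) (hμ₂' : μ₂ < 2 * μhat) :
    ∃ κ > 0, ∃ R ≥ 1, ∃ C > 0, ∀ (b b' : ℝ → Plane 𝕜 →L[ℝ] Plane 𝕜) (binf : Plane 𝕜 →L[ℝ] Plane 𝕜),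
      IsCoeff μhat M b b' binf → ∀ μ, 0 ≤ μ → μ ≤ μ₂ → ∀ s : 𝕜, R ≤ ‖s‖ →
      -(κ * ‖s‖) ≤ RCLike.re s →
      ∀ (p r : SpaceX 𝕜 μ μhat) (w₁ w₂ w₃ r₁ : ℝ → Plane 𝕜),
        HasWeakDeriv 1 p.fn w₁ → HasWeakDeriv 1 w₁ w₂ → HasWeakDeriv 1 w₂ w₃ →
        HasWeakDeriv 1 r.fn r₁ → MemL2w μ w₁ → MemL2w μ w₂ → MemL2w μ w₃ → MemL2w μ r₁ →
        (∀ᵐ x, r.fn x = s • p.fn x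
          - (actL 𝕜 (mulMat α₁ α₂) (w₂ x) + c • w₁ x + b x (p.fn x))) →
        ‖s‖ ^ 2 * normL2w μ w₁ ^ 2 + ‖s‖ * normL2w μ w₂ ^ 2 + normL2w μ w₃ ^ 2
          ≤ C * (normL2w μ r₁ ^ 2 + ‖p‖ ^ 2) := by
  obtain ⟨κ, hκ, R₀, hR₀, C₀, hC₀, core⟩ := resolvent_estimate 𝕜 (M := M) (μ₂ := μ₂) c hα
    (abs_nonneg α₂)
  obtain ⟨Cd, hCd, decay⟩ := memL2w_of_exp_decay (𝕜 := 𝕜) hμ₂'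
  set A := actL 𝕜 (mulMat α₁ α₂) with hA
  refine ⟨κ, hκ, R₀, hR₀, C₀ * (2 + 4 * M ^ 2 + 4 * (Cd * M ^ 2)), by positivity, ?_⟩
  intro b b' binf hb μ hμ hμ₂ s hR hs p r w₁ w₂ w₃ r₁ hw1 hw2 hw3 hr1 m1 m2 m3 mr heq
  have hr1' : HasWeakDeriv 1 r.fn (fun x => s • w₁ x
      - (A (w₃ x) + c • w₂ x + (b x (w₁ x) + b' x (p.fn x)))) := by
    have h1 := (hw1.smul s).sub (((hw3.clm A).add (hw2.smul (c : 𝕜))).add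
      (hw1.coeff_apply hb.hasDerivAt hb.continuous_deriv))
    refine h1.congr ?_ ?_
    · filter_upwards [heq] with x hx
      rw [hx, RCLike.real_smul_eq_coe_smul (K := 𝕜) c]
    · refine .of_forall fun x => ?_
      simp only [RCLike.real_smul_eq_coe_smul (K := 𝕜) c]
  have hr1e := hr1.unique hr1'
  -- the additional inhomogeneity
  have mb1 : AEStronglyMeasurable (fun x => b' x (p.fn x - template μhat x • p.lim)) volume :=
    aesm_coeff_apply hb.continuous_deriv p.mem.aesm
  have mb2 : AEStronglyMeasurable (fun x => b' x (template μhat x • p.lim)) volume :=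
    aesm_coeff_apply hb.continuous_deriv
      ((continuous_template μhat).smul continuous_const).aestronglyMeasurable
  obtain ⟨k1, n1⟩ := p.mem.mono (K := M) hμ mb1 (.of_forall fun x =>
    (b' x).le_of_opNorm_le (hb.norm_deriv_le x) _)
  obtain ⟨k2, n2⟩ := decay μ hμ hμ₂ _ (M * ‖p.lim‖) mb2 (fun x => by
    rw [map_smul, norm_smul, Real.norm_of_nonneg (template_nonneg _ _)]
    refine (mul_le_mul_of_nonneg_left ((b' x).le_opNorm _) (template_nonneg _ _)).trans ?_
    rw [← mul_assoc, mul_right_comm M]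
    exact mul_le_mul_of_nonneg_right (hb.decay_deriv x) (norm_nonneg _))
  have k3 := k1.add k2
  have n3 := k1.normL2w_add_sq_le k2
  have n4 := mr.normL2w_add_sq_le k3
  have est := core A (fun z => (re_inner_mulMat α₁ α₂ z).ge) (abs_im_inner_mulMat_le α₁ α₂)
    (norm_actL_mulMat_le hα α₂) b hb.norm_le μ hμ hμ₂ s hR hs w₁ w₂ w₃ _
    hw2 hw3 m1 m2 m3 (mr.add k3) (by
      filter_upwards [hr1e] with x hx
      rw [hx, ← map_add, sub_add_cancel]
      abel)
  refine est.trans ?_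
  rw [mul_assoc]
  refine mul_le_mul_of_nonneg_left ?_ hC₀.le
  rw [SpaceX.norm_sq]
  have a1 : 0 ≤ (normL2w μ r₁) ^ 2 := sq_nonneg _
  have a2 : 0 ≤ M ^ 2 * (normL2w μ r₁) ^ 2 := by positivity
  have a3 : 0 ≤ Cd * M ^ 2 * (normL2w μ r₁) ^ 2 := by positivity
  have a4 : 0 ≤ ‖p.lim‖ ^ 2 := sq_nonneg _
  have a5 : 0 ≤ M ^ 2 * ‖p.lim‖ ^ 2 := by positivity
  have a6 : 0 ≤ normL2w μ (fun x => p.fn x - template μhat x • p.lim) ^ 2 := sq_nonneg _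
  have a7 : 0 ≤ Cd * M ^ 2 * normL2w μ (fun x => p.fn x - template μhat x • p.lim) ^ 2 := by
    positivity
  have e : Cd * (M * ‖p.lim‖) ^ 2 = Cd * M ^ 2 * ‖p.lim‖ ^ 2 := by ring
  linarith

end ExtendedEstimates

/-! ### The differential expression maps `X²_η` into `X_η` -/

section SpaceX

variable {𝕜 : Type} [RCLike 𝕜] {μ μhat : ℝ}

/-- The element `(f, ρ)` of `X_η`, for a function `f`. -/
noncomputable def SpaceX.ofFun (f : ℝ → Plane 𝕜) (hf : AEStronglyMeasurable f volume) (ρ : Plane 𝕜)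
    (h : MemL2w μ fun x => f x - template μhat x • ρ) : SpaceX 𝕜 μ μhat :=
  Subtype.mk (p := fun q => q ∈ spaceXSub 𝕜 μ μhat) (AEEqFun.mk f hf, ρ)
    (h.congr ((AEEqFun.coeFn_mk f hf).symm.mono fun x hx => by simp only [hx]))

theorem SpaceX.fn_ofFun (f : ℝ → Plane 𝕜) (hf : AEStronglyMeasurable f volume) (ρ : Plane 𝕜)
    (h : MemL2w μ fun x => f x - template μhat x • ρ) :
    (SpaceX.ofFun f hf ρ h).fn =ᵐ[volume] f := AEEqFun.coeFn_mk f hf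

theorem SpaceX.lim_ofFun (f : ℝ → Plane 𝕜) (hf : AEStronglyMeasurable f volume) (ρ : Plane 𝕜)
    (h : MemL2w μ fun x => f x - template μhat x • ρ) :
    (SpaceX.ofFun f hf ρ h).lim = ρ := rfl

theorem SpaceX.coe_fn_sub (p q : SpaceX 𝕜 μ μhat) :
    (p - q).fn =ᵐ[volume] fun x => p.fn x - q.fn x := AEEqFun.coeFn_sub p.fn q.fn

theorem SpaceX.lim_sub (p q : SpaceX 𝕜 μ μhat) : (p - q).lim = p.lim - q.lim := rfl

theorem SpaceX.norm_sub_sq (p q : SpaceX 𝕜 μ μhat) :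
    ‖p - q‖ ^ 2 = ‖p.lim - q.lim‖ ^ 2 + normL2w μ (fun x => (p.fn x - template μhat x • p.lim)
      - (q.fn x - template μhat x • q.lim)) ^ 2 := by
  rw [SpaceX.norm_sq, SpaceX.lim_sub]
  congr 2
  refine normL2w_congr ?_
  filter_upwards [SpaceX.coe_fn_sub p q] with x hx
  rw [hx, smul_sub]
  abel

/-- The image of `(v, ρ)` under the linearized operator exists in `X_η` and is controlled by the
norm of `(v, ρ)` in `X²_η`. -/
theorem exists_image {μ₂ M : ℝ} (c : ℝ) (hμ₂' : μ₂ < 2 * μhat) (hμ : 0 ≤ μ)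
    (hμ₂ : μ ≤ μ₂) (A : Plane 𝕜 →L[ℝ] Plane 𝕜) {b b' : ℝ → Plane 𝕜 →L[ℝ] Plane 𝕜}
    {binf : Plane 𝕜 →L[ℝ] Plane 𝕜} (hb : IsCoeff μhat M b b' binf) :
    ∃ C > 0, ∀ (p : SpaceX 𝕜 μ μhat) (w₁ w₂ : ℝ → Plane 𝕜), MemL2w μ w₁ → MemL2w μ w₂ →
      ∃ q : SpaceX 𝕜 μ μhat, (q.fn =ᵐ[volume] fun x => A (w₂ x) + c • w₁ x + b x (p.fn x)) ∧
        q.lim = binf p.lim ∧ ‖q‖ ^ 2 ≤ C * (‖p‖ ^ 2 + normL2w μ w₁ ^ 2 + normL2w μ w₂ ^ 2) := by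
  obtain ⟨Cd, hCd, decay⟩ := memL2w_of_exp_decay (𝕜 := 𝕜) hμ₂'
  refine ⟨9 * (‖A‖ ^ 2 + c ^ 2 + M ^ 2 + Cd * M ^ 2 + 1), by positivity,
    fun p w₁ w₂ m1 m2 => ?_⟩
  have cb := continuous_coeff hb.hasDerivAt
  have mb : AEStronglyMeasurable (fun x => b x (p.fn x)) volume :=
    aesm_coeff_apply cb p.fn.aestronglyMeasurable
  obtain ⟨k1, n1⟩ := m2.mono (f := fun x => A (w₂ x)) (K := ‖A‖) hμ
    (A.continuous.comp_aestronglyMeasurable m2.aesm) (.of_forall fun x => A.le_opNorm _)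
  obtain ⟨k2, n2⟩ := m1.mono (f := fun x => c • w₁ x) (K := |c|) hμ
    (m1.aesm.const_smul c) (.of_forall fun x => by rw [norm_smul, Real.norm_eq_abs])
  obtain ⟨k3, n3⟩ := p.mem.mono (f := fun x => b x (p.fn x - template μhat x • p.lim)) (K := M) hμ
    (aesm_coeff_apply cb p.mem.aesm) (.of_forall fun x => (b x).le_of_opNorm_le (hb.norm_le x) _)
  have mt := (continuous_template μhat).aestronglyMeasurable (μ := (volume : Measure ℝ))
  have ml : AEStronglyMeasurable (fun x => b x p.lim) volume :=
    aesm_coeff_apply cb aestronglyMeasurable_const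
  obtain ⟨k4, n4⟩ := decay μ hμ hμ₂ (fun x => template μhat x • (b x p.lim - binf p.lim))
    (M * ‖p.lim‖) (mt.smul (ml.sub aestronglyMeasurable_const)) (fun x => by
      rw [norm_smul, Real.norm_of_nonneg (template_nonneg _ _), ← _root_.sub_apply]
      refine (mul_le_mul_of_nonneg_left ((b x - binf).le_opNorm _) (template_nonneg _ _)).trans ?_
      rw [← mul_assoc, mul_right_comm M]
      exact mul_le_mul_of_nonneg_right (hb.decay x) (norm_nonneg _))
  have k := (k1.add k2).add (k3.add k4)
  have e : ∀ x, (A (w₂ x) + c • w₁ x) + (b x (p.fn x - template μhat x • p.lim)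
      + template μhat x • (b x p.lim - binf p.lim))
      = (A (w₂ x) + c • w₁ x + b x (p.fn x)) - template μhat x • binf p.lim := by
    intro x
    rw [map_sub, map_smul, smul_sub]
    abel
  have hm : MemL2w μ fun x => (A (w₂ x) + c • w₁ x + b x (p.fn x))
      - template μhat x • binf p.lim := k.congr (.of_forall e)
  have ms : AEStronglyMeasurable (fun x => A (w₂ x) + c • w₁ x + b x (p.fn x)) volume :=
    (k1.aesm.add k2.aesm).add mb
  have hq := SpaceX.fn_ofFun _ ms (binf p.lim) hm
  refine ⟨SpaceX.ofFun _ ms (binf p.lim) hm, hq, rfl, ?_⟩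
  have nq : normL2w μ (fun x => (SpaceX.ofFun _ ms (binf p.lim) hm).fn x
      - template μhat x • binf p.lim) = normL2w μ (fun x => (A (w₂ x) + c • w₁ x)
        + (b x (p.fn x - template μhat x • p.lim)
        + template μhat x • (b x p.lim - binf p.lim))) := by
    refine normL2w_congr ?_
    filter_upwards [hq] with x hx
    rw [hx, e]
  have s1 := (k1.add k2).normL2w_add_sq_le (k3.add k4)
  have s2 := k1.normL2w_add_sq_le k2
  have s3 := k3.normL2w_add_sq_le k4
  rw [SpaceX.norm_sq, SpaceX.lim_ofFun, nq, SpaceX.norm_sq]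
  have hl : ‖binf p.lim‖ ^ 2 ≤ M ^ 2 * ‖p.lim‖ ^ 2 := by
    have := pow_le_pow_left₀ (norm_nonneg _) (binf.le_of_opNorm_le hb.norm_lim_le p.lim) 2
    rwa [mul_pow] at this
  rw [sq_abs] at n2
  rw [mul_pow] at n4
  set P := ‖p.lim‖ ^ 2
  set U := normL2w μ (fun x => p.fn x - template μhat x • p.lim) ^ 2
  set W₁ := normL2w μ w₁ ^ 2
  set W₂ := normL2w μ w₂ ^ 2
  have hP : 0 ≤ P := sq_nonneg _
  have hU : 0 ≤ U := sq_nonneg _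
  have hW₁ : 0 ≤ W₁ := sq_nonneg _
  have hW₂ : 0 ≤ W₂ := sq_nonneg _
  have hA := sq_nonneg ‖A‖
  have hc := sq_nonneg c
  have hM := sq_nonneg M
  have hCM : 0 ≤ Cd * M ^ 2 := by positivity
  have total : ‖binf p.lim‖ ^ 2 + normL2w μ (fun x => (A (w₂ x) + c • w₁ x)
        + (b x (p.fn x - template μhat x • p.lim)
        + template μhat x • (b x p.lim - binf p.lim))) ^ 2
      ≤ M ^ 2 * P + 4 * (‖A‖ ^ 2 * W₂) + 4 * (c ^ 2 * W₁) + 4 * (M ^ 2 * U)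
        + 4 * (Cd * M ^ 2 * P) := by
    linarith
  refine total.trans ?_
  set S := P + U + W₁ + W₂
  have hS : 0 ≤ S := by positivity
  have t1 := mul_le_mul_of_nonneg_left (show P ≤ S by simp only [S]; linarith) hM
  have t2 := mul_le_mul_of_nonneg_left (show W₂ ≤ S by simp only [S]; linarith) hA
  have t3 := mul_le_mul_of_nonneg_left (show W₁ ≤ S by simp only [S]; linarith) hc
  have t4 := mul_le_mul_of_nonneg_left (show U ≤ S by simp only [S]; linarith) hM
  have t5 := mul_le_mul_of_nonneg_left (show P ≤ S by simp only [S]; linarith) hCM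
  have t6 := mul_nonneg hA hS
  have t7 := mul_nonneg hc hS
  have t8 := mul_nonneg hM hS
  have t9 := mul_nonneg hCM hS
  linarith

end SpaceX

/-! ### The graph and the domain of the linearized operator -/

section Graph

variable {𝕜 : Type} [RCLike 𝕜] {α₁ α₂ : ℝ} {g₁ g₂ : ℝ → ℝ} {vstar : ℝ → Plane ℝ} {c freq : ℝ}
  {vinf : Plane ℝ} {μ μhat : ℝ}

/-- The coefficient `S_ω + Df(u)` of the linearized operator. -/
noncomputable def zeroOrder (𝕜 : Type) [RCLike 𝕜] (g₁ g₂ : ℝ → ℝ) (freq : ℝ) (u : Plane ℝ) :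
    Plane 𝕜 →L[ℝ] Plane 𝕜 :=
  actL 𝕜 (rotGen freq + jac g₁ g₂ u)

theorem zeroOrder_apply (u : Plane ℝ) (z : Plane 𝕜) : zeroOrder 𝕜 g₁ g₂ freq u z
    = act 𝕜 (rotGen freq) z + act 𝕜 (jac g₁ g₂ u) z := by
  rw [zeroOrder, map_add]
  rfl

/-- The graph of the linearized operator, with iterated first order weak derivatives. -/
theorem mem_linGraph_iff {p q : SpaceX 𝕜 μ μhat} :
    (p, q) ∈ linGraph 𝕜 α₁ α₂ g₁ g₂ vstar c freq vinf μ μhat ↔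
      ∃ w₁ w₂ : Fn 𝕜, HasWeakDeriv 1 p.fn w₁ ∧ HasWeakDeriv 1 w₁ w₂ ∧ MemL2w μ w₁ ∧ MemL2w μ w₂ ∧
        (q.fn =ᵐ[volume] fun x => actL 𝕜 (mulMat α₁ α₂) (w₂ x) + c • w₁ x
          + zeroOrder 𝕜 g₁ g₂ freq (vstar x) (p.fn x)) ∧
        q.lim = zeroOrder 𝕜 g₁ g₂ freq vinf p.lim := by
  have key : ∀ w₁ w₂ : Fn 𝕜, (fun x => actL 𝕜 (mulMat α₁ α₂) (w₂ x) + c • w₁ x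
      + zeroOrder 𝕜 g₁ g₂ freq (vstar x) (p.fn x)) = fun x => act 𝕜 (mulMat α₁ α₂) (w₂ x)
      + (c : 𝕜) • w₁ x + act 𝕜 (rotGen freq) (p.fn x) + act 𝕜 (jac g₁ g₂ (vstar x)) (p.fn x) := by
    intro w₁ w₂
    funext x
    rw [zeroOrder_apply, actL_apply, RCLike.real_smul_eq_coe_smul (K := 𝕜) c, add_assoc,
      add_assoc, add_assoc]
  constructor
  · rintro ⟨w₁, w₂, ⟨a1, a2⟩, ⟨b1, b2⟩, e, l⟩
    refine ⟨w₁, w₂, a1, a1.of_succ b1, a2, b2, ?_, ?_⟩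
    · rw [key]; exact e
    · rw [zeroOrder_apply]; exact l
  · rintro ⟨w₁, w₂, a1, b1, a2, b2, e, l⟩
    refine ⟨w₁, w₂, ⟨a1, a2⟩, ⟨a1.succ b1, b2⟩, ?_, ?_⟩
    · rw [key] at e; exact e
    · rw [zeroOrder_apply] at l; exact l

theorem mem_sobX_two_iff {p : SpaceX 𝕜 μ μhat} : p ∈ sobX 𝕜 μ μhat 2 ↔
    ∃ w₁ w₂ : Fn 𝕜, HasWeakDeriv 1 p.fn w₁ ∧ HasWeakDeriv 1 w₁ w₂ ∧ MemL2w μ w₁ ∧ MemL2w μ w₂ := by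
  constructor
  · intro h
    obtain ⟨w₁, a1, a2⟩ := h 1 le_rfl one_le_two
    obtain ⟨w₂, b1, b2⟩ := h 2 one_le_two le_rfl
    exact ⟨w₁, w₂, a1, a1.of_succ b1, a2, b2⟩
  · rintro ⟨w₁, w₂, a1, b1, a2, b2⟩ k hk1 hk2
    interval_cases k
    · exact ⟨w₁, a1, a2⟩
    · exact ⟨w₂, a1.succ b1, b2⟩

/-- The condition `𝓛 p ∈ X_η` in the graph is automatic for `p ∈ X²_η`. -/
theorem linOp_domain {M μ₂ : ℝ} (hμ₂' : μ₂ < 2 * μhat) (hμ : 0 ≤ μ) (hμ₂ : μ ≤ μ₂)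
    {b' : ℝ → Plane 𝕜 →L[ℝ] Plane 𝕜}
    (hb : IsCoeff μhat M (fun x => zeroOrder 𝕜 g₁ g₂ freq (vstar x)) b'
      (zeroOrder 𝕜 g₁ g₂ freq vinf)) :
    (linOp 𝕜 α₁ α₂ g₁ g₂ vstar c freq vinf μ μhat).domain = sobX 𝕜 μ μhat 2 := by
  ext p
  rw [LinearPMap.mem_domain_iff, linOp_graph, mem_sobX_two_iff]
  constructor
  · rintro ⟨q, hq⟩
    obtain ⟨w₁, w₂, a1, b1, a2, b2, -⟩ := mem_linGraph_iff.1 hq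
    exact ⟨w₁, w₂, a1, b1, a2, b2⟩
  · rintro ⟨w₁, w₂, a1, b1, a2, b2⟩
    obtain ⟨C, -, hC⟩ := exists_image c hμ₂' hμ hμ₂ (actL 𝕜 (mulMat α₁ α₂)) hb
    obtain ⟨q, e, l, -⟩ := hC p w₁ w₂ a2 b2
    exact ⟨q, mem_linGraph_iff.2 ⟨w₁, w₂, a1, b1, a2, b2, e, l⟩⟩

end Graph

/-! ### Density of the domain -/

section Density

variable {𝕜 : Type} [RCLike 𝕜] {μ μhat : ℝ}

theorem contDiff_weight_inv (μ : ℝ) : ContDiff ℝ ∞ fun x => (weight μ x)⁻¹ := by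
  have e : (fun x => (weight μ x)⁻¹) = fun x => Real.exp (-(μ * Real.sqrt (x ^ 2 + 1))) :=
    funext fun x => by rw [weight, Real.exp_neg]
  rw [e]
  have h1 : ContDiff ℝ ∞ fun x : ℝ => x ^ 2 + 1 := by fun_prop
  have h2 : ContDiff ℝ ∞ fun x : ℝ => Real.sqrt (x ^ 2 + 1) := h1.sqrt fun x => by positivity
  exact (contDiff_const.mul h2).neg.exp

theorem memL2w_of_hasCompactSupport {f : ℝ → Plane 𝕜} (hf : Continuous f)
    (hc : HasCompactSupport f) : MemL2w μ f :=
  ⟨hf.memLp_of_hasCompactSupport hc,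
    ((continuous_weight μ).smul hf).memLp_of_hasCompactSupport hc.smul_left⟩

/-- Smooth functions with compact support are dense in the space of all `f` with `η f ∈ L²`. -/
theorem exists_contDiff_eLpNorm_weight_le {E : Type*} [NormedAddCommGroup E] [NormedSpace ℝ E]
    {f : ℝ → E} (hf : MemLp (fun x => weight μ x • f x) 2 volume) {ε : ℝ} (hε : 0 < ε) :
    ∃ h : ℝ → E, HasCompactSupport h ∧ ContDiff ℝ ∞ h ∧
      eLpNorm (fun x => weight μ x • (f x - h x)) 2 volume ≤ ENNReal.ofReal ε := by
  obtain ⟨g, hgc, hgs, hg⟩ := hf.exist_eLpNorm_sub_le ENNReal.ofNat_ne_top (by norm_num) hε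
  have hgs' : ContDiff ℝ ∞ g := hgs
  refine ⟨fun x => (weight μ x)⁻¹ • g x, hgc.smul_left, (contDiff_weight_inv μ).smul hgs', ?_⟩
  refine le_of_eq_of_le (congrArg (fun u => eLpNorm u 2 volume) ?_) hg
  funext x
  rw [smul_sub, smul_inv_smul₀ (weight_pos μ x).ne', Pi.sub_apply]

/-- Adding `ρ v̂` to test functions yields a dense subset of `X_η` contained in `X²_η`. -/
theorem dense_sobX {μ₂ : ℝ} (hμhat : 0 < μhat) (hμ₂' : μ₂ < 2 * μhat) (hμ : 0 ≤ μ)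
    (hμ₂ : μ ≤ μ₂) : Dense (sobX 𝕜 μ μhat 2 : Set (SpaceX 𝕜 μ μhat)) := by
  obtain ⟨Cd, hCd, decay⟩ := memL2w_of_exp_decay (𝕜 := 𝕜) hμ₂'
  refine Metric.dense_iff.2 fun p ε hε => ?_
  obtain ⟨h, hc, hs, hle'⟩ := exists_contDiff_eLpNorm_weight_le p.mem.2 (half_pos hε)
  have hle : normL2w μ (fun x => (p.fn x - template μhat x • p.lim) - h x) ≤ ε / 2 :=
    ENNReal.toReal_le_of_le_ofReal (half_pos hε).le hle'
  obtain ⟨⟨mt1, -⟩, ⟨mt2, -⟩⟩ := memL2w_templateDeriv hμhat (decay μ hμ hμ₂) p.lim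
  have hd1 : ContDiff ℝ ∞ (deriv h) := (contDiff_infty_iff_deriv.1 hs).2
  have hd2 : ContDiff ℝ ∞ (deriv (deriv h)) := (contDiff_infty_iff_deriv.1 hd1).2
  have d1 : HasWeakDeriv 1 h (deriv h) := (IsPrim.of_hasDerivAt
    (fun x => ((contDiff_infty_iff_deriv.1 hs).1 x).hasDerivAt) hd1.continuous).hasWeakDeriv
  have d2 : HasWeakDeriv 1 (deriv h) (deriv (deriv h)) := (IsPrim.of_hasDerivAt
    (fun x => ((contDiff_infty_iff_deriv.1 hd1).1 x).hasDerivAt) hd2.continuous).hasWeakDeriv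
  have t1 := HasWeakDeriv.of_hasDerivAt_smul (hasDerivAt_template μhat)
    (continuous_templateDeriv μhat) p.lim
  have t2 := HasWeakDeriv.of_hasDerivAt_smul (hasDerivAt_templateDeriv μhat)
    (continuous_templateDeriv₂ μhat) p.lim
  have ct : Continuous fun x => template μhat x • p.lim :=
    (continuous_template μhat).smul continuous_const
  have mh : MemL2w μ h := memL2w_of_hasCompactSupport hs.continuous hc
  have mq : MemL2w μ fun x => (h x + template μhat x • p.lim) - template μhat x • p.lim :=
    mh.congr (.of_forall fun x => by simp)
  have mm : AEStronglyMeasurable (fun x => h x + template μhat x • p.lim) volume :=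
    (hs.continuous.add ct).aestronglyMeasurable
  set q := SpaceX.ofFun _ mm p.lim mq with hq
  have hqf : q.fn =ᵐ[volume] fun x => h x + template μhat x • p.lim := SpaceX.fn_ofFun _ mm p.lim mq
  have k1 := (memL2w_of_hasCompactSupport (μ := μ) hd1.continuous hc.deriv).add mt1
  have k2 := (memL2w_of_hasCompactSupport (μ := μ) hd2.continuous hc.deriv.deriv).add mt2
  refine ⟨q, ?_, mem_sobX_two_iff.2 ⟨AEEqFun.mk _ k1.aesm, AEEqFun.mk _ k2.aesm, ?_, ?_, ?_, ?_⟩⟩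
  · rw [Metric.mem_ball, dist_comm, dist_eq_norm]
    have e : ‖p - q‖ ^ 2 ≤ (ε / 2) ^ 2 := by
      rw [SpaceX.norm_sub_sq, hq, SpaceX.lim_ofFun, sub_self, norm_zero, ← hq]
      have e1 : normL2w μ (fun x => (p.fn x - template μhat x • p.lim)
          - (q.fn x - template μhat x • p.lim))
          = normL2w μ (fun x => (p.fn x - template μhat x • p.lim) - h x) := by
        refine normL2w_congr ?_
        filter_upwards [hqf] with x hx
        rw [hx, add_sub_cancel_right]
      rw [e1, zero_pow two_ne_zero, zero_add]
      exact pow_le_pow_left₀ (normL2w_nonneg _ _) hle 2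
    have := (pow_le_pow_iff_left₀ (norm_nonneg _) (half_pos hε).le two_ne_zero).1 e
    linarith
  · exact (d1.add t1).congr hqf.symm (AEEqFun.coeFn_mk _ _).symm
  · exact (d2.add t2).congr (AEEqFun.coeFn_mk _ _).symm (AEEqFun.coeFn_mk _ _).symm
  · exact k1.congr (AEEqFun.coeFn_mk _ _).symm
  · exact k2.congr (AEEqFun.coeFn_mk _ _).symm

end Density

/-! ### Convergence in `L²_η` -/

section Closedness

variable {𝕜 : Type} [RCLike 𝕜] {μ μhat : ℝ}

/-- Completeness of `L²_η`, for sequences of functions. -/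
theorem exists_limit_of_cauchy (hμ : 0 ≤ μ) {f : ℕ → ℝ → Plane 𝕜} (hf : ∀ n, MemL2w μ (f n))
    (hC : ∀ ε > 0, ∃ N, ∀ m ≥ N, ∀ n ≥ N, normL2w μ (fun x => f m x - f n x) < ε) :
    ∃ F : Fn 𝕜, MemL2w μ F ∧
      Tendsto (fun n => normL2w μ (fun x => f n x - F x)) atTop (𝓝 0) := by
  have hcs : CauchySeq fun n => (hf n).2.toLp := by
    refine Metric.cauchySeq_iff.2 fun ε hε => ?_
    obtain ⟨N, hN⟩ := hC ε hε
    refine ⟨N, fun m hm n hn => ?_⟩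
    rw [dist_eq_norm, ← MemLp.toLp_sub, Lp.norm_toLp]
    refine lt_of_eq_of_lt ?_ (hN m hm n hn)
    rw [normL2w]
    congr 2
    funext x
    simp [smul_sub]
  obtain ⟨G, hG⟩ := cauchySeq_tendsto_of_complete hcs
  have mG : AEStronglyMeasurable (fun x => (weight μ x)⁻¹ • G x) volume :=
    ((continuous_weight μ).inv₀ fun x => (weight_pos μ x).ne').aestronglyMeasurable.smul
      (Lp.aestronglyMeasurable G)
  have hFe := AEEqFun.coeFn_mk _ mG
  have hwF : (fun x => weight μ x • (AEEqFun.mk _ mG : Fn 𝕜) x) =ᵐ[volume] G := by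
    filter_upwards [hFe] with x hx
    rw [hx, smul_inv_smul₀ (weight_pos μ x).ne']
  have hwF2 : MemLp (fun x => weight μ x • (AEEqFun.mk _ mG : Fn 𝕜) x) 2 volume :=
    (Lp.memLp G).ae_eq hwF.symm
  refine ⟨AEEqFun.mk _ mG, ⟨hwF2.mono (AEEqFun.aestronglyMeasurable _) (.of_forall fun x => ?_),
    hwF2⟩, ?_⟩
  · rw [norm_smul, Real.norm_of_nonneg (weight_pos μ x).le]
    exact le_mul_of_one_le_left (norm_nonneg _) (one_le_weight hμ x)
  · have hz := tendsto_iff_norm_sub_tendsto_zero.1 hG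
    refine hz.congr fun n => ?_
    rw [Lp.norm_def, normL2w]
    congr 1
    refine eLpNorm_congr_ae ?_
    filter_upwards [Lp.coeFn_sub ((hf n).2.toLp) G, (hf n).2.coeFn_toLp, hwF] with x h1 h2 h3
    rw [h1, Pi.sub_apply, h2, ← h3, smul_sub]

/-- Convergence in `L²_η` implies convergence against test functions. -/
theorem tendsto_integral_test (hμ : 0 ≤ μ) {f : ℕ → ℝ → Plane 𝕜} {F : ℝ → Plane 𝕜}
    (hf : ∀ n, MemL2w μ (f n)) (hF : MemL2w μ F)
    (h : Tendsto (fun n => normL2w μ (fun x => f n x - F x)) atTop (𝓝 0)) {ψ : ℝ → ℝ}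
    (hψ : Continuous ψ) (hc : HasCompactSupport ψ) :
    Tendsto (fun n => ∫ x, ψ x • f n x) atTop (𝓝 (∫ x, ψ x • F x)) := by
  have mψ : MemLp ψ 2 volume := hψ.memLp_of_hasCompactSupport hc
  have hi : ∀ {u : ℝ → Plane 𝕜}, MemL2w μ u → Integrable (fun x => ψ x • u x) := fun hu =>
    memLp_one_iff_integrable.1 (hu.1.smul mψ)
  refine tendsto_integral_of_L1' _ (hi hF).aestronglyMeasurable (.of_forall fun n => hi (hf n)) ?_
  have hb : ∀ n, eLpNorm ((fun x => ψ x • f n x) - fun x => ψ x • F x) 1 volume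
      ≤ eLpNorm ψ 2 volume * ENNReal.ofReal (normL2w μ (fun x => f n x - F x)) := by
    intro n
    have hm := (hf n).sub hF
    have e : ((fun x => ψ x • f n x) - fun x => ψ x • F x)
        = ψ • fun x => (f n x - F x) := by
      funext x
      simp [smul_sub]
    rw [e]
    refine (eLpNorm_smul_le_mul_eLpNorm (p := 2) (q := 2) (r := 1) hm.aesm
      mψ.aestronglyMeasurable).trans ?_
    gcongr
    rw [normL2w, ENNReal.ofReal_toReal hm.2.eLpNorm_ne_top]
    refine eLpNorm_mono fun x => ?_
    rw [norm_smul, Real.norm_of_nonneg (weight_pos μ x).le]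
    exact le_mul_of_one_le_left (norm_nonneg _) (one_le_weight hμ x)
  refine tendsto_of_tendsto_of_tendsto_of_le_of_le tendsto_const_nhds ?_ (fun _ => zero_le) hb
  have h0 := ENNReal.tendsto_ofReal h
  rw [ENNReal.ofReal_zero] at h0
  simpa using ENNReal.Tendsto.const_mul h0 (Or.inr mψ.eLpNorm_ne_top)

end Closedness

/-! ### Closedness of the operator -/

section ClosedGraph

variable {𝕜 : Type} [RCLike 𝕜] {μ μhat : ℝ}

theorem SpaceX.norm_lim_sub_le (p q : SpaceX 𝕜 μ μhat) : ‖p.lim - q.lim‖ ≤ ‖p - q‖ := by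
  refine (pow_le_pow_iff_left₀ (norm_nonneg _) (norm_nonneg _) two_ne_zero).1 ?_
  rw [SpaceX.norm_sub_sq]
  exact le_add_of_nonneg_right (sq_nonneg _)

theorem SpaceX.normL2w_sub_le (p q : SpaceX 𝕜 μ μhat) :
    normL2w μ (fun x => (p.fn x - template μhat x • p.lim)
      - (q.fn x - template μhat x • q.lim)) ≤ ‖p - q‖ := by
  refine (pow_le_pow_iff_left₀ (normL2w_nonneg _ _) (norm_nonneg _) two_ne_zero).1 ?_
  rw [SpaceX.norm_sub_sq]
  exact le_add_of_nonneg_left (sq_nonneg _)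

theorem tendsto_integral_smul_smul_const {E : Type*} [NormedAddCommGroup E] [NormedSpace ℝ E]
    [CompleteSpace E] (ψ t : ℝ → ℝ) {ρ : ℕ → E} {ρ₀ : E} (h : Tendsto ρ atTop (𝓝 ρ₀)) :
    Tendsto (fun n => ∫ x, ψ x • t x • ρ n) atTop (𝓝 (∫ x, ψ x • t x • ρ₀)) := by
  simp only [smul_smul, integral_smul_const]
  exact h.const_smul _

theorem locallyIntegrable_template_smul (ρ : Plane 𝕜) :
    LocallyIntegrable (fun x => template μhat x • ρ) volume :=
  ((continuous_template μhat).smul continuous_const).locallyIntegrable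

theorem SpaceX.locallyIntegrable (p : SpaceX 𝕜 μ μhat) : LocallyIntegrable p.fn volume := by
  refine ((p.mem.1.locallyIntegrable one_le_two).add
    (locallyIntegrable_template_smul (μhat := μhat) p.lim)).congr (.of_forall fun x => ?_)
  exact sub_add_cancel _ _

/-- Convergence in `X_η` implies convergence of the first components against test functions. -/
theorem SpaceX.tendsto_integral_test (hμ : 0 ≤ μ) {p : ℕ → SpaceX 𝕜 μ μhat}
    {P : SpaceX 𝕜 μ μhat} (h : Tendsto p atTop (𝓝 P)) {ψ : ℝ → ℝ} (hψ : Continuous ψ)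
    (hc : HasCompactSupport ψ) :
    Tendsto (fun n => ∫ x, ψ x • (p n).fn x) atTop (𝓝 (∫ x, ψ x • P.fn x)) := by
  have hz := tendsto_iff_norm_sub_tendsto_zero.1 h
  have h1 : Tendsto (fun n => (p n).lim) atTop (𝓝 P.lim) :=
    tendsto_iff_norm_sub_tendsto_zero.2 (squeeze_zero (fun _ => norm_nonneg _)
      (fun n => SpaceX.norm_lim_sub_le (p n) P) hz)
  have h2 := TOF.tendsto_integral_test hμ (fun n => (p n).mem) P.mem
    (squeeze_zero (fun _ => normL2w_nonneg _ _) (fun n => SpaceX.normL2w_sub_le (p n) P) hz) hψ hc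
  have e : ∀ q : SpaceX 𝕜 μ μhat, ∫ x, ψ x • q.fn x
      = (∫ x, ψ x • (q.fn x - template μhat x • q.lim)) + ∫ x, ψ x • template μhat x • q.lim := by
    intro q
    rw [← integral_add]
    · refine integral_congr_ae (.of_forall fun x => ?_)
      simp only
      rw [← smul_add, sub_add_cancel]
    · exact (q.mem.1.locallyIntegrable one_le_two).integrable_smul_left_of_hasCompactSupport hψ hc
    · exact (locallyIntegrable_template_smul q.lim).integrable_smul_left_of_hasCompactSupport hψ hc
  simp only [e]
  exact h2.add (tendsto_integral_smul_smul_const ψ (template μhat) h1)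

variable {α₁ α₂ c freq M μ₂ : ℝ} {g₁ g₂ : ℝ → ℝ} {vstar : ℝ → Plane ℝ} {vinf : Plane ℝ}

/-- The linearized operator is closed: by the resolvent estimate at a large real `s`, convergence
of `(p, 𝓛 p)` entails convergence of the weak derivatives of `p`. -/
theorem linOp_isClosed (hα : 0 < α₁) (hμhat : 0 < μhat) (hμ₂' : μ₂ < 2 * μhat) (hμ : 0 ≤ μ)
    (hμ₂ : μ ≤ μ₂) {b' : ℝ → Plane 𝕜 →L[ℝ] Plane 𝕜}
    (hb : IsCoeff μhat M (fun x => zeroOrder 𝕜 g₁ g₂ freq (vstar x)) b'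
      (zeroOrder 𝕜 g₁ g₂ freq vinf)) :
    (linOp 𝕜 α₁ α₂ g₁ g₂ vstar c freq vinf μ μhat).IsClosed := by
  obtain ⟨κ, hκ, R, hR, C, hC, est⟩ := extended_estimate 𝕜 α₂ c M hα hμhat hμ₂'
  obtain ⟨Ci, hCi, img⟩ := exists_image c hμ₂' hμ hμ₂ (actL 𝕜 (mulMat α₁ α₂)) hb
  rw [LinearPMap.IsClosed, linOp_graph]
  refine IsSeqClosed.isClosed fun z Z hz hlim => ?_
  have hz' := fun n => (mem_linGraph_iff (p := (z n).1) (q := (z n).2)).1 (hz n)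
  choose w₁ w₂ hw1 hw2 m1 m2 hfn hli using hz'
  have hp : Tendsto (fun n => (z n).1) atTop (𝓝 Z.1) := (continuous_fst.tendsto Z).comp hlim
  have hq : Tendsto (fun n => (z n).2) atTop (𝓝 Z.2) := (continuous_snd.tendsto Z).comp hlim
  set s : 𝕜 := ((R : ℝ) : 𝕜) with hs
  have hR0 : 0 < R := lt_of_lt_of_le one_pos hR
  have hsn : ‖s‖ = R := by rw [hs, RCLike.norm_ofReal, abs_of_pos hR0]
  have hsr : RCLike.re s = R := RCLike.ofReal_re R
  have hy : CauchySeq fun n => s • (z n).1 - (z n).2 := ((hp.const_smul s).sub hq).cauchySeq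
  have hest : ∀ m n, normL2w μ (fun x => w₁ m x - w₁ n x) ^ 2
      + normL2w μ (fun x => w₂ m x - w₂ n x) ^ 2
      ≤ C * ‖(s • (z m).1 - (z m).2) - (s • (z n).1 - (z n).2)‖ ^ 2 := by
    intro m n
    have e := est _ _ _ hb μ hμ hμ₂ s hsn.ge (by rw [hsr, hsn]; nlinarith) ((z m).1 - (z n).1)
      ((s • (z m).1 - (z m).2) - (s • (z n).1 - (z n).2)) (fun x => w₁ m x - w₁ n x)
      (fun x => w₂ m x - w₂ n x)
      (((hw1 m).sub (hw1 n)).congr (SpaceX.coe_fn_sub _ _).symm (ae_eq_refl _))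
      ((hw2 m).sub (hw2 n)) ((m1 m).sub (m1 n)) ((m2 m).sub (m2 n)) ?_ ?_
    · have h1 : 0 ≤ ‖s‖ ^ 2 * ‖(z m).1 - (z n).1‖ ^ 2 := by positivity
      have h2 : normL2w μ (fun x => w₁ m x - w₁ n x) ^ 2
          ≤ ‖s‖ * normL2w μ (fun x => w₁ m x - w₁ n x) ^ 2 :=
        le_mul_of_one_le_left (sq_nonneg _) (hsn.symm ▸ hR)
      linarith
    · filter_upwards [SpaceX.coe_fn_sub (s • (z m).1 - (z m).2) (s • (z n).1 - (z n).2),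
        SpaceX.coe_fn_sub (s • (z m).1) (z m).2, SpaceX.coe_fn_sub (s • (z n).1) (z n).2,
        SpaceX.coe_fn_smul s (z m).1, SpaceX.coe_fn_smul s (z n).1,
        SpaceX.coe_fn_sub (z m).1 (z n).1, hfn m, hfn n] with x h1 h2 h3 h4 h5 h6 h7 h8
      rw [h1, h2, h3, h4, h5, h6, h7, h8]
      simp only [map_sub, smul_sub]
      abel
    · simp only [SpaceX.lim_sub, SpaceX.lim_smul, hli, map_sub, smul_sub]
      abel
  have hcau : ∀ w : ℕ → Fn 𝕜, (∀ m n, normL2w μ (fun x => w m x - w n x) ^ 2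
      ≤ C * ‖(s • (z m).1 - (z m).2) - (s • (z n).1 - (z n).2)‖ ^ 2) →
      ∀ ε > 0, ∃ N, ∀ m ≥ N, ∀ n ≥ N, normL2w μ (fun x => w m x - w n x) < ε := by
    intro w hw ε hε
    obtain ⟨N, hN⟩ := Metric.cauchySeq_iff.1 hy (ε / Real.sqrt C)
      (div_pos hε (Real.sqrt_pos.2 hC))
    refine ⟨N, fun m hm n hn => ?_⟩
    have h1 := hN m hm n hn
    rw [dist_eq_norm, lt_div_iff₀ (Real.sqrt_pos.2 hC)] at h1
    refine lt_of_le_of_lt ?_ h1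
    refine (pow_le_pow_iff_left₀ (normL2w_nonneg _ _) (by positivity) two_ne_zero).1 ?_
    rw [mul_pow, Real.sq_sqrt hC.le, mul_comm]
    exact hw m n
  obtain ⟨W₁, M1, T1⟩ := exists_limit_of_cauchy hμ m1 (hcau w₁ fun m n =>
    (le_add_of_nonneg_right (sq_nonneg _)).trans (hest m n))
  obtain ⟨W₂, M2, T2⟩ := exists_limit_of_cauchy hμ m2 (hcau w₂ fun m n =>
    (le_add_of_nonneg_left (sq_nonneg _)).trans (hest m n))
  have D1 : HasWeakDeriv 1 Z.1.fn W₁ := HasWeakDeriv.of_tendsto Z.1.locallyIntegrable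
    (M1.1.locallyIntegrable one_le_two) hw1
    (fun ψ hψ hc => SpaceX.tendsto_integral_test hμ hp hψ hc)
    (fun ψ hψ hc => tendsto_integral_test hμ m1 M1 T1 hψ hc)
  have D2 : HasWeakDeriv 1 W₁ W₂ := HasWeakDeriv.of_tendsto
    (M1.1.locallyIntegrable one_le_two) (M2.1.locallyIntegrable one_le_two) hw2
    (fun ψ hψ hc => tendsto_integral_test hμ m1 M1 T1 hψ hc)
    (fun ψ hψ hc => tendsto_integral_test hμ m2 M2 T2 hψ hc)
  -- the image `q'` of the limit is the limit of the images
  obtain ⟨q', hq'f, hq'l, -⟩ := img Z.1 W₁ W₂ M1 M2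
  have hb1 : ∀ n, ‖(z n).2 - q'‖ ^ 2 ≤ Ci * (‖(z n).1 - Z.1‖ ^ 2
      + normL2w μ (fun x => w₁ n x - W₁ x) ^ 2 + normL2w μ (fun x => w₂ n x - W₂ x) ^ 2) := by
    intro n
    obtain ⟨q, hqf, hql, hqn⟩ := img ((z n).1 - Z.1) _ _ ((m1 n).sub M1) ((m2 n).sub M2)
    have e : (z n).2 - q' = q := by
      refine SpaceX.ext ?_ ?_
      · filter_upwards [SpaceX.coe_fn_sub (z n).2 q', SpaceX.coe_fn_sub (z n).1 Z.1, hqf, hq'f,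
          hfn n] with x h1 h2 h3 h4 h5
        rw [h1, h3, h2, h4, h5]
        simp only [map_sub, smul_sub]
        abel
      · rw [SpaceX.lim_sub, hli, hq'l, hql, SpaceX.lim_sub, map_sub]
    rw [e]
    exact hqn
  have hq2 : Tendsto (fun n => (z n).2) atTop (𝓝 q') := by
    refine tendsto_iff_norm_sub_tendsto_zero.2 ?_
    have hz := tendsto_iff_norm_sub_tendsto_zero.1 hp
    have h0 : Tendsto (fun n => Ci * (‖(z n).1 - Z.1‖ ^ 2
      + normL2w μ (fun x => w₁ n x - W₁ x) ^ 2 + normL2w μ (fun x => w₂ n x - W₂ x) ^ 2))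
      atTop (𝓝 0) := by
      have := (((hz.pow 2).add (T1.pow 2)).add (T2.pow 2)).const_mul Ci
      simpa using this
    have h1 := squeeze_zero (fun n => sq_nonneg _) hb1 h0
    have h2 := (Real.continuous_sqrt.tendsto 0).comp h1
    rw [Real.sqrt_zero] at h2
    exact h2.congr fun n => Real.sqrt_sq (norm_nonneg _)
  have hZ : Z.2 = q' := tendsto_nhds_unique hq hq2
  exact mem_linGraph_iff.2 ⟨W₁, W₂, D1, D2, M1, M2, hZ ▸ hq'f, hZ ▸ hq'l⟩

end ClosedGraph

/-! ### The coefficients along a front -/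

section Coefficients

variable {g₁ g₂ : ℝ → ℝ}

theorem nonlin_zero_coord (u : Plane ℝ) :
    nonlin g₁ g₂ u 0 = g₁ (‖u‖ ^ 2) * u 0 - g₂ (‖u‖ ^ 2) * u 1 := by
  rw [nonlin, act_coord]
  simp [mulMat]
  ring

theorem nonlin_one_coord (u : Plane ℝ) :
    nonlin g₁ g₂ u 1 = g₂ (‖u‖ ^ 2) * u 0 + g₁ (‖u‖ ^ 2) * u 1 := by
  rw [nonlin, act_coord]
  simp [mulMat]

theorem contDiff_nonlin (h₁ : ContDiff ℝ 3 g₁) (h₂ : ContDiff ℝ 3 g₂) :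
    ContDiff ℝ 3 (nonlin g₁ g₂) := by
  have hn : ContDiff ℝ 3 fun u : Plane ℝ => ‖u‖ ^ 2 := contDiff_norm_sq ℝ
  have hc : ∀ i : Fin 2, ContDiff ℝ 3 fun u : Plane ℝ => u i := fun i =>
    (contDiff_euclidean.1 contDiff_id) i
  refine contDiff_euclidean.2 fun i => ?_
  fin_cases i
  · refine (congrArg (ContDiff ℝ 3) (funext nonlin_zero_coord)).mpr ?_
    exact ((h₁.comp hn).mul (hc 0)).sub ((h₂.comp hn).mul (hc 1))
  · refine (congrArg (ContDiff ℝ 3) (funext nonlin_one_coord)).mpr ?_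
    exact ((h₂.comp hn).mul (hc 0)).add ((h₁.comp hn).mul (hc 1))

theorem contDiff_jac (h₁ : ContDiff ℝ 3 g₁) (h₂ : ContDiff ℝ 3 g₂) (i j : Fin 2) :
    ContDiff ℝ 2 fun u => jac g₁ g₂ u i j := by
  have h : ContDiff ℝ 2 (fderiv ℝ (nonlin g₁ g₂)) :=
    (contDiff_nonlin h₁ h₂).fderiv_right (by norm_num)
  have h' : ContDiff ℝ 2 fun u => fderiv ℝ (nonlin g₁ g₂) u (EuclideanSpace.single j 1) :=
    h.clm_apply contDiff_const
  exact (contDiff_euclidean.1 h') i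

/-- On each ball, the entries of the Jacobian are bounded with bounded derivatives, and hence
Lipschitz continuous. -/
theorem exists_jac_bound (h₁ : ContDiff ℝ 3 g₁) (h₂ : ContDiff ℝ 3 g₂) (B : ℝ) :
    ∃ L ≥ 0, ∀ i j, (∀ u, ‖u‖ ≤ B → |jac g₁ g₂ u i j| ≤ L) ∧
      (∀ u, ‖u‖ ≤ B → ‖fderiv ℝ (fun u => jac g₁ g₂ u i j) u‖ ≤ L) ∧
      ∀ u v, ‖u‖ ≤ B → ‖v‖ ≤ B → |jac g₁ g₂ u i j - jac g₁ g₂ v i j| ≤ L * ‖u - v‖ := by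
  have key : ∀ i j, ∃ L ≥ 0, (∀ u, ‖u‖ ≤ B → |jac g₁ g₂ u i j| ≤ L) ∧
      (∀ u, ‖u‖ ≤ B → ‖fderiv ℝ (fun u => jac g₁ g₂ u i j) u‖ ≤ L) := by
    intro i j
    have hc := isCompact_closedBall (0 : Plane ℝ) B
    obtain ⟨L₀, hL₀⟩ := hc.exists_bound_of_continuousOn
      (contDiff_jac h₁ h₂ i j).continuous.continuousOn
    obtain ⟨L₁, hL₁⟩ := hc.exists_bound_of_continuousOn
      ((contDiff_jac h₁ h₂ i j).continuous_fderiv (by norm_num)).continuousOn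
    refine ⟨max 0 (max L₀ L₁), le_max_left _ _, fun u hu => ?_, fun u hu => ?_⟩
    · exact (hL₀ u (by simpa using hu)).trans ((le_max_left _ _).trans (le_max_right _ _))
    · exact (hL₁ u (by simpa using hu)).trans ((le_max_right _ _).trans (le_max_right _ _))
  choose L hL0 hL1 hL2 using key
  have hle : ∀ i j, L i j ≤ ∑ i, ∑ j, L i j := fun i j =>
    (Finset.single_le_sum (f := fun j => L i j) (fun j _ => hL0 i j) (Finset.mem_univ j)).trans
      (Finset.single_le_sum (f := fun i => ∑ j, L i j)
        (fun i _ => Finset.sum_nonneg fun j _ => hL0 i j) (Finset.mem_univ i))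
  refine ⟨∑ i, ∑ j, L i j, Finset.sum_nonneg fun i _ => Finset.sum_nonneg fun j _ => hL0 i j,
    fun i j => ⟨fun u hu => (hL1 i j u hu).trans (hle i j),
      fun u hu => (hL2 i j u hu).trans (hle i j), fun u v hu hv => ?_⟩⟩
  refine (convex_closedBall (0 : Plane ℝ) B).norm_image_sub_le_of_norm_fderiv_le
    (𝕜 := ℝ) (f := fun u => jac g₁ g₂ u i j)
    (fun w _ => ((contDiff_jac h₁ h₂ i j).differentiable (by norm_num)) w)
    (fun w hw => (hL2 i j w (by simpa using hw)).trans (hle i j))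
    (by simpa using hv) (by simpa using hu)

/-- The zero order coefficient of the linearization along a profile with a decay rate of at least
`2 μ̂`. -/
theorem exists_isCoeff (𝕜 : Type) [RCLike 𝕜] {vstar : ℝ → Plane ℝ} {vinf : Plane ℝ}
    {μstar μhat : ℝ} (freq : ℝ) (h₁ : ContDiff ℝ 3 g₁) (h₂ : ContDiff ℝ 3 g₂)
    (hbdd : IsC2b vstar) (hlim : Tendsto vstar atTop (𝓝 vinf)) (hdec : IsDecayRate vstar vinf μstar)
    (hle : 2 * μhat ≤ μstar) :
    ∃ M, ∃ b' : ℝ → Plane 𝕜 →L[ℝ] Plane 𝕜,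
      IsCoeff μhat M (fun x => zeroOrder 𝕜 g₁ g₂ freq (vstar x)) b'
        (zeroOrder 𝕜 g₁ g₂ freq vinf) := by
  obtain ⟨hC2, hb⟩ := hbdd
  obtain ⟨B₀, hB₀⟩ := hb 0 (by norm_num)
  obtain ⟨B₁, hB₁⟩ := hb 1 (by norm_num)
  simp only [iteratedDeriv_zero] at hB₀
  simp only [iteratedDeriv_one] at hB₁
  have hBi : ‖vinf‖ ≤ B₀ := le_of_tendsto hlim.norm (.of_forall hB₀)
  have hB₁0 : 0 ≤ B₁ := (norm_nonneg _).trans (hB₁ 0)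
  have hB₀0 : 0 ≤ B₀ := (norm_nonneg _).trans (hB₀ 0)
  obtain ⟨K, hK, hp, hm⟩ := hdec
  obtain ⟨L, hL, hJ⟩ := exists_jac_bound h₁ h₂ B₀
  have hv : ∀ x, HasDerivAt vstar (deriv vstar x) x := fun x =>
    (hC2.differentiable (by norm_num) x).hasDerivAt
  have hv' : Continuous (deriv vstar) := hC2.continuous_deriv (by norm_num)
  have hdiff : ∀ x, ‖zeroOrder 𝕜 g₁ g₂ freq (vstar x) - zeroOrder 𝕜 g₁ g₂ freq vinf‖
      ≤ 2 * (L * ‖vstar x - vinf‖) := by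
    intro x
    rw [zeroOrder, zeroOrder, ← map_sub, add_sub_add_left_eq_sub]
    exact norm_actL_le fun i j => (hJ i j).2.2 _ _ (hB₀ x) hBi
  have hbound : ∀ u : Plane ℝ, ‖u‖ ≤ B₀ → ‖zeroOrder 𝕜 g₁ g₂ freq u‖ ≤ 2 * (|freq| + L) := by
    intro u hu
    refine norm_actL_le fun i j => ?_
    rw [Matrix.add_apply]
    refine (abs_add_le _ _).trans (add_le_add ?_ ((hJ i j).1 u hu))
    fin_cases i <;> fin_cases j <;> simp [rotGen]
  set J' : ℝ → Matrix (Fin 2) (Fin 2) ℝ := fun x => Matrix.of fun i j =>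
    fderiv ℝ (fun u => jac g₁ g₂ u i j) (vstar x) (deriv vstar x) with hJ'
  have hder : ∀ x, ‖actL 𝕜 (J' x)‖ ≤ 2 * (L * ‖deriv vstar x‖) := fun x =>
    norm_actL_le fun i j => ContinuousLinearMap.le_of_opNorm_le _ ((hJ i j).2.1 _ (hB₀ x)) _
  have hdecay : ∀ x, 0 ≤ x → ‖vstar x - vinf‖ ≤ K * Real.exp (-(2 * μhat * |x|)) ∧
      ‖deriv vstar x‖ ≤ K * Real.exp (-(2 * μhat * |x|)) := by
    intro x hx
    have h1 := hp x hx
    rw [iteratedDeriv_one] at h1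
    have h2 : K * Real.exp (-(μstar * x)) ≤ K * Real.exp (-(2 * μhat * |x|)) := by
      rw [abs_of_nonneg hx]
      gcongr
    have e1 := norm_nonneg (vstar x - vinf)
    have e2 := norm_nonneg (deriv vstar x)
    have e3 := norm_nonneg (iteratedDeriv 2 vstar x)
    have e4 := norm_nonneg (iteratedDeriv 3 vstar x)
    constructor <;> linarith
  -- the template function supplies the decay at `-∞`
  have htem : ∀ (y D : ℝ → ℝ) (N : ℝ), (∀ x, 0 ≤ y x) → (∀ x, y x ≤ 2 * (L * D x)) →
      (∀ x, D x ≤ N) → 0 ≤ N → (∀ x, 0 ≤ x → D x ≤ K * Real.exp (-(2 * μhat * |x|))) → ∀ x,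
      template μhat x * y x ≤ 2 * (L * (K + N)) * Real.exp (-(2 * μhat * |x|)) := by
    intro y D N hy0 hy hN hN0 hD x
    rcases le_total 0 x with hx | hx
    · calc template μhat x * y x ≤ 1 * y x :=
            mul_le_mul_of_nonneg_right (template_le_one _ _) (hy0 x)
        _ ≤ 2 * (L * (K * Real.exp (-(2 * μhat * |x|)))) := by
            rw [one_mul]
            refine (hy x).trans ?_
            gcongr
            exact hD x hx
        _ ≤ 2 * (L * ((K + N) * Real.exp (-(2 * μhat * |x|)))) := by
            gcongr
            linarith
        _ = _ := by ring
    · rw [abs_of_nonpos hx, show -(2 * μhat * -x) = 2 * μhat * x by ring,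
        mul_comm (2 * (L * (K + N)))]
      refine mul_le_mul (template_le_exp _ _) ?_ (hy0 x) (Real.exp_pos _).le
      refine (hy x).trans ?_
      gcongr
      linarith [hN x]
  set M := 2 * (|freq| + L) + 2 * (L * (K + (B₀ + B₀))) + 2 * (L * (K + B₁)) + 2 * (L * B₁) with hM
  have p1 : 0 ≤ 2 * (|freq| + L) := by positivity
  have p2 : 0 ≤ 2 * (L * (K + (B₀ + B₀))) := by positivity
  have p3 : 0 ≤ 2 * (L * (K + B₁)) := by positivity
  have p4 : 0 ≤ 2 * (L * B₁) := by positivity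
  refine ⟨M, fun x => actL 𝕜 (J' x), ⟨fun x => ?_, ?_, fun x => ?_, ?_, fun x => ?_, fun x => ?_,
    fun x => ?_⟩⟩
  · exact (hbound _ (hB₀ x)).trans (by linarith)
  · exact (hbound _ hBi).trans (by linarith)
  · refine hasDerivAt_actL fun i j => ?_
    have h := (((contDiff_jac h₁ h₂ i j).differentiable (by norm_num)) (vstar x)).hasFDerivAt
    exact (h.comp_hasDerivAt x (hv x)).const_add (rotGen freq i j)
  · refine continuous_actL fun i j => ?_
    have h := (contDiff_jac h₁ h₂ i j).continuous_fderiv (by norm_num)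
    exact (h.comp hC2.continuous).clm_apply hv'
  · refine (hder x).trans (le_trans ?_ (show 2 * (L * B₁) ≤ M by linarith))
    gcongr
    exact hB₁ x
  · refine (htem _ _ (B₀ + B₀) (fun x => norm_nonneg _) hdiff (fun x =>
      (norm_sub_le _ _).trans (add_le_add (hB₀ x) hBi)) (by positivity)
      (fun x hx => (hdecay x hx).1) x).trans ?_
    gcongr
    linarith
  · refine (htem _ _ B₁ (fun x => norm_nonneg _) hder hB₁ hB₁0
      (fun x hx => (hdecay x hx).2) x).trans ?_
    gcongr
    linarith

end Coefficients

/-! ### The resolvent estimates -/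

section ResolventEstimates

theorem sobNorm_one_sq {𝕜 : Type} [RCLike 𝕜] {μ μhat : ℝ} (p : SpaceX 𝕜 μ μhat) :
    sobNorm 1 p ^ 2 = ‖p‖ ^ 2 + normL2w μ (weakDeriv 1 p.fn) ^ 2 := by
  rw [sobNorm, Real.sq_sqrt (by positivity), Finset.Icc_self, Finset.sum_singleton,
    SpaceX.norm_sq]

/-- In a sector slightly larger than the right half plane, the real part is bounded below by a
small multiple of the modulus. -/
theorem re_ge_of_abs_arg_le {s : ℂ} {ε : ℝ} (hε : 0 ≤ ε) (hε1 : ε ≤ 1)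
    (h : |s.arg| ≤ Real.pi / 2 + ε) : -(ε * ‖s‖) ≤ s.re := by
  have h1 : Real.cos (Real.pi / 2 + ε) ≤ Real.cos |s.arg| :=
    Real.cos_le_cos_of_nonneg_of_le_pi (abs_nonneg _) (by linarith [Real.pi_gt_three]) h
  rw [Real.cos_abs, add_comm, Real.cos_add_pi_div_two] at h1
  have h2 := Real.sin_le hε
  rw [← Complex.norm_mul_cos_arg s]
  have h3 := mul_le_mul_of_nonneg_left (show -ε ≤ Real.cos s.arg by linarith) (norm_nonneg s)
  linarith

variable {α₁ α₂ c freq M μ₂ μhat : ℝ} {g₁ g₂ : ℝ → ℝ} {vstar : ℝ → Plane ℝ} {vinf : Plane ℝ}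

/-- The resolvent estimates in all three norms, with constants uniform in the weight. -/
theorem linOp_resolvent_estimates (hα : 0 < α₁) (hμhat : 0 < μhat) (hμ₂' : μ₂ < 2 * μhat)
    {b' : ℝ → Plane ℂ →L[ℝ] Plane ℂ}
    (hb : IsCoeff μhat M (fun x => zeroOrder ℂ g₁ g₂ freq (vstar x)) b'
      (zeroOrder ℂ g₁ g₂ freq vinf)) :
    ∃ ε₀ > 0, ∃ R₀ > 0, ∃ C > 0, ∀ μ : ℝ, 0 ≤ μ → μ ≤ μ₂ →
      ∀ s : ℂ, R₀ ≤ ‖s‖ → |s.arg| ≤ Real.pi / 2 + ε₀ →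
        ∀ p q : SpaceX ℂ μ μhat, (p, q) ∈ linGraph ℂ α₁ α₂ g₁ g₂ vstar c freq vinf μ μhat →
          (‖s‖ * ‖p‖ ^ 2 + normL2w μ (weakDeriv 1 p.fn) ^ 2 ≤ C / ‖s‖ * ‖s • p - q‖ ^ 2) ∧
          (‖s‖ ^ 2 * ‖p‖ ^ 2 + ‖s‖ * normL2w μ (weakDeriv 1 p.fn) ^ 2
              + normL2w μ (weakDeriv 2 p.fn) ^ 2 ≤ C * ‖s • p - q‖ ^ 2) ∧
          (s • p - q ∈ sobX ℂ μ μhat 1 → p ∈ sobX ℂ μ μhat 3 →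
            ‖s‖ ^ 2 * sobNorm 1 p ^ 2 + ‖s‖ * normL2w μ (weakDeriv 2 p.fn) ^ 2
              + normL2w μ (weakDeriv 3 p.fn) ^ 2 ≤ C * sobNorm 1 (s • p - q) ^ 2) := by
  obtain ⟨κ₁, hκ₁, R₁, hR₁, C₁, hC₁, est₁⟩ := extended_estimate ℂ α₂ c M hα hμhat hμ₂'
  obtain ⟨κ₂, hκ₂, R₂, hR₂, C₂, hC₂, est₂⟩ := extended_estimate_deriv ℂ α₂ c (M := M) hα hμ₂'
  refine ⟨min 1 (min κ₁ κ₂), lt_min one_pos (lt_min hκ₁ hκ₂), max R₁ R₂,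
    lt_of_lt_of_le one_pos (hR₁.trans (le_max_left _ _)), C₁ + C₂ + C₁ * C₂, by positivity, ?_⟩
  intro μ hμ hμ₂ s hsR hs p q hpq
  have hre := re_ge_of_abs_arg_le (le_min zero_le_one (le_min hκ₁.le hκ₂.le)) (min_le_left _ _) hs
  have hsR₁ : R₁ ≤ ‖s‖ := (le_max_left _ _).trans hsR
  have hsR₂ : R₂ ≤ ‖s‖ := (le_max_right _ _).trans hsR
  have hs1 : 1 ≤ ‖s‖ := hR₁.trans hsR₁
  have hs0 : 0 < ‖s‖ := lt_of_lt_of_le one_pos hs1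
  have hre' : ∀ κ, min 1 (min κ₁ κ₂) ≤ κ → -(κ * ‖s‖) ≤ RCLike.re s := fun κ hκ =>
    le_trans (neg_le_neg (mul_le_mul_of_nonneg_right hκ hs0.le)) hre
  have hre₁ := hre' κ₁ ((min_le_right _ _).trans (min_le_left _ _))
  have hre₂ := hre' κ₂ ((min_le_right _ _).trans (min_le_right _ _))
  obtain ⟨w₁, w₂, d1, d2, m1, m2, hf, hl⟩ := mem_linGraph_iff.1 hpq
  have hD2 : HasWeakDeriv 2 p.fn w₂ := d1.succ d2
  rw [weakDeriv_eq d1, weakDeriv_eq hD2]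
  have heq : ∀ᵐ x, (s • p - q).fn x = s • p.fn x - (actL ℂ (mulMat α₁ α₂) (w₂ x) + c • w₁ x
      + zeroOrder ℂ g₁ g₂ freq (vstar x) (p.fn x)) := by
    filter_upwards [SpaceX.coe_fn_sub (s • p) q, SpaceX.coe_fn_smul s p, hf] with x h1 h2 h3
    rw [h1, h2, h3]
  have hlim : (s • p - q).lim = s • p.lim - zeroOrder ℂ g₁ g₂ freq vinf p.lim := by
    rw [SpaceX.lim_sub, SpaceX.lim_smul, hl]
  have e₁ := est₁ _ _ _ hb μ hμ hμ₂ s hsR₁ hre₁ p (s • p - q) w₁ w₂ d1 d2 m1 m2 heq hlim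
  set r := s • p - q with hr
  have hC : C₁ ≤ C₁ + C₂ + C₁ * C₂ := by nlinarith [mul_pos hC₁ hC₂]
  have e₁' := e₁.trans (mul_le_mul_of_nonneg_right hC (sq_nonneg ‖r‖))
  refine ⟨?_, e₁', fun hr1 hp3 => ?_⟩
  · rw [div_mul_eq_mul_div, le_div_iff₀ hs0]
    nlinarith [sq_nonneg (normL2w μ w₂)]
  · obtain ⟨r₁, hdr, mr⟩ := hr1 1 le_rfl le_rfl
    obtain ⟨w₃, hd3, m3⟩ := hp3 3 (by norm_num) le_rfl
    have d3 : HasWeakDeriv 1 w₂ w₃ := d2.of_succ (d1.of_succ hd3)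
    rw [sobNorm_one_sq, sobNorm_one_sq, weakDeriv_eq d1, weakDeriv_eq hdr, weakDeriv_eq hd3]
    have e₂ := est₂ _ _ _ hb μ hμ hμ₂ s hsR₂ hre₂ p r w₁ w₂ w₃ r₁ d1 d2 d3 hdr m1 m2 m3 mr heq
    have h1 : ‖p‖ ^ 2 ≤ C₁ * ‖r‖ ^ 2 := by
      have h2 : ‖p‖ ^ 2 ≤ ‖s‖ ^ 2 * ‖p‖ ^ 2 :=
        le_mul_of_one_le_left (sq_nonneg _) (one_le_pow₀ hs1)
      have h3 : 0 ≤ ‖s‖ * normL2w μ w₁ ^ 2 := by positivity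
      linarith [sq_nonneg (normL2w μ w₂)]
    have h4 : 0 ≤ ‖s‖ * normL2w μ w₁ ^ 2 := by positivity
    have h5 := mul_le_mul_of_nonneg_left h1 hC₂.le
    have h6 : 0 ≤ C₁ * normL2w μ r₁ ^ 2 := by positivity
    have h7 : 0 ≤ C₁ * C₂ * normL2w μ r₁ ^ 2 := by positivity
    have h8 : 0 ≤ C₂ * ‖r‖ ^ 2 := by positivity
    linarith [sq_nonneg (normL2w μ w₂)]

end ResolventEstimates

/-! ### Lyapunov functions and exponential decay -/

section ExponentialDecay

/-- If `f` converges and `f''` is bounded, then `f'` tends to zero. -/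
theorem tendsto_deriv_zero {E : Type*} [NormedAddCommGroup E] [NormedSpace ℝ E]
    {f f' f'' : ℝ → E} {B : ℝ} {l : E} (hf : ∀ x, HasDerivAt f (f' x) x)
    (hf' : ∀ x, HasDerivAt f' (f'' x) x) (hB : ∀ x, ‖f'' x‖ ≤ B) (hl : Tendsto f atTop (𝓝 l)) :
    Tendsto f' atTop (𝓝 0) := by
  have hB0 : 0 ≤ B := (norm_nonneg _).trans (hB 0)
  have key : ∀ h > 0, ∀ x, ‖f' x‖ ≤ ‖f (x + h) - f x‖ / h + B * h := by
    intro h hh x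
    -- the derivative of `t ↦ f t - t f'(x)` is bounded by `B h` on `[x, x + h]`
    have h1 : ‖(f (x + h) - (x + h) • f' x) - (f x - x • f' x)‖ ≤ (B * h) * ‖(x + h) - x‖ := by
      refine (convex_Icc x (x + h)).norm_image_sub_le_of_norm_hasDerivWithin_le
        (f := fun t => f t - t • f' x) (f' := fun t => f' t - (1 : ℝ) • f' x)
        (fun t _ => ((hf t).sub ((hasDerivAt_id t).smul_const (f' x))).hasDerivWithinAt)
        (fun t ht => ?_) ⟨le_rfl, by linarith⟩ ⟨by linarith, le_rfl⟩
      rw [one_smul]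
      refine ((convex_univ (𝕜 := ℝ)).norm_image_sub_le_of_norm_hasDerivWithin_le (f := f')
        (fun s _ => (hf' s).hasDerivWithinAt) (fun s _ => hB s) (Set.mem_univ x)
        (Set.mem_univ t)).trans ?_
      rw [Real.norm_of_nonneg (by linarith [ht.1])]
      exact mul_le_mul_of_nonneg_left (by linarith [ht.2]) hB0
    have e : (f (x + h) - (x + h) • f' x) - (f x - x • f' x) = (f (x + h) - f x) - h • f' x := by
      rw [add_smul]; abel
    rw [e, add_sub_cancel_left, Real.norm_of_nonneg hh.le] at h1
    have h2 : ‖h • f' x‖ ≤ ‖f (x + h) - f x‖ + ‖(f (x + h) - f x) - h • f' x‖ := by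
      have := norm_sub_le (f (x + h) - f x) ((f (x + h) - f x) - h • f' x)
      rwa [sub_sub_cancel] at this
    rw [norm_smul, Real.norm_of_nonneg hh.le] at h2
    rw [← sub_le_iff_le_add, le_div_iff₀ hh]
    nlinarith
  refine tendsto_zero_iff_norm_tendsto_zero.2 (Metric.tendsto_atTop.2 fun ε hε => ?_)
  set h := ε / (2 * (B + 1)) with hh
  have hh0 : 0 < h := by positivity
  have hd : Tendsto (fun x => ‖f (x + h) - f x‖ / h) atTop (𝓝 0) := by
    have h1 : Tendsto (fun x => f (x + h)) atTop (𝓝 l) :=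
      hl.comp (tendsto_atTop_add_const_right _ _ tendsto_id)
    have h2 := ((h1.sub hl).norm).div_const h
    simpa using h2
  obtain ⟨N, hN⟩ := (hd.eventually (gt_mem_nhds (half_pos hε))).exists_forall_of_atTop
  refine ⟨N, fun x hx => ?_⟩
  rw [dist_zero_right, norm_norm]
  have h3 : B * h ≤ ε / 2 := by
    rw [hh, mul_div_assoc', div_le_div_iff₀ (by positivity) two_pos]
    nlinarith
  linarith [key h hh0 x, hN x hx]

/-- Exponential decay from a Lyapunov function `Q`, whose decay rate `-Q'` controls `y`. No lower
bound of `Q` in terms of `y` is needed: the values of `y` are recovered from the mean value of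
`-Q'` over an interval of length one, as `y` grows at most exponentially. -/
theorem exp_decay_of_lyapunov {Q y Q' y' : ℝ → ℝ} {t₀ δ C : ℝ} (hδ : 0 < δ) (hC : 0 < C)
    (hQ : ∀ t, HasDerivAt Q (Q' t) t) (hy : ∀ t, HasDerivAt y (y' t) t)
    (hQy : ∀ t ≥ t₀, Q' t ≤ -(δ * y t)) (hle : ∀ t ≥ t₀, Q t ≤ C * y t)
    (hy' : ∀ t ≥ t₀, y' t ≤ C * y t) (hy0 : ∀ t ≥ t₀, 0 ≤ y t) (hlim : Tendsto Q atTop (𝓝 0)) :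
    ∃ K > 0, ∃ κ > 0, ∀ t ≥ t₀ + 1, y t ≤ K * Real.exp (-(κ * t)) := by
  have hanti : ∀ s ≥ t₀, ∀ t ≥ s, Q t ≤ Q s := by
    have h : AntitoneOn Q (Set.Ici t₀) := antitoneOn_of_deriv_nonpos (convex_Ici t₀)
      (fun t _ => (hQ t).continuousAt.continuousWithinAt)
      (fun t _ => (hQ t).differentiableAt.differentiableWithinAt) fun t ht => by
        rw [interior_Ici, Set.mem_Ioi] at ht
        rw [(hQ t).deriv]
        nlinarith [hQy t ht.le, mul_nonneg hδ.le (hy0 t ht.le)]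
    exact fun s hs t ht => h hs (le_trans hs ht : t₀ ≤ t) ht
  have hQ0 : ∀ t ≥ t₀, 0 ≤ Q t := fun t ht =>
    le_of_tendsto hlim ((eventually_ge_atTop t).mono fun s hs => hanti t ht s hs)
  set κ := δ / C with hκ
  have hκ0 : 0 < κ := div_pos hδ hC
  have hdec : ∀ t ≥ t₀, Q t * Real.exp (κ * t) ≤ Q t₀ * Real.exp (κ * t₀) := by
    have hd : ∀ t, HasDerivAt (fun t => Q t * Real.exp (κ * t))
        (Q' t * Real.exp (κ * t) + Q t * (Real.exp (κ * t) * (κ * 1))) t := fun t =>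
      (hQ t).mul (((hasDerivAt_id t).const_mul κ).exp)
    have h : AntitoneOn (fun t => Q t * Real.exp (κ * t)) (Set.Ici t₀) :=
      antitoneOn_of_deriv_nonpos (convex_Ici t₀)
      (fun t _ => (hd t).continuousAt.continuousWithinAt)
      (fun t _ => (hd t).differentiableAt.differentiableWithinAt) fun t ht => by
        rw [interior_Ici, Set.mem_Ioi] at ht
        rw [(hd t).deriv]
        have h1 : κ * Q t ≤ δ * y t := by
          rw [hκ, div_mul_eq_mul_div, div_le_iff₀ hC]
          nlinarith [mul_le_mul_of_nonneg_left (hle t ht.le) hδ.le]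
        nlinarith [hQy t ht.le, Real.exp_pos (κ * t),
          mul_nonneg (Real.exp_pos (κ * t)).le (sub_nonneg.2 h1),
          mul_nonneg (Real.exp_pos (κ * t)).le (sub_nonneg.2 (hQy t ht.le))]
    exact fun t ht => h (Set.mem_Ici.2 le_rfl) ht ht
  have hgrow : ∀ s ≥ t₀, ∀ t ≥ s, y t * Real.exp (-(C * t)) ≤ y s * Real.exp (-(C * s)) := by
    have hd : ∀ t, HasDerivAt (fun t => y t * Real.exp (-(C * t)))
        (y' t * Real.exp (-(C * t)) + y t * (Real.exp (-(C * t)) * -(C * 1))) t := fun t =>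
      (hy t).mul (((hasDerivAt_id t).const_mul C).neg.exp)
    have h : AntitoneOn (fun t => y t * Real.exp (-(C * t))) (Set.Ici t₀) :=
      antitoneOn_of_deriv_nonpos (convex_Ici t₀)
      (fun t _ => (hd t).continuousAt.continuousWithinAt)
      (fun t _ => (hd t).differentiableAt.differentiableWithinAt) fun t ht => by
        rw [interior_Ici, Set.mem_Ioi] at ht
        rw [(hd t).deriv]
        nlinarith [mul_nonneg (Real.exp_pos (-(C * t))).le (sub_nonneg.2 (hy' t ht.le))]
    exact fun s hs t ht => h hs (le_trans hs ht : t₀ ≤ t) ht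
  refine ⟨Real.exp C / δ * (Q t₀ * Real.exp (κ * t₀) * Real.exp κ) + 1, ?_, κ, hκ0,
    fun t ht => ?_⟩
  · have := hQ0 t₀ le_rfl
    positivity
  have ht1 : t₀ ≤ t - 1 := by linarith
  obtain ⟨ξ, ⟨hξ1, hξ2⟩, hξ⟩ := exists_hasDerivAt_eq_slope Q Q' (show t - 1 < t by linarith)
    (fun s _ => (hQ s).continuousAt.continuousWithinAt) (fun s _ => hQ s)
  rw [sub_sub_cancel, div_one] at hξ
  have h1 : δ * y ξ ≤ Q (t - 1) := by
    linarith [hQy ξ (by linarith), hQ0 t (by linarith)]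
  have h2 : y t ≤ Real.exp C * y ξ := by
    have h3 := hgrow ξ (by linarith) t hξ2.le
    have h4 : y t = y t * Real.exp (-(C * t)) * Real.exp (C * t) := by
      rw [mul_assoc, ← Real.exp_add, neg_add_cancel, Real.exp_zero, mul_one]
    rw [h4]
    calc y t * Real.exp (-(C * t)) * Real.exp (C * t)
        ≤ y ξ * Real.exp (-(C * ξ)) * Real.exp (C * t) :=
          mul_le_mul_of_nonneg_right h3 (Real.exp_pos _).le
      _ = Real.exp (C * (t - ξ)) * y ξ := by
          rw [mul_assoc, ← Real.exp_add, mul_comm]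
          congr 2
          ring
      _ ≤ Real.exp C * y ξ := by
          refine mul_le_mul_of_nonneg_right (Real.exp_le_exp.2 ?_) (hy0 ξ (by linarith))
          nlinarith
  have h5 : Q (t - 1) ≤ Q t₀ * Real.exp (κ * t₀) * Real.exp κ * Real.exp (-(κ * t)) := by
    have h6 := hdec (t - 1) ht1
    have h7 : Q (t - 1)
        = Q (t - 1) * Real.exp (κ * (t - 1)) * (Real.exp κ * Real.exp (-(κ * t))) := by
      rw [mul_assoc, ← Real.exp_add, ← Real.exp_add]
      ring_nf
      rw [Real.exp_zero, mul_one]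
    rw [h7, mul_assoc (Q t₀ * Real.exp (κ * t₀))]
    exact mul_le_mul_of_nonneg_right h6 (by positivity)
  have h8 : y ξ ≤ Q (t - 1) / δ := by rw [le_div_iff₀ hδ]; linarith
  calc y t ≤ Real.exp C * (Q (t - 1) / δ) :=
        h2.trans (mul_le_mul_of_nonneg_left h8 (Real.exp_pos _).le)
    _ ≤ Real.exp C * (Q t₀ * Real.exp (κ * t₀) * Real.exp κ * Real.exp (-(κ * t)) / δ) := by
        gcongr
    _ = Real.exp C / δ * (Q t₀ * Real.exp (κ * t₀) * Real.exp κ) * Real.exp (-(κ * t)) := by ring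
    _ ≤ _ := by
        gcongr
        linarith

/-- A convergent function with exponentially decaying derivative converges exponentially. -/
theorem norm_sub_le_of_exp_decay {E : Type*} [NormedAddCommGroup E] [NormedSpace ℝ E]
    {f f' : ℝ → E} {l : E} {T K κ : ℝ} (hκ : 0 < κ) (hf : ∀ x, HasDerivAt f (f' x) x)
    (hl : Tendsto f atTop (𝓝 l)) (h : ∀ x ≥ T, ‖f' x‖ ≤ K * Real.exp (-(κ * x))) :
    ∀ x ≥ T, ‖f x - l‖ ≤ K / κ * Real.exp (-(κ * x)) := by
  intro x hx
  have hK : 0 ≤ K := by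
    have := (norm_nonneg _).trans (h T le_rfl)
    exact nonneg_of_mul_nonneg_left this (Real.exp_pos _)
  have key : ∀ s ≥ x, ‖f s - f x‖ ≤ K / κ * Real.exp (-(κ * x)) := by
    intro s hs
    have hB : ∀ t, HasDerivAt (fun t => K / κ * (Real.exp (-(κ * x)) - Real.exp (-(κ * t))))
        (K * Real.exp (-(κ * t))) t := by
      intro t
      have h1 := ((((hasDerivAt_id t).const_mul κ).neg.exp).const_sub
        (Real.exp (-(κ * x)))).const_mul (K / κ)
      refine h1.congr_deriv ?_
      simp only [id, Pi.neg_apply]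
      field_simp
    have h2 := image_norm_le_of_norm_deriv_right_le_deriv_boundary (f := fun t => f t - f x)
      (f' := f') (a := x) (b := s)
      (fun t _ => ((hf t).sub_const (f x)).continuousAt.continuousWithinAt)
      (fun t _ => ((hf t).sub_const (f x)).hasDerivWithinAt) (by simp) hB
      (fun t ht => h t (le_trans hx ht.1)) (Set.right_mem_Icc.2 hs)
    refine h2.trans (mul_le_mul_of_nonneg_left ?_ (by positivity))
    linarith [Real.exp_pos (-(κ * s))]
  have h3 : Tendsto (fun s => ‖f s - f x‖) atTop (𝓝 ‖l - f x‖) := (hl.sub_const (f x)).norm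
  rw [norm_sub_rev]
  exact le_of_tendsto h3 ((eventually_ge_atTop x).mono key)

/-- A trajectory of a perturbed linear equation `x' = M x + o(x)` which converges to zero decays
exponentially if `M` satisfies `M³ + a₂ M² + a₁ M = d` with `a₂ ≥ 0` and `d > 0`. At `λ = i y` the
real part of the polynomial is `-a₂ y² ≠ d`, so this is an algebraic form of hyperbolicity. The
Lyapunov function is the energy obtained by testing the third order equation with `x` and
integrating by parts. -/
theorem exp_decay_of_cubic {E : Type*} [NormedAddCommGroup E] [InnerProductSpace ℝ E]
    (M : E →L[ℝ] E) {a₂ a₁ d : ℝ} (ha₂ : 0 ≤ a₂) (hd : 0 < d)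
    (hM : ∀ x, M (M (M x)) + a₂ • M (M x) + a₁ • M x = d • x) {x N : ℝ → E}
    (hx : ∀ t, HasDerivAt x (M (x t) + N t) t) (hN : N =o[atTop] x)
    (h0 : Tendsto x atTop (𝓝 0)) :
    ∃ K > 0, ∃ κ > 0, ∃ T, ∀ t ≥ T, ‖x t‖ ^ 2 ≤ K * Real.exp (-(κ * t)) := by
  set m := ‖M‖ with hm
  have hm0 : 0 ≤ m := norm_nonneg M
  have b1 : ∀ z, ‖M z‖ ≤ m * ‖z‖ := M.le_opNorm
  have b2 : ∀ z, ‖M (M z)‖ ≤ m ^ 2 * ‖z‖ := fun z => by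
    have := mul_le_mul_of_nonneg_left (b1 z) hm0
    exact (b1 (M z)).trans (this.trans (le_of_eq (by ring)))
  set C₁ := 3 * m ^ 2 + 2 * a₂ * m + |a₁| with hC₁
  have hC₁0 : 0 ≤ C₁ := by positivity
  set ε := d / (2 * (C₁ + 1)) with hε
  have hε0 : 0 < ε := by positivity
  have hCε : C₁ * ε ≤ d / 2 := by
    rw [hε, mul_div_assoc', div_le_div_iff₀ (by positivity) two_pos]
    nlinarith
  obtain ⟨T, hT⟩ := (hN.def hε0).exists_forall_of_atTop
  -- the negative of the energy
  set Q : ℝ → ℝ := fun t => -(⟪x t, M (M (x t))⟫_ℝ - ⟪M (x t), M (x t)⟫_ℝ / 2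
    + a₂ * ⟪x t, M (x t)⟫_ℝ + a₁ / 2 * ⟪x t, x t⟫_ℝ) with hQdef
  have d1 : ∀ t, HasDerivAt (fun t => M (x t)) (M (M (x t) + N t)) t := fun t =>
    M.hasFDerivAt.comp_hasDerivAt t (hx t)
  have d2 : ∀ t, HasDerivAt (fun t => M (M (x t))) (M (M (M (x t) + N t))) t := fun t =>
    M.hasFDerivAt.comp_hasDerivAt t (d1 t)
  have hQ : ∀ t, HasDerivAt Q _ t := fun t =>
    (((((hx t).inner ℝ (d2 t)).sub (((d1 t).inner ℝ (d1 t)).div_const 2)).add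
      (((hx t).inner ℝ (d1 t)).const_mul a₂)).add (((hx t).inner ℝ (hx t)).const_mul (a₁ / 2))).neg
  have hy : ∀ t, HasDerivAt (fun t => ⟪x t, x t⟫_ℝ) _ t := fun t => (hx t).inner ℝ (hx t)
  have hbd : ∀ (u v : E) (k l : ℝ), ‖v‖ ≤ k * l → |⟪u, v⟫_ℝ| ≤ k * (‖u‖ * l) := fun u v k l h => by
    have := mul_le_mul_of_nonneg_left h (norm_nonneg u)
    exact (abs_real_inner_le_norm u v).trans (this.trans (le_of_eq (by ring)))
  have hself : ∀ z : E, ⟪z, z⟫_ℝ = ‖z‖ * ‖z‖ := real_inner_self_eq_norm_mul_norm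
  set c := 2 * m ^ 2 + a₂ * m + |a₁| + 2 * (m + ε) + 1 with hc
  have hbound : ∀ t, |Q t| ≤ c * ⟪x t, x t⟫_ℝ := by
    intro t
    have i1 := abs_le.1 (hbd (x t) (M (M (x t))) _ _ (b2 _))
    have i2 : ⟪M (x t), M (x t)⟫_ℝ ≤ m ^ 2 * (‖x t‖ * ‖x t‖) := by
      rw [hself]
      have := mul_le_mul (b1 (x t)) (b1 (x t)) (norm_nonneg _) (by positivity)
      exact this.trans (le_of_eq (by ring))
    have i2' : 0 ≤ ⟪M (x t), M (x t)⟫_ℝ := real_inner_self_nonneg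
    have i3 := abs_le.1 (hbd (x t) (M (x t)) _ _ (b1 _))
    have i4 := mul_le_mul_of_nonneg_left i3.2 ha₂
    have i5 := mul_le_mul_of_nonneg_left i3.1 ha₂
    have hX : 0 ≤ ‖x t‖ * ‖x t‖ := by positivity
    have i6 := mul_le_mul_of_nonneg_right (le_abs_self a₁) hX
    have i7 := mul_le_mul_of_nonneg_right (neg_abs_le a₁) hX
    have i8 : 0 ≤ |a₁| * (‖x t‖ * ‖x t‖) := by positivity
    have i9 : 0 ≤ m ^ 2 * (‖x t‖ * ‖x t‖) := by positivity
    have i10 : 0 ≤ m * (‖x t‖ * ‖x t‖) := by positivity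
    have i11 : 0 ≤ ε * (‖x t‖ * ‖x t‖) := by positivity
    rw [hQdef, hc, abs_le]
    simp only [hself (x t)]
    constructor <;> linarith
  have hXlim : Tendsto (fun t => c * ⟪x t, x t⟫_ℝ) atTop (𝓝 0) := by
    have := (h0.inner (𝕜 := ℝ) h0).const_mul c
    simpa using this
  have hlim : Tendsto Q atTop (𝓝 0) := squeeze_zero_norm hbound hXlim
  suffices h : ∃ K > 0, ∃ κ > 0, ∀ t ≥ T + 1, ⟪x t, x t⟫_ℝ ≤ K * Real.exp (-(κ * t)) by
    obtain ⟨K, hK, κ, hκ, hfin⟩ := h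
    exact ⟨K, hK, κ, hκ, T + 1, fun t ht => by
      rw [← real_inner_self_eq_norm_sq]; exact hfin t ht⟩
  refine exp_decay_of_lyapunov (half_pos hd) (show 0 < c by positivity) hQ hy
    ?_ (fun t _ => (le_abs_self _).trans (hbound t)) ?_ (fun t _ => real_inner_self_nonneg) hlim
  · intro t ht
    have hcub := congrArg (fun z => ⟪x t, z⟫_ℝ) (hM (x t))
    simp only [inner_add_right, real_inner_smul_right] at hcub
    have hNt : ‖N t‖ ≤ ε * ‖x t‖ := hT t ht
    have j1 := abs_le.1 (hbd (x t) (M (M (N t))) _ _ (b2 _))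
    have j2 := abs_le.1 (hbd (N t) (M (M (x t))) _ _ (b2 _))
    have j3 := abs_le.1 (hbd (M (x t)) (M (N t)) _ _ (b1 _))
    have j4 := abs_le.1 (hbd (x t) (M (N t)) _ _ (b1 _))
    have j5 := abs_le.1 (hbd (N t) (M (x t)) _ _ (b1 _))
    have j6 := hbd (x t) (N t) 1 ‖N t‖ (by rw [one_mul])
    have j7 : m * (‖M (x t)‖ * ‖N t‖) ≤ m ^ 2 * (‖x t‖ * ‖N t‖) := by
      have := mul_le_mul_of_nonneg_left (mul_le_mul_of_nonneg_right (b1 (x t)) (norm_nonneg (N t)))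
        hm0
      exact this.trans (le_of_eq (by ring))
    have j8 : C₁ * (‖x t‖ * ‖N t‖) ≤ d / 2 * (‖x t‖ * ‖x t‖) := by
      have k1 := mul_le_mul_of_nonneg_left (mul_le_mul_of_nonneg_left hNt (norm_nonneg (x t))) hC₁0
      have k2 := mul_le_mul_of_nonneg_right hCε (mul_self_nonneg ‖x t‖)
      linarith
    have j9 : |a₁ * ⟪x t, N t⟫_ℝ| ≤ |a₁| * (‖x t‖ * ‖N t‖) := by
      rw [abs_mul]
      rw [one_mul] at j6
      exact mul_le_mul_of_nonneg_left j6 (abs_nonneg _)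
    have j10 := abs_le.1 j9
    have j11 := mul_le_mul_of_nonneg_left j4.1 ha₂
    have j12 := mul_le_mul_of_nonneg_left j5.1 ha₂
    have j13 : 0 ≤ a₂ * ⟪M (x t), M (x t)⟫_ℝ := mul_nonneg ha₂ real_inner_self_nonneg
    rw [hC₁] at j8
    rw [mul_comm ‖N t‖] at j2 j5 j12
    simp only [map_add, inner_add_right, inner_add_left, real_inner_comm (M (x t)) (M (N t)),
      real_inner_comm (M (x t)) (M (M (x t))), real_inner_comm (x t) (N t),
      real_inner_comm (x t) (M (x t)), hself (x t)] at hcub j13 j3 j10 ⊢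
    linarith
  · intro t ht
    have hNt : ‖N t‖ ≤ ε * ‖x t‖ := hT t ht
    have j3 := (abs_le.1 (hbd (x t) (M (x t)) _ _ (b1 _))).2
    have j6 := (abs_le.1 (hbd (x t) (N t) _ _ hNt)).2
    have hX : 0 ≤ ‖x t‖ * ‖x t‖ := by positivity
    have k1 : 0 ≤ m ^ 2 * (‖x t‖ * ‖x t‖) := by positivity
    have k2 : 0 ≤ a₂ * m * (‖x t‖ * ‖x t‖) := by positivity
    have k3 : 0 ≤ |a₁| * (‖x t‖ * ‖x t‖) := by positivity
    simp only [inner_add_right, inner_add_left, real_inner_comm (x t) (N t),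
      real_inner_comm (x t) (M (x t)), hself (x t), hc]
    linarith

end ExponentialDecay

/-! ### The profile equation -/

section ProfileEquation

variable {α₁ α₂ c freq : ℝ} {g₁ g₂ : ℝ → ℝ} {v : ℝ → Plane ℝ} {vinf : Plane ℝ}

/-- The reaction term `S_ω u + f(u)` of the profile equation in the corotating frame. -/
noncomputable def reaction (g₁ g₂ : ℝ → ℝ) (freq : ℝ) (u : Plane ℝ) : Plane ℝ :=
  actL ℝ (rotGen freq) u + nonlin g₁ g₂ u

theorem rot_zero : rot 0 = 1 := by
  ext i j
  fin_cases i <;> fin_cases j <;> simp [rot]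

theorem hasDerivAt_actL_rot (freq : ℝ) :
    HasDerivAt (fun t : ℝ => actL ℝ (rot (-(freq * t)))) (actL ℝ (rotGen (-freq))) 0 := by
  have h : HasDerivAt (fun t : ℝ => -(freq * t)) (-freq) 0 :=
    ((hasDerivAt_id (0 : ℝ)).const_mul freq).neg.congr_deriv (by rw [mul_one])
  have hc : HasDerivAt (fun t : ℝ => Real.cos (-(freq * t))) 0 0 := by
    simpa using h.cos
  have hs : HasDerivAt (fun t : ℝ => Real.sin (-(freq * t))) (-freq) 0 := by
    simpa using h.sin
  refine hasDerivAt_actL fun i j => ?_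
  fin_cases i <;> fin_cases j
  · exact hc
  · exact hs.neg
  · exact hs
  · exact hc

theorem hasDerivAt_clm_apply {E : Type*} [NormedAddCommGroup E] [NormedSpace ℝ E]
    {b : ℝ → E →L[ℝ] E} {b' : E →L[ℝ] E} {f : ℝ → E} {f' : E} {t : ℝ} (hb : HasDerivAt b b' t)
    (hf : HasDerivAt f f' t) : HasDerivAt (fun t => b t (f t)) (b' (f t) + b t f') t :=
  hb.clm_apply hf

/-- The profile of a traveling oscillating front solves the stationary equation in the comoving and
corotating frame. -/
theorem IsFront.profile_equation (h : IsFront α₁ α₂ g₁ g₂ v c freq vinf) (x : ℝ) :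
    actL ℝ (mulMat α₁ α₂) (iteratedDeriv 2 v x) + c • deriv v x
      + reaction g₁ g₂ freq (v x) = 0 := by
  obtain ⟨hC2, hpde, -⟩ := h
  have e := hpde x 0 le_rfl
  have h0 : ∀ z : Plane ℝ, act ℝ 1 z = z := actL_one
  simp only [mul_zero, sub_zero, neg_zero, rot_zero, h0] at e
  have hsh : HasDerivAt (fun τ => v (x - c * τ)) (-c • deriv v x) 0 := by
    have h1 : HasDerivAt v (deriv v x) (x - c * 0) := by
      rw [mul_zero, sub_zero]
      exact (hC2.differentiable (by norm_num) x).hasDerivAt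
    have h2 : HasDerivAt (fun τ : ℝ => x - c * τ) (-c) 0 := by
      simpa using ((hasDerivAt_id (0 : ℝ)).const_mul c).const_sub x
    exact h1.scomp 0 h2
  have hd := hasDerivAt_clm_apply (hasDerivAt_actL_rot freq) hsh
  have e' := hd.deriv.symm.trans e
  rw [mul_zero, sub_zero, mul_zero, neg_zero, rot_zero, actL_one] at e'
  have hneg : actL ℝ (rotGen (-freq)) (v x) = -actL ℝ (rotGen freq) (v x) := by
    rw [show rotGen (-freq) = -rotGen freq by
      ext i j; fin_cases i <;> fin_cases j <;> simp [rotGen], map_neg, _root_.neg_apply]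
  rw [hneg, neg_smul] at e'
  rw [reaction, actL_apply (mulMat α₁ α₂)]
  have e2 : act ℝ (mulMat α₁ α₂) (iteratedDeriv 2 v x)
      = -(actL ℝ (rotGen freq) (v x)) + -(c • deriv v x) - nonlin g₁ g₂ (v x) :=
    eq_sub_of_add_eq e'.symm
  rw [e2]
  abel

theorem contDiff_reaction (h₁ : ContDiff ℝ 3 g₁) (h₂ : ContDiff ℝ 3 g₂) :
    ContDiff ℝ 3 (reaction g₁ g₂ freq) :=
  (actL ℝ (rotGen freq)).contDiff.add (contDiff_nonlin h₁ h₂)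

theorem exists_reaction_bound (freq : ℝ) (h₁ : ContDiff ℝ 3 g₁) (h₂ : ContDiff ℝ 3 g₂) (B : ℝ) :
    ∃ L ≥ 0, (∀ u, ‖u‖ ≤ B → ‖fderiv ℝ (reaction g₁ g₂ freq) u‖ ≤ L) ∧
      ∀ u w, ‖u‖ ≤ B → ‖w‖ ≤ B →
        ‖reaction g₁ g₂ freq u - reaction g₁ g₂ freq w‖ ≤ L * ‖u - w‖ := by
  have hF := contDiff_reaction (freq := freq) h₁ h₂
  obtain ⟨L, hL⟩ := (isCompact_closedBall (0 : Plane ℝ) B).exists_bound_of_continuousOn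
    (hF.continuous_fderiv (by norm_num)).continuousOn
  have hL' : ∀ u, ‖u‖ ≤ B → ‖fderiv ℝ (reaction g₁ g₂ freq) u‖ ≤ max 0 L := fun u hu =>
    (hL u (by simpa using hu)).trans (le_max_right _ _)
  refine ⟨max 0 L, le_max_left _ _, hL', fun u w hu hw => ?_⟩
  exact (convex_closedBall (0 : Plane ℝ) B).norm_image_sub_le_of_norm_fderiv_le (𝕜 := ℝ)
    (fun z _ => hF.differentiable (by norm_num) z) (fun z hz => hL' z (by simpa using hz))
    (by simpa using hw) (by simpa using hu)

theorem norm_le_norm_actL_mulMat (α₁ α₂ : ℝ) (z : Plane ℝ) :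
    α₁ * ‖z‖ ≤ ‖actL ℝ (mulMat α₁ α₂) z‖ := by
  rcases (norm_nonneg z).eq_or_lt with h | h
  · rw [← h, mul_zero]; exact norm_nonneg _
  · have h1 := (RCLike.re_le_norm (K := ℝ) _).trans
      (norm_inner_le_norm (𝕜 := ℝ) z (actL ℝ (mulMat α₁ α₂) z))
    rw [re_inner_mulMat] at h1
    nlinarith

/-- The second derivative of the profile is differentiable, by the profile equation. -/
theorem IsFront.exists_hasDerivAt (h : IsFront α₁ α₂ g₁ g₂ v c freq vinf) (hα : 0 < α₁)
    (h₁ : ContDiff ℝ 3 g₁) (h₂ : ContDiff ℝ 3 g₂) (x : ℝ) :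
    ∃ w, HasDerivAt (iteratedDeriv 2 v) w x ∧ actL ℝ (mulMat α₁ α₂) w
      = -(c • iteratedDeriv 2 v x + fderiv ℝ (reaction g₁ g₂ freq) (v x) (deriv v x)) := by
  have hinj : Function.Injective (actL ℝ (mulMat α₁ α₂)) := by
    refine (injective_iff_map_eq_zero _).2 fun z hz => ?_
    have := norm_le_norm_actL_mulMat α₁ α₂ z
    rw [hz, norm_zero] at this
    exact norm_le_zero_iff.1 (nonpos_of_mul_nonpos_right this hα)
  set Ae : Plane ℝ ≃L[ℝ] Plane ℝ := (LinearEquiv.ofInjectiveEndo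
    (actL ℝ (mulMat α₁ α₂)).toLinearMap hinj).toContinuousLinearEquiv with hAe
  have hA : ∀ z, Ae z = actL ℝ (mulMat α₁ α₂) z := fun z => rfl
  have hv : HasDerivAt v (deriv v x) x := (h.1.differentiable (by norm_num) x).hasDerivAt
  have hv' : HasDerivAt (deriv v) (iteratedDeriv 2 v x) x := by
    rw [iteratedDeriv_succ, iteratedDeriv_one]
    have hd : ContDiff ℝ 1 (deriv v) := (contDiff_succ_iff_deriv (n := 1).1 h.1).2.2
    exact (hd.differentiable (by norm_num) x).hasDerivAt
  have e : iteratedDeriv 2 v = fun y => Ae.symm (-(c • deriv v y + reaction g₁ g₂ freq (v y))) := by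
    funext y
    rw [ContinuousLinearEquiv.eq_symm_apply, hA]
    have := h.profile_equation y
    rw [add_assoc] at this
    exact eq_neg_of_add_eq_zero_left this
  have hF : HasDerivAt (fun y => reaction g₁ g₂ freq (v y))
      (fderiv ℝ (reaction g₁ g₂ freq) (v x) (deriv v x)) x :=
    (((contDiff_reaction h₁ h₂).differentiable (by norm_num) (v x)).hasFDerivAt).comp_hasDerivAt
      x hv
  refine ⟨Ae.symm (-(c • iteratedDeriv 2 v x + fderiv ℝ (reaction g₁ g₂ freq) (v x) (deriv v x))),
    ?_, ?_⟩
  · have h3 := (Ae.symm : Plane ℝ →L[ℝ] Plane ℝ).hasFDerivAt.comp_hasDerivAt x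
      ((hv'.const_smul c).add hF).neg
    refine h3.congr_of_eventuallyEq (.of_forall fun y => ?_)
    rw [e]
    rfl
  · rw [← hA, ContinuousLinearEquiv.apply_symm_apply]

end ProfileEquation

/-! ### Decay of the profile at the stable rest state -/

section DecayAtBot

theorem le_sqrt_mul_exp {x K κ t : ℝ} (hK : 0 ≤ K) (h : x ^ 2 ≤ K * Real.exp (-(κ * t))) :
    x ≤ Real.sqrt K * Real.exp (-(κ / 2 * t)) := by
  refine (Real.le_sqrt_of_sq_le h).trans (le_of_eq ?_)
  rw [Real.sqrt_mul hK, ← Real.exp_half]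
  congr 2
  ring

theorem inner_reaction (g₁ g₂ : ℝ → ℝ) (freq : ℝ) (u : Plane ℝ) :
    ⟪u, reaction g₁ g₂ freq u⟫_ℝ = g₁ (‖u‖ ^ 2) * ‖u‖ ^ 2 := by
  have h1 : ⟪u, actL ℝ (rotGen freq) u⟫_ℝ = 0 := re_inner_rotGen freq u
  have h2 : ⟪u, nonlin g₁ g₂ u⟫_ℝ = g₁ (‖u‖ ^ 2) * ‖u‖ ^ 2 := re_inner_mulMat _ _ u
  rw [reaction, inner_add_right, h1, h2, zero_add]

variable {α₁ α₂ c freq : ℝ} {g₁ g₂ : ℝ → ℝ} {v v' v'' : ℝ → Plane ℝ}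

/-- Exponential decay at the stable rest state `0`, by the Lyapunov function
`⟨v, A v'⟩ + c |v|² / 2`. -/
theorem exp_decay_atBot (hα : 0 < α₁) (hc : 0 < c) (hg₁ : Continuous g₁) (hg0 : g₁ 0 < 0)
    (hv : ∀ x, HasDerivAt v (v' x) x) (hv' : ∀ x, HasDerivAt v' (v'' x) x)
    (heq : ∀ x, actL ℝ (mulMat α₁ α₂) (v'' x) + c • v' x + reaction g₁ g₂ freq (v x) = 0)
    {B D : ℝ} (hB : ∀ x, ‖v' x‖ ≤ B) (hD : 0 ≤ D) (hv'' : ∀ x, ‖v'' x‖ ≤ D * (‖v x‖ + ‖v' x‖))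
    (hlim : Tendsto v atBot (𝓝 0)) :
    ∃ K > 0, ∃ κ > 0, ∃ T, ∀ t ≥ T, ‖v (-t)‖ + ‖v' (-t)‖ ≤ K * Real.exp (-(κ * t)) := by
  set A := actL ℝ (mulMat α₁ α₂) with hA
  have hg : ∀ᶠ x in atBot, g₁ (‖v x‖ ^ 2) < g₁ 0 / 2 := by
    have h1 : Tendsto (fun x => g₁ (‖v x‖ ^ 2)) atBot (𝓝 (g₁ 0)) := by
      have h2 := (hg₁.tendsto (‖(0 : Plane ℝ)‖ ^ 2)).comp (hlim.norm.pow 2)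
      rwa [norm_zero, zero_pow two_ne_zero] at h2
    exact h1.eventually (gt_mem_nhds (by linarith))
  obtain ⟨S, hS⟩ := hg.exists_forall_of_atBot
  set δ := min α₁ (-(g₁ 0) / 2) with hδ
  have hδ0 : 0 < δ := lt_min hα (by linarith)
  set Q : ℝ → ℝ := fun x => ⟪v x, A (v' x)⟫_ℝ + c / 2 * ⟪v x, v x⟫_ℝ with hQdef
  set y : ℝ → ℝ := fun x => ⟪v x, v x⟫_ℝ + ⟪v' x, v' x⟫_ℝ with hydef
  have hAd : ∀ x, HasDerivAt (fun x => A (v' x)) (A (v'' x)) x := fun x =>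
    A.hasFDerivAt.comp_hasDerivAt x (hv' x)
  have hQd : ∀ x, HasDerivAt Q (α₁ * ‖v' x‖ ^ 2 - g₁ (‖v x‖ ^ 2) * ‖v x‖ ^ 2) x := by
    intro x
    refine (((hv x).inner ℝ (hAd x)).add (((hv x).inner ℝ (hv x)).const_mul (c / 2))).congr_deriv ?_
    have h1 : A (v'' x) = -(c • v' x + reaction g₁ g₂ freq (v x)) := by
      have := heq x
      rw [add_assoc] at this
      exact eq_neg_of_add_eq_zero_left this
    have h2 : ⟪v' x, A (v' x)⟫_ℝ = α₁ * ‖v' x‖ ^ 2 := re_inner_mulMat α₁ α₂ (v' x)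
    rw [h1, inner_neg_right, inner_add_right, real_inner_smul_right, inner_reaction, h2,
      real_inner_comm (v x) (v' x)]
    ring
  have hyd : ∀ x, HasDerivAt y (2 * ⟪v x, v' x⟫_ℝ + 2 * ⟪v' x, v'' x⟫_ℝ) x := by
    intro x
    refine (((hv x).inner ℝ (hv x)).add ((hv' x).inner ℝ (hv' x))).congr_deriv ?_
    rw [real_inner_comm (v x) (v' x), real_inner_comm (v' x) (v'' x)]
    ring
  have hyn : ∀ x, y x = ‖v x‖ ^ 2 + ‖v' x‖ ^ 2 := fun x => by
    simp only [hydef, real_inner_self_eq_norm_sq]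
  have hNA : 0 ≤ ‖A‖ := norm_nonneg A
  have hQle : ∀ x, |Q x| ≤ ‖A‖ * (‖v x‖ * ‖v' x‖) + c / 2 * ‖v x‖ ^ 2 := by
    intro x
    have h1 : |⟪v x, A (v' x)⟫_ℝ| ≤ ‖A‖ * (‖v x‖ * ‖v' x‖) := by
      have := mul_le_mul_of_nonneg_left (A.le_opNorm (v' x)) (norm_nonneg (v x))
      exact (abs_real_inner_le_norm _ _).trans (this.trans (le_of_eq (by ring)))
    refine (abs_add_le _ _).trans (add_le_add h1 (le_of_eq ?_))
    rw [real_inner_self_eq_norm_sq, abs_of_nonneg (by positivity)]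
  have hQlim : Tendsto Q atBot (𝓝 0) := by
    have hz : Tendsto (fun x => ‖A‖ * (‖v x‖ * B) + c / 2 * ‖v x‖ ^ 2) atBot (𝓝 0) := by
      have h1 := hlim.norm
      rw [norm_zero] at h1
      have h2 := ((h1.mul_const B).const_mul ‖A‖).add ((h1.pow 2).const_mul (c / 2))
      simpa using h2
    refine squeeze_zero_norm (fun x => (hQle x).trans ?_) hz
    have := mul_le_mul_of_nonneg_left (mul_le_mul_of_nonneg_left (hB x) (norm_nonneg (v x))) hNA
    linarith
  have hneg : ∀ {f : ℝ → ℝ} {f' : ℝ → ℝ}, (∀ x, HasDerivAt f (f' x) x) →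
      ∀ t, HasDerivAt (fun t => f (-t)) (-f' (-t)) t := fun hf t =>
    ((hf (-t)).comp t (hasDerivAt_neg t)).congr_deriv (by ring)
  have h2ab : ∀ x, ‖v x‖ * ‖v' x‖ ≤ (‖v x‖ ^ 2 + ‖v' x‖ ^ 2) / 2 := fun x => by
    linarith [two_mul_le_add_sq ‖v x‖ ‖v' x‖]
  obtain ⟨K, hK, κ, hκ, hfin⟩ := exp_decay_of_lyapunov (t₀ := -S) hδ0
    (show 0 < 1 + 3 * D + ‖A‖ + c by positivity) (hneg hQd) (hneg hyd)
    (fun t ht => by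
      have h1 := hS (-t) (by linarith)
      have h2 : δ ≤ α₁ := min_le_left _ _
      have h3 : δ ≤ -(g₁ 0) / 2 := min_le_right _ _
      rw [hyn]
      nlinarith [sq_nonneg ‖v (-t)‖, sq_nonneg ‖v' (-t)‖,
        mul_nonneg (sub_nonneg.2 h2) (sq_nonneg ‖v' (-t)‖),
        mul_nonneg (show 0 ≤ -g₁ (‖v (-t)‖ ^ 2) - δ by linarith) (sq_nonneg ‖v (-t)‖)])
    (fun t _ => by
      refine (le_abs_self _).trans ((hQle (-t)).trans ?_)
      rw [hyn]
      have h1 := mul_le_mul_of_nonneg_left (h2ab (-t)) hNA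
      have h2 : 0 ≤ ‖v (-t)‖ ^ 2 := sq_nonneg _
      have h3 : 0 ≤ ‖v' (-t)‖ ^ 2 := sq_nonneg _
      have h4 := mul_nonneg hNA h2
      have h5 := mul_nonneg hNA h3
      have h6 := mul_nonneg hD h2
      have h7 := mul_nonneg hD h3
      have h8 := mul_nonneg hc.le h2
      have h9 := mul_nonneg hc.le h3
      linarith)
    (fun t _ => by
      rw [hyn]
      have i1 := (abs_le.1 (abs_real_inner_le_norm (v (-t)) (v' (-t)))).1
      have i2 := (abs_le.1 (abs_real_inner_le_norm (v' (-t)) (v'' (-t)))).1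
      have i3 := mul_le_mul_of_nonneg_left (hv'' (-t)) (norm_nonneg (v' (-t)))
      have i4 := mul_le_mul_of_nonneg_left (h2ab (-t)) hD
      have h2 : 0 ≤ ‖v (-t)‖ ^ 2 := sq_nonneg _
      have h3 : 0 ≤ ‖v' (-t)‖ ^ 2 := sq_nonneg _
      have h4 := mul_nonneg hNA h2
      have h5 := mul_nonneg hNA h3
      have h6 := mul_nonneg hD h2
      have h7 := mul_nonneg hD h3
      have h8 := mul_nonneg hc.le h2
      have h9 := mul_nonneg hc.le h3
      linarith [h2ab (-t)])
    (fun t _ => by rw [hyn]; positivity) (hQlim.comp tendsto_neg_atTop_atBot)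
  refine ⟨Real.sqrt (2 * K), Real.sqrt_pos.2 (by positivity), κ / 2, half_pos hκ, -S + 1,
    fun t ht => le_sqrt_mul_exp (by positivity) ?_⟩
  have h1 := hfin t ht
  rw [hyn] at h1
  nlinarith [h2ab (-t)]

end DecayAtBot

/-! ### Decay of the profile at the periodic rest state -/

section DecayAtTop

theorem hasDerivAt_of_coord {n : ℕ} {f : ℝ → EuclideanSpace ℝ (Fin n)}
    {f' : EuclideanSpace ℝ (Fin n)} {t : ℝ} (h : ∀ i, HasDerivAt (fun t => f t i) (f' i) t) :
    HasDerivAt f f' t := by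
  rw [hasDerivAt_iff_hasFDerivAt, ← hasFDerivWithinAt_univ, hasFDerivWithinAt_euclidean]
  intro i
  refine (h i).hasFDerivAt.hasFDerivWithinAt.congr_fderiv ?_
  ext
  simp

theorem hasDerivAt_coord {n : ℕ} {f : ℝ → EuclideanSpace ℝ (Fin n)}
    {f' : EuclideanSpace ℝ (Fin n)} {t : ℝ} (h : HasDerivAt f f' t) (i : Fin n) :
    HasDerivAt (fun t => f t i) (f' i) t :=
  (EuclideanSpace.proj (𝕜 := ℝ) i).hasFDerivAt.comp_hasDerivAt t h

/-- The linear map of `ℝ³` with first row `(0, 2, 0)`. -/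
noncomputable def modulusMap (m₁ m₂ m₃ n₁ n₂ n₃ : ℝ) :
    EuclideanSpace ℝ (Fin 3) →L[ℝ] EuclideanSpace ℝ (Fin 3) :=
  LinearMap.toContinuousLinearMap
    (Matrix.toEuclideanLin !![0, 2, 0; m₁, m₂, m₃; n₁, n₂, n₃])

theorem modulusMap_apply (m₁ m₂ m₃ n₁ n₂ n₃ : ℝ) (x : EuclideanSpace ℝ (Fin 3)) :
    modulusMap m₁ m₂ m₃ n₁ n₂ n₃ x
      = !₂[2 * x 1, m₁ * x 0 + m₂ * x 1 + m₃ * x 2, n₁ * x 0 + n₂ * x 1 + n₃ * x 2] := by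
  ext i
  fin_cases i <;> simp [modulusMap, Matrix.toLpLin_apply, dotProduct,
    Fin.sum_univ_three]

/-- The Cayley–Hamilton theorem for `modulusMap`. -/
theorem modulusMap_cubic (m₁ m₂ m₃ n₁ n₂ n₃ : ℝ) (x : EuclideanSpace ℝ (Fin 3)) :
    let M := modulusMap m₁ m₂ m₃ n₁ n₂ n₃
    M (M (M x)) + (-(m₂ + n₃)) • M (M x) + (-(2 * m₁) + (m₂ * n₃ - m₃ * n₂)) • M x
      = (-(2 * (m₁ * n₃ - m₃ * n₁))) • x := by
  intro M
  ext i
  fin_cases i <;> simp [M, modulusMap_apply] <;> ring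

theorem norm_vec_three_sq (a b c : ℝ) :
    ‖(!₂[a, b, c] : EuclideanSpace ℝ (Fin 3))‖ ^ 2 = a ^ 2 + b ^ 2 + c ^ 2 := by
  simp [EuclideanSpace.norm_sq_eq, Fin.sum_univ_three]

theorem norm_vec_three_le (a b c : ℝ) :
    ‖(!₂[a, b, c] : EuclideanSpace ℝ (Fin 3))‖ ≤ |a| + |b| + |c| := by
  refine (pow_le_pow_iff_left₀ (norm_nonneg _) (by positivity) two_ne_zero).1 ?_
  rw [norm_vec_three_sq, ← sq_abs a, ← sq_abs b, ← sq_abs c]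
  nlinarith [abs_nonneg a, abs_nonneg b, abs_nonneg c, mul_nonneg (abs_nonneg a) (abs_nonneg b),
    mul_nonneg (abs_nonneg a) (abs_nonneg c), mul_nonneg (abs_nonneg b) (abs_nonneg c)]

theorem reaction_coord (g₁ g₂ : ℝ → ℝ) (freq : ℝ) (u : Plane ℝ) :
    reaction g₁ g₂ freq u 0 = g₁ (‖u‖ ^ 2) * u 0 - (freq + g₂ (‖u‖ ^ 2)) * u 1 ∧
      reaction g₁ g₂ freq u 1 = (freq + g₂ (‖u‖ ^ 2)) * u 0 + g₁ (‖u‖ ^ 2) * u 1 := by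
  constructor
  · rw [reaction, PiLp.add_apply, nonlin_zero_coord, actL_apply, act_coord]
    simp [rotGen]
    ring
  · rw [reaction, PiLp.add_apply, nonlin_one_coord, actL_apply, act_coord]
    simp [rotGen]
    ring

variable {α₁ α₂ c freq : ℝ} {g₁ g₂ : ℝ → ℝ} {v v' v'' : ℝ → Plane ℝ} {vinf : Plane ℝ}

/-- Exponential decay at the rest state `v_∞`. The rest states form a circle, so `v_∞` is not
hyperbolic; the three rotation invariant quantities `|v|² - |v_∞|²`, `⟨v, v'⟩` and `v ∧ v'` satisfy
a system of their own, whose linearization at zero is hyperbolic. -/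
theorem exp_decay_atTop (hα : 0 < α₁) (hc : 0 < c) (hg₁ : Differentiable ℝ g₁)
    (hg₂ : Differentiable ℝ g₂) (hv : ∀ x, HasDerivAt v (v' x) x)
    (hv' : ∀ x, HasDerivAt v' (v'' x) x)
    (heq : ∀ x, actL ℝ (mulMat α₁ α₂) (v'' x) + c • v' x + reaction g₁ g₂ freq (v x) = 0)
    (hlim : Tendsto v atTop (𝓝 vinf)) (hlim' : Tendsto v' atTop (𝓝 0))
    (hF : reaction g₁ g₂ freq vinf = 0) (hne : vinf ≠ 0) (hg' : deriv g₁ (‖vinf‖ ^ 2) < 0) :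
    ∃ K > 0, ∃ κ > 0, ∃ T, ∀ t ≥ T, ‖v t - vinf‖ + ‖v' t‖ ≤ K * Real.exp (-(κ * t)) := by
  set e := ‖vinf‖ ^ 2 with he
  have he0 : 0 < e := by have := norm_pos_iff.2 hne; positivity
  have hes : e = vinf 0 ^ 2 + vinf 1 ^ 2 := by
    rw [he, plane_norm_sq, Real.norm_eq_abs, Real.norm_eq_abs, sq_abs, sq_abs]
  obtain ⟨F0, F1⟩ := reaction_coord g₁ g₂ freq vinf
  rw [hF, PiLp.zero_apply] at F0 F1
  -- at the rest state `v_∞ ≠ 0`, real and imaginary part of the reaction rate vanish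
  have hg1e : g₁ e = 0 := by
    have h : g₁ e * e = 0 := by
      rw [← he] at F0 F1
      linear_combination (-vinf 0) * F0 - vinf 1 * F1 + g₁ e * hes
    exact (mul_eq_zero.1 h).resolve_right he0.ne'
  have hg2e : freq + g₂ e = 0 := by
    have h : (freq + g₂ e) * e = 0 := by
      rw [← he] at F0 F1
      linear_combination vinf 1 * F0 - vinf 0 * F1 + (freq + g₂ e) * hes
    exact (mul_eq_zero.1 h).resolve_right he0.ne'
  set γ₁ := deriv g₁ e with hγ₁
  set γ₂ := deriv g₂ e with hγ₂
  -- the nonlinear terms, as functions of `p = |v|² - |v_∞|²`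
  set G₁ : ℝ → ℝ := fun p => g₁ (e + p) * (e + p) with hG₁
  set G₂ : ℝ → ℝ := fun p => (freq + g₂ (e + p)) * (e + p) with hG₂
  have hsh : HasDerivAt (fun p : ℝ => e + p) 1 0 := (hasDerivAt_id (0 : ℝ)).const_add e
  have dG₁ : HasDerivAt G₁ (γ₁ * e) 0 := by
    have h1 : HasDerivAt g₁ γ₁ (e + 0) := by rw [add_zero]; exact (hg₁ e).hasDerivAt
    refine ((h1.comp 0 hsh).mul hsh).congr_deriv ?_
    simp only [Function.comp, add_zero, hg1e]
    ring
  have dG₂ : HasDerivAt G₂ (γ₂ * e) 0 := by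
    have h1 : HasDerivAt g₂ γ₂ (e + 0) := by rw [add_zero]; exact (hg₂ e).hasDerivAt
    refine (((h1.comp 0 hsh).const_add freq).mul hsh).congr_deriv ?_
    simp only [Function.comp, add_zero, hg2e]
    ring
  set n := α₁ ^ 2 + α₂ ^ 2 with hn
  have hn0 : 0 < n := by positivity
  set p : ℝ → ℝ := fun t => v t 0 ^ 2 + v t 1 ^ 2 - e with hp
  set a : ℝ → ℝ := fun t => v t 0 * v' t 0 + v t 1 * v' t 1 with ha
  set b : ℝ → ℝ := fun t => v t 0 * v' t 1 - v t 1 * v' t 0 with hb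
  set r₁ : ℝ → ℝ := fun t => G₁ (p t) - γ₁ * e * p t with hr₁
  set r₂ : ℝ → ℝ := fun t => G₂ (p t) - γ₂ * e * p t with hr₂
  set x : ℝ → EuclideanSpace ℝ (Fin 3) := fun t => !₂[p t, a t, b t] with hx
  set n₁ : ℝ → ℝ := fun t => ‖v' t‖ ^ 2 - (α₁ * r₁ t + α₂ * r₂ t) / n with hn₁
  set n₂ : ℝ → ℝ := fun t => -((α₁ * r₂ t - α₂ * r₁ t) / n) with hn₂
  set N : ℝ → EuclideanSpace ℝ (Fin 3) := fun t => !₂[0, n₁ t, n₂ t] with hN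
  set M := modulusMap (-((α₁ * γ₁ + α₂ * γ₂) * e / n)) (-(c * α₁ / n)) (-(c * α₂ / n))
    (-((α₁ * γ₂ - α₂ * γ₁) * e / n)) (c * α₂ / n) (-(c * α₁ / n)) with hM
  have hns : ∀ z : Plane ℝ, ‖z‖ ^ 2 = z 0 ^ 2 + z 1 ^ 2 := fun z => by
    rw [plane_norm_sq, Real.norm_eq_abs, Real.norm_eq_abs, sq_abs, sq_abs]
  have hde : ∀ t, HasDerivAt x (M (x t) + N t) t := by
    intro t
    have c0 := hasDerivAt_coord (hv t) 0
    have c1 := hasDerivAt_coord (hv t) 1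
    have c0' := hasDerivAt_coord (hv' t) 0
    have c1' := hasDerivAt_coord (hv' t) 1
    -- the real and imaginary part of the profile equation, multiplied by the conjugate of `v`
    obtain ⟨R0, R1⟩ := reaction_coord g₁ g₂ freq (v t)
    have q0 := congrArg (fun z : Plane ℝ => z 0) (heq t)
    have q1 := congrArg (fun z : Plane ℝ => z 1) (heq t)
    have hP : ‖v t‖ ^ 2 = e + p t := by rw [hns, hp]; ring
    simp only [PiLp.add_apply, PiLp.smul_apply, PiLp.zero_apply, smul_eq_mul, R0, R1, actL_apply,
      act_coord, hP] at q0 q1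
    simp [mulMat] at q0 q1
    have hA : v t 0 * v'' t 0 + v t 1 * v'' t 1
        = (α₁ * (-(c * a t) - G₁ (p t)) + α₂ * (-(c * b t) - G₂ (p t))) / n := by
      rw [eq_div_iff hn0.ne']
      simp only [hG₁, hG₂, ha, hb]
      rw [show e + p t = v t 0 ^ 2 + v t 1 ^ 2 by rw [hp]; ring] at q0 q1 ⊢
      linear_combination (α₁ * v t 0 - α₂ * v t 1) * q0 + (α₁ * v t 1 + α₂ * v t 0) * q1
    have hB : v t 0 * v'' t 1 - v t 1 * v'' t 0
        = (α₁ * (-(c * b t) - G₂ (p t)) - α₂ * (-(c * a t) - G₁ (p t))) / n := by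
      rw [eq_div_iff hn0.ne']
      simp only [hG₁, hG₂, ha, hb]
      rw [show e + p t = v t 0 ^ 2 + v t 1 ^ 2 by rw [hp]; ring] at q0 q1 ⊢
      linear_combination (-α₁ * v t 1 - α₂ * v t 0) * q0 + (α₁ * v t 0 - α₂ * v t 1) * q1
    refine hasDerivAt_of_coord fun i => ?_
    fin_cases i
    · refine (((c0.pow 2).add (c1.pow 2)).sub_const e).congr_deriv ?_
      simp [hM, modulusMap_apply, hx, hN, ha]
      ring
    · refine ((c0.mul c0').add (c1.mul c1')).congr_deriv ?_
      simp [hM, modulusMap_apply, hx, hN, hn₁, hns (v' t), hr₁, hr₂]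
      linear_combination hA
    · refine ((c0.mul c1').sub (c1.mul c0')).congr_deriv ?_
      simp [hM, modulusMap_apply, hx, hN, hn₂, hr₁, hr₂]
      linear_combination hB
  have t0 : ∀ i, Tendsto (fun t => v t i) atTop (𝓝 (vinf i)) := fun i =>
    ((EuclideanSpace.proj (𝕜 := ℝ) i).continuous.tendsto vinf).comp hlim
  have t0' : ∀ i, Tendsto (fun t => v' t i) atTop (𝓝 0) := fun i =>
    ((EuclideanSpace.proj (𝕜 := ℝ) i).continuous.tendsto (0 : Plane ℝ)).comp hlim'
  have hp0 : Tendsto p atTop (𝓝 0) := by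
    have := (((t0 0).pow 2).add ((t0 1).pow 2)).sub_const e
    rwa [← hes, sub_self] at this
  have ha0 : Tendsto a atTop (𝓝 0) := by
    simpa using ((t0 0).mul (t0' 0)).add ((t0 1).mul (t0' 1))
  have hb0 : Tendsto b atTop (𝓝 0) := by
    simpa using ((t0 0).mul (t0' 1)).sub ((t0 1).mul (t0' 0))
  have hx0 : Tendsto x atTop (𝓝 0) := by
    refine squeeze_zero_norm (fun t => norm_vec_three_le (p t) (a t) (b t)) ?_
    simpa using (hp0.abs.add ha0.abs).add hb0.abs
  have hxs : ∀ t, ‖x t‖ ^ 2 = p t ^ 2 + a t ^ 2 + b t ^ 2 := fun t => norm_vec_three_sq _ _ _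
  -- `|v|² |v'|² = ⟨v, v'⟩² + (v ∧ v')²`, and `|v|²` is bounded below near `+∞`
  have hv'x : ∀ᶠ t in atTop, ‖v' t‖ ^ 2 ≤ 2 / e * ‖x t‖ ^ 2 := by
    filter_upwards [hp0.eventually (lt_mem_nhds (show -(e / 2) < 0 by linarith))] with t ht
    have h1 : (e + p t) * ‖v' t‖ ^ 2 = a t ^ 2 + b t ^ 2 := by
      rw [hns]; simp only [hp, ha, hb]; ring
    rw [div_mul_eq_mul_div, le_div_iff₀ he0, hxs]
    nlinarith [sq_nonneg (p t), mul_nonneg (show 0 ≤ e / 2 + p t by linarith) (sq_nonneg ‖v' t‖)]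
  have hpx : p =O[atTop] x := by
    refine Asymptotics.IsBigO.of_bound 1 (.of_forall fun t => ?_)
    rw [one_mul]
    exact PiLp.norm_apply_le (x t) 0
  have hr : ∀ (G : ℝ → ℝ) (γ : ℝ), HasDerivAt G γ 0 → G 0 = 0 →
      (fun t => G (p t) - γ * p t) =o[atTop] x := by
    intro G γ hG h0
    have h1 := (hasDerivAt_iff_isLittleO.1 hG).comp_tendsto hp0
    refine (h1.congr (fun t => ?_) fun t => ?_).trans_isBigO hpx
    · simp [h0, mul_comm]
    · simp
  have hr₁o : r₁ =o[atTop] x := hr G₁ _ dG₁ (by simp [hG₁, hg1e])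
  have hr₂o : r₂ =o[atTop] x := hr G₂ _ dG₂ (by simp [hG₂, hg2e])
  have hv'o : (fun t => ‖v' t‖ ^ 2) =o[atTop] x := by
    refine Asymptotics.isLittleO_iff.2 fun ε hε => ?_
    have hx1 := hx0.norm
    rw [norm_zero] at hx1
    filter_upwards [hv'x, hx1.eventually (gt_mem_nhds (show 0 < ε * (e / 2) by positivity))]
      with t h1 h2
    rw [Real.norm_of_nonneg (sq_nonneg _)]
    refine h1.trans ?_
    rw [div_mul_eq_mul_div, div_le_iff₀ he0]
    nlinarith [norm_nonneg (x t)]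
  have hn₁o : n₁ =o[atTop] x := by
    refine (hv'o.sub (((hr₁o.const_mul_left α₁).add (hr₂o.const_mul_left α₂)).const_mul_left
      n⁻¹)).congr_left fun t => ?_
    simp only [hn₁]; ring
  have hn₂o : n₂ =o[atTop] x := by
    refine (((hr₂o.const_mul_left α₁).sub (hr₁o.const_mul_left α₂)).const_mul_left
      (-n⁻¹)).congr_left fun t => ?_
    simp only [hn₂]; ring
  have hNo : N =o[atTop] x := by
    refine Asymptotics.IsBigO.trans_isLittleO (g := fun t => |n₁ t| + |n₂ t|) ?_
      (hn₁o.norm_left.add hn₂o.norm_left)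
    refine Asymptotics.IsBigO.of_bound 1 (.of_forall fun t => ?_)
    rw [one_mul, Real.norm_of_nonneg (by positivity)]
    refine (norm_vec_three_le _ _ _).trans (le_of_eq ?_)
    rw [abs_zero, zero_add]
  -- the sign of the determinant is where `g₁'(|v_∞|²) < 0` and `c > 0` enter
  have hd : 0 < -(2 * (-((α₁ * γ₁ + α₂ * γ₂) * e / n) * -(c * α₁ / n)
      - -(c * α₂ / n) * -((α₁ * γ₂ - α₂ * γ₁) * e / n))) := by
    have h1 : -(2 * (-((α₁ * γ₁ + α₂ * γ₂) * e / n) * -(c * α₁ / n)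
      - -(c * α₂ / n) * -((α₁ * γ₂ - α₂ * γ₁) * e / n))) = 2 * c * e * (-γ₁) / n := by
      field_simp
      rw [hn]
      ring
    rw [h1]
    have : 0 < -γ₁ := neg_pos.2 hg'
    positivity
  have ha₂ : 0 ≤ -(-(c * α₁ / n) + -(c * α₁ / n)) := by
    have : 0 ≤ c * α₁ / n := by positivity
    linarith
  obtain ⟨K, hK, κ, hκ, T, hfin⟩ := exp_decay_of_cubic M ha₂ hd (modulusMap_cubic _ _ _ _ _ _)
    hde hNo hx0
  obtain ⟨T', hT'⟩ := hv'x.exists_forall_of_atTop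
  set K₁ := Real.sqrt (2 / e * K) with hK₁
  have hK₁0 : 0 < K₁ := Real.sqrt_pos.2 (by positivity)
  have h1 : ∀ t ≥ max T T', ‖v' t‖ ≤ K₁ * Real.exp (-(κ / 2 * t)) := by
    intro t ht
    refine le_sqrt_mul_exp (by positivity) ((hT' t ((le_max_right _ _).trans ht)).trans ?_)
    rw [mul_assoc]
    exact mul_le_mul_of_nonneg_left (hfin t ((le_max_left _ _).trans ht)) (by positivity)
  have h2 := norm_sub_le_of_exp_decay (half_pos hκ) hv hlim h1
  refine ⟨K₁ / (κ / 2) + K₁, by positivity, κ / 2, half_pos hκ, max T T', fun t ht => ?_⟩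
  rw [add_mul]
  exact add_le_add (h2 t ht) (h1 t ht)

end DecayAtTop

/-! ### The profile has a decay rate -/

section DecayRate

/-- A bounded function which eventually decays exponentially does so on `[0, ∞)`, with any smaller
rate. -/
theorem exp_decay_on_Ici {f : ℝ → ℝ} {B K κ T κ' : ℝ} (hB0 : 0 ≤ B) (hK : 0 ≤ K) (hκ' : 0 ≤ κ')
    (hle : κ' ≤ κ) (hB : ∀ t, f t ≤ B) (h : ∀ t ≥ T, f t ≤ K * Real.exp (-(κ * t))) :
    ∀ t ≥ 0, f t ≤ (K + B * Real.exp (κ * |T|)) * Real.exp (-(κ' * t)) := by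
  intro t ht
  rw [add_mul]
  rcases le_total T t with hT | hT
  · refine ((h t hT).trans ?_).trans (le_add_of_nonneg_right (by positivity))
    gcongr
  · refine ((hB t).trans ?_).trans (le_add_of_nonneg_left (by positivity))
    rw [mul_assoc, ← Real.exp_add]
    refine le_mul_of_one_le_right hB0 (Real.one_le_exp ?_)
    have h1 : κ' * t ≤ κ * |T| :=
      mul_le_mul hle (hT.trans (le_abs_self T)) ht (hκ'.trans hle)
    linarith

/-- The profile of a front converges exponentially. Both limits are zeros of the reaction term; the
decay of `v` and `v'` is passed on to the second and third derivative by the profile equation. -/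
theorem exists_decayRate {α₁ α₂ c freq : ℝ} {g₁ g₂ : ℝ → ℝ} {vstar : ℝ → Plane ℝ}
    {vinf : Plane ℝ} (hα : 0 < α₁) (hg₁ : ContDiff ℝ 3 g₁) (hg₂ : ContDiff ℝ 3 g₂) (hg0 : g₁ 0 < 0)
    (hfront : IsFront α₁ α₂ g₁ g₂ vstar c freq vinf) (hbdd : IsC2b vstar) (hc : 0 < c)
    (hg' : deriv g₁ (‖vinf‖ ^ 2) < 0) :
    ∃ μstar > 0, IsDecayRate vstar vinf μstar := by
  obtain ⟨hC2, -, hbot, htop, hne⟩ := id hfront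
  obtain ⟨B₀, hB₀⟩ := hbdd.2 0 (by norm_num)
  obtain ⟨B₁, hB₁⟩ := hbdd.2 1 (by norm_num)
  obtain ⟨B₂, hB₂⟩ := hbdd.2 2 le_rfl
  simp only [iteratedDeriv_zero] at hB₀
  simp only [iteratedDeriv_one] at hB₁
  have hB₀0 : 0 ≤ B₀ := (norm_nonneg _).trans (hB₀ 0)
  have hB₁0 : 0 ≤ B₁ := (norm_nonneg _).trans (hB₁ 0)
  have hBi : ‖vinf‖ ≤ B₀ := le_of_tendsto htop.norm (.of_forall hB₀)
  obtain ⟨L, hL, hDF, hLip⟩ := exists_reaction_bound freq hg₁ hg₂ B₀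
  have hv : ∀ x, HasDerivAt vstar (deriv vstar x) x := fun x =>
    (hC2.differentiable (by norm_num) x).hasDerivAt
  have hv' : ∀ x, HasDerivAt (deriv vstar) (iteratedDeriv 2 vstar x) x := fun x => by
    rw [iteratedDeriv_succ, iteratedDeriv_one]
    have hd : ContDiff ℝ 1 (deriv vstar) := (contDiff_succ_iff_deriv (n := 1).1 hC2).2.2
    exact (hd.differentiable (by norm_num) x).hasDerivAt
  have heq := hfront.profile_equation
  set D₁ := (c + L) / α₁ with hD₁
  have hD₁0 : 0 ≤ D₁ := by positivity
  have hdiv : ∀ {y s u w : ℝ}, α₁ * y ≤ c * u + L * w → u ≤ s → w ≤ s → y ≤ D₁ * s := by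
    intro y s u w h hu hw
    rw [hD₁, div_mul_eq_mul_div, le_div_iff₀ hα]
    nlinarith [mul_le_mul_of_nonneg_left hu hc.le, mul_le_mul_of_nonneg_left hw hL]
  have hsecond : ∀ w : Plane ℝ, ‖w‖ ≤ B₀ → reaction g₁ g₂ freq w = 0 → ∀ x,
      ‖iteratedDeriv 2 vstar x‖ ≤ D₁ * (‖vstar x - w‖ + ‖deriv vstar x‖) := by
    intro w hw hF x
    have h1 : actL ℝ (mulMat α₁ α₂) (iteratedDeriv 2 vstar x)
        = -(c • deriv vstar x + reaction g₁ g₂ freq (vstar x)) := by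
      have := heq x
      rw [add_assoc] at this
      exact eq_neg_of_add_eq_zero_left this
    have h2 := norm_le_norm_actL_mulMat α₁ α₂ (iteratedDeriv 2 vstar x)
    rw [h1, norm_neg] at h2
    have h3 := hLip (vstar x) w (hB₀ x) hw
    rw [hF, sub_zero] at h3
    have h4 : ‖c • deriv vstar x‖ = c * ‖deriv vstar x‖ := by
      rw [norm_smul, Real.norm_of_nonneg hc.le]
    exact hdiv (h2.trans ((norm_add_le _ _).trans (add_le_add h4.le h3)))
      (le_add_of_nonneg_left (norm_nonneg _)) (le_add_of_nonneg_right (norm_nonneg _))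
  have hthird : ∀ x, HasDerivAt (iteratedDeriv 2 vstar) (iteratedDeriv 3 vstar x) x ∧
      ‖iteratedDeriv 3 vstar x‖ ≤ D₁ * (‖iteratedDeriv 2 vstar x‖ + ‖deriv vstar x‖) := by
    intro x
    obtain ⟨w, hw, hAw⟩ := hfront.exists_hasDerivAt hα hg₁ hg₂ x
    have h3 : iteratedDeriv 3 vstar x = w := by rw [iteratedDeriv_succ, hw.deriv]
    rw [h3]
    refine ⟨hw, ?_⟩
    have h2 := norm_le_norm_actL_mulMat α₁ α₂ w
    rw [hAw, norm_neg] at h2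
    have h4 : ‖c • iteratedDeriv 2 vstar x‖ = c * ‖iteratedDeriv 2 vstar x‖ := by
      rw [norm_smul, Real.norm_of_nonneg hc.le]
    have h5 := ContinuousLinearMap.le_of_opNorm_le _ (hDF _ (hB₀ x)) (deriv vstar x)
    exact hdiv (h2.trans ((norm_add_le _ _).trans (add_le_add h4.le h5)))
      (le_add_of_nonneg_right (norm_nonneg _)) (le_add_of_nonneg_left (norm_nonneg _))
  have hlim' : Tendsto (deriv vstar) atTop (𝓝 0) := tendsto_deriv_zero hv hv' hB₂ htop
  have hlim'' : Tendsto (iteratedDeriv 2 vstar) atTop (𝓝 0) :=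
    tendsto_deriv_zero hv' (fun x => (hthird x).1) (B := D₁ * (B₂ + B₁)) (fun x =>
      (hthird x).2.trans (mul_le_mul_of_nonneg_left (add_le_add (hB₂ x) (hB₁ x)) hD₁0)) hlim'
  have hF0 : reaction g₁ g₂ freq 0 = 0 := by
    rw [reaction, map_zero, nonlin, map_zero, add_zero]
  have hFi : reaction g₁ g₂ freq vinf = 0 := by
    have hcont := (contDiff_reaction (freq := freq) hg₁ hg₂).continuous
    have h1 := (((actL ℝ (mulMat α₁ α₂)).continuous.tendsto 0).comp hlim'').add
      (hlim'.const_smul c) |>.add ((hcont.tendsto vinf).comp htop)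
    rw [map_zero, smul_zero, add_zero, zero_add] at h1
    refine tendsto_nhds_unique h1 ?_
    exact tendsto_const_nhds.congr fun x => (heq x).symm
  have hs0 := hsecond 0 (by rwa [norm_zero]) hF0
  simp only [sub_zero] at hs0
  obtain ⟨K₁, hK₁, κ₁, hκ₁, T₁, h₁⟩ := exp_decay_atBot hα hc hg₁.continuous hg0 hv hv' heq hB₁
    hD₁0 hs0 hbot
  obtain ⟨K₂, hK₂, κ₂, hκ₂, T₂, h₂⟩ := exp_decay_atTop hα hc (hg₁.differentiable (by norm_num))
    (hg₂.differentiable (by norm_num)) hv hv' heq htop hlim' hFi hne hg'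
  set D := 1 + D₁ + D₁ * (D₁ + 1) with hD
  have hD0 : 0 < D := by positivity
  have htot : ∀ w : Plane ℝ, ‖w‖ ≤ B₀ → reaction g₁ g₂ freq w = 0 → ∀ x,
      ‖vstar x - w‖ + ‖iteratedDeriv 1 vstar x‖ + ‖iteratedDeriv 2 vstar x‖
        + ‖iteratedDeriv 3 vstar x‖ ≤ D * (‖vstar x - w‖ + ‖deriv vstar x‖) := by
    intro w hw hF x
    rw [iteratedDeriv_one]
    have e2 := hsecond w hw hF x
    have e3 := (hthird x).2
    have e4 := mul_le_mul_of_nonneg_left e2 hD₁0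
    have e5 := mul_nonneg hD₁0 (norm_nonneg (vstar x - w))
    rw [hD]
    linarith
  have hbd : ∀ w : Plane ℝ, ‖w‖ ≤ B₀ → ∀ x, ‖vstar x - w‖ + ‖deriv vstar x‖ ≤ 2 * B₀ + B₁ := by
    intro w hw x
    linarith [norm_sub_le (vstar x) w, hB₀ x, hB₁ x]
  have hκ : 0 < min κ₁ κ₂ := lt_min hκ₁ hκ₂
  have d₁ := exp_decay_on_Ici (B := 2 * B₀ + B₁) (f := fun t => ‖vstar (-t)‖ + ‖deriv vstar (-t)‖)
    (by positivity) hK₁.le hκ.le (min_le_left κ₁ κ₂)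
    (fun t => by simpa using hbd 0 (by rwa [norm_zero]) (-t)) h₁
  have d₂ := exp_decay_on_Ici (by positivity) hK₂.le hκ.le (min_le_right κ₁ κ₂) (hbd vinf hBi) h₂
  set C₁ := K₁ + (2 * B₀ + B₁) * Real.exp (κ₁ * |T₁|)
  set C₂ := K₂ + (2 * B₀ + B₁) * Real.exp (κ₂ * |T₂|)
  have hC₁ : 0 < C₁ := by positivity
  have hC₂ : 0 < C₂ := by positivity
  refine ⟨min κ₁ κ₂, hκ, D * (C₁ + C₂), by positivity, fun x hx => ?_, fun x hx => ?_⟩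
  · refine (htot vinf hBi hFi x).trans ?_
    rw [mul_assoc]
    refine mul_le_mul_of_nonneg_left ((d₂ x hx).trans ?_) hD0.le
    gcongr
    linarith
  · have h1 := htot 0 (by rwa [norm_zero]) hF0 x
    rw [sub_zero] at h1
    refine h1.trans ?_
    rw [mul_assoc]
    have h2 := d₁ (-x) (by linarith)
    simp only [neg_neg, mul_neg] at h2
    refine mul_le_mul_of_nonneg_left (h2.trans ?_) hD0.le
    gcongr
    linarith

end DecayRate

end TOF

theorem lemma3p1 (α₁ α₂ : ℝ) (g₁ g₂ : ℝ → ℝ) (vstar : ℝ → TOF.Plane ℝ) (c freq : ℝ)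
    (vinf : TOF.Plane ℝ)
    (hα : 0 < α₁) (hg₁ : ContDiff ℝ 3 g₁) (hg₂ : ContDiff ℝ 3 g₂) (hg0 : g₁ 0 < 0)
    (hfront : TOF.IsFront α₁ α₂ g₁ g₂ vstar c freq vinf) (hbdd : TOF.IsC2b vstar) (hc : 0 < c)
    (hvinf : vinf = !₂[‖vinf‖, 0]) (hg' : deriv g₁ (‖vinf‖ ^ 2) < 0) :
    (∃ μstar > 0, TOF.IsDecayRate vstar vinf μstar) ∧
    ∀ μstar > 0, TOF.IsDecayRate vstar vinf μstar →
    ∀ μhat : ℝ, 0 < 2 * μhat → 2 * μhat ≤ μstar →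
    ∀ μ₂ : ℝ, 0 < μ₂ → μ₂ < 2 * μhat →
    ∃ ε₀ > 0, ∃ R₀ > 0, ∃ C > 0, ∀ μ : ℝ, 0 ≤ μ → μ ≤ μ₂ →
      -- `𝓛_η : Y_η ⊂ X_η → X_η` is closed and densely defined, over `ℝ` and over `ℂ`
      ((TOF.linOp ℝ α₁ α₂ g₁ g₂ vstar c freq vinf μ μhat).domain = TOF.sobX ℝ μ μhat 2 ∧
        (TOF.linOp ℝ α₁ α₂ g₁ g₂ vstar c freq vinf μ μhat).IsClosed ∧
        Dense (TOF.sobX ℝ μ μhat 2 : Set (TOF.SpaceX ℝ μ μhat))) ∧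
      ((TOF.linOp ℂ α₁ α₂ g₁ g₂ vstar c freq vinf μ μhat).domain = TOF.sobX ℂ μ μhat 2 ∧
        (TOF.linOp ℂ α₁ α₂ g₁ g₂ vstar c freq vinf μ μhat).IsClosed ∧
        Dense (TOF.sobX ℂ μ μhat 2 : Set (TOF.SpaceX ℂ μ μhat))) ∧
      ∀ s : ℂ, R₀ ≤ ‖s‖ → |s.arg| ≤ Real.pi / 2 + ε₀ →
        ∀ (v : (TOF.linOp ℂ α₁ α₂ g₁ g₂ vstar c freq vinf μ μhat).domain) (r : TOF.SpaceX ℂ μ μhat),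
          s • (v : TOF.SpaceX ℂ μ μhat) - TOF.linOp ℂ α₁ α₂ g₁ g₂ vstar c freq vinf μ μhat v = r →
          (‖s‖ * ‖(v : TOF.SpaceX ℂ μ μhat)‖ ^ 2
              + TOF.normL2w μ (TOF.weakDeriv 1 v.1.fn) ^ 2 ≤ C / ‖s‖ * ‖r‖ ^ 2) ∧
          (‖s‖ ^ 2 * ‖(v : TOF.SpaceX ℂ μ μhat)‖ ^ 2
              + ‖s‖ * TOF.normL2w μ (TOF.weakDeriv 1 v.1.fn) ^ 2
              + TOF.normL2w μ (TOF.weakDeriv 2 v.1.fn) ^ 2 ≤ C * ‖r‖ ^ 2) ∧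
          (r ∈ TOF.sobX ℂ μ μhat 1 → (v : TOF.SpaceX ℂ μ μhat) ∈ TOF.sobX ℂ μ μhat 3 →
            ‖s‖ ^ 2 * TOF.sobNorm 1 (v : TOF.SpaceX ℂ μ μhat) ^ 2
              + ‖s‖ * TOF.normL2w μ (TOF.weakDeriv 2 v.1.fn) ^ 2
              + TOF.normL2w μ (TOF.weakDeriv 3 v.1.fn) ^ 2
              ≤ C * TOF.sobNorm 1 r ^ 2) := by
  obtain ⟨hC2, hpde, hbot, htop, hne⟩ := id hfront
  refine ⟨TOF.exists_decayRate hα hg₁ hg₂ hg0 hfront hbdd hc hg', ?_⟩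
  intro μstar _ hdec μhat hμhat hle μ₂ _ hμ₂'
  have hμhat' : 0 < μhat := by linarith
  obtain ⟨M, b, hb⟩ := TOF.exists_isCoeff ℝ freq hg₁ hg₂ hbdd htop hdec hle
  obtain ⟨M', b', hb'⟩ := TOF.exists_isCoeff ℂ freq hg₁ hg₂ hbdd htop hdec hle
  obtain ⟨ε₀, hε₀, R₀, hR₀, C, hC, est⟩ :=
    TOF.linOp_resolvent_estimates (α₂ := α₂) (c := c) hα hμhat' hμ₂' hb'
  refine ⟨ε₀, hε₀, R₀, hR₀, C, hC, fun μ hμ hμ₂ =>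
    ⟨⟨TOF.linOp_domain hμ₂' hμ hμ₂ hb, TOF.linOp_isClosed hα hμhat' hμ₂' hμ hμ₂ hb,
      TOF.dense_sobX hμhat' hμ₂' hμ hμ₂⟩,
    ⟨TOF.linOp_domain hμ₂' hμ hμ₂ hb', TOF.linOp_isClosed hα hμhat' hμ₂' hμ hμ₂ hb',
      TOF.dense_sobX hμhat' hμ₂' hμ hμ₂⟩, ?_⟩⟩
  rintro s hs harg v r rfl
  refine est μ hμ hμ₂ s hs harg v _ ?_
  rw [← TOF.linOp_graph]
  exact LinearPMap.mem_graph _ v
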